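/- \textbf{Computational model.} A quantum algorithm is a single program (the same for all $n$) for a quantum random access machine with $w$-bit words. A classical word RAM (registers, arrays, branching and loops; unit-cost arithmetic, bitwise, shift and comparison operations on words) controls a quantum memory consisting of registers and arrays of words. The following also have unit cost: Hadamard and $T$ gates on a single qubit; reversible word operations $|x,y,z\rangle\mapsto|x\oplus(y\circ z),y,z\rangle$ on quantum registers; adding (bitwise modulo 2) a classical register to a quantum register; reading a classical array in superposition; exchanging a quantum register with an array cell of the quantum memory whose address is in superposition; measuring a quantum register; setting a classical array to zero; and discarding the quantum memory in exchange for a fresh one in the state zero. The entries of an input matrix $A$ are accessed through a unit-cost oracle, classically and in superposition, $|x,i,j\rangle\mapsto|x\oplus A[i,j],i,j\rangle$ (an entry of $\mathbb Z\cup\{\infty\}$ is given as a finiteness flag and a value, each read by one oracle call). An algorithm solves a problem in time $O(n^{e})$ if there are constants $\kappa\ge 1$ and $C$ such that for all $n\ge 1$, all word lengths $w\ge\kappa(\lfloor\log_2 n\rfloor+1)$ and all instances of size $n$, it halts on every computation branch after at most $Cn^{e}$ steps ($C$ independent of $w$), and its output is correct with probability at least $2/3$. \textbf{Problems.} All weights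 are integers, and finite weights in an instance of size $n$ have absolute value at most $n^{c}$, where $c$ is a constant. \begin{itemize} \item \emph{Minimum triangle}$_c$: given the symmetric weight matrix (with $\infty$ for non-edges and on the diagonal) of an undirected edge-weighted graph on $n$ vertices, output the three vertices of a triangle whose total edge weight is minimum, or report that there is no triangle. \item \emph{Distance product}$_c$: given $n\times n$ matrices $A,B$ over $\mathbb Z\cup\{\infty\}$, output the matrix $A\star B$ with $(A\star B)[i,j]=\min_k (A[i,k]+B[k,j])$. \item \emph{APSP}$_c$: given the weight matrix of a directed graph on $n$ vertices whose weights may be negative but which has no cycle of negative weight, output the matrix of all shortest path distances ($\infty$ for unreachable pairs). \end{itemize} \textbf{Corollary (minimum triangle and APSP).} Suppose that there is a constant $\varepsilon>0$ such that for every constant $c$, minimum triangle$_c$ has an $O(n^{1.5-\varepsilon})$ time quantum algorithm. Then there is a constant $\delta>0$ such that for every constant $c$, both distance product$_c$ and APSP$_c$ have an $O(n^{2.5-\delta})$ time quantum algorithm. (The algorithms and the constants in $O(\cdot)$ may depend on $c$.) -/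

import Mathlib

/-! ## A quantum word RAM

A machine with `w`-bit words consists of a classical word RAM (registers and arrays of words),
which also has a quantum memory (quantum registers and quantum arrays of words).  The classical
part controls the computation; it applies elementary gates to the quantum memory and may measure
it.  The input is accessible through an oracle, classically and in superposition. -/

/-- Binary operations on words. -/
inductive WordOp
  | add | sub | mul | udiv | umod | band | bor | bxor | shl | shr | eq | ult | slt

/-- Words are `w`-bit strings; `udiv`, `umod`, `ult` are unsigned, `slt` is the comparison of
signed (two's complement) integers, and comparisons return `0` or `1`. -/
def WordOp.eval {w : ℕ} : WordOp → BitVec w → BitVec w → BitVec w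
  | .add, x, y => x + y
  | .sub, x, y => x - y
  | .mul, x, y => x * y
  | .udiv, x, y => x / y
  | .umod, x, y => x % y
  | .band, x, y => x &&& y
  | .bor, x, y => x ||| y
  | .bxor, x, y => x ^^^ y
  | .shl, x, y => x <<< y
  | .shr, x, y => x >>> y
  | .eq, x, y => if x = y then 1 else 0
  | .ult, x, y => if x.toNat < y.toNat then 1 else 0
  | .slt, x, y => if x.toInt < y.toInt then 1 else 0

/-- The input oracle: `X k i j` is the word at position `(i, j)` of the `k`-th input table. -/
abbrev WordInput (w : ℕ) : Type := ℕ → BitVec w → BitVec w → BitVec w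

/-- A basis state of the quantum memory. -/
@[ext]
structure QBasis (w : ℕ) where
  reg : ℕ → BitVec w
  arr : ℕ → BitVec w → BitVec w

/-- The basis state in which every quantum cell contains `0`. -/
def QBasis.zero (w : ℕ) : QBasis w := ⟨fun _ => 0, fun _ _ => 0⟩

/-- Overwrite quantum register `x`. -/
def QBasis.setReg {w : ℕ} (b : QBasis w) (x : ℕ) (v : BitVec w) : QBasis w :=
  ⟨Function.update b.reg x v, b.arr⟩

/-- Add `v` bitwise modulo 2 to quantum register `x`. -/
def QBasis.xorReg {w : ℕ} (b : QBasis w) (x : ℕ) (v : BitVec w) : QBasis w :=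
  b.setReg x (b.reg x ^^^ v)

/-- Exchange quantum register `x` with the cell of quantum array `a` whose address is in quantum
register `y`. -/
def QBasis.swapCell {w : ℕ} (b : QBasis w) (a x y : ℕ) : QBasis w :=
  ⟨Function.update b.reg x (b.arr a (b.reg y)),
    Function.update b.arr a (Function.update (b.arr a) (b.reg y) (b.reg x))⟩

/-- Vectors of the quantum memory: finite superpositions of basis states.  They are not
normalised: the squared norm is the probability of the branch in which they occur. -/
abbrev QVec (w : ℕ) : Type := QBasis w →₀ ℂ

/-- The squared norm. -/
noncomputable def QVec.normSq {w : ℕ} (ψ : QVec w) : ℝ := ψ.sum fun _ z => ‖z‖ ^ 2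

/-- The image of a basis state under the Hadamard gate on the lowest bit of quantum register `x`:
`2^(-1/2) (|b ⊕ 1⟩ ± |b⟩)`, with sign `-` if that bit of `b` is `1`. -/
noncomputable def QBasis.hadamard {w : ℕ} (x : ℕ) (b : QBasis w) : QVec w :=
  ((Real.sqrt 2)⁻¹ : ℂ) •
    (Finsupp.single (b.xorReg x 1) 1
      + Finsupp.single b (if (b.reg x).getLsbD 0 then (-1 : ℂ) else 1))

/-- The image of a basis state under the `T` gate on the lowest bit of quantum register `x`: the
phase `exp (i π / 4)` if that bit is `1`. -/
noncomputable def QBasis.tGate {w : ℕ} (x : ℕ) (b : QBasis w) : QVec w :=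
  Finsupp.single b
    (if (b.reg x).getLsbD 0 then Complex.exp ((Real.pi / 4 : ℝ) * Complex.I) else 1)

/-- The (unnormalised) vector after a measurement of quantum register `x` with outcome `v`. -/
noncomputable def QVec.project {w : ℕ} (x : ℕ) (v : BitVec w) (ψ : QVec w) : QVec w :=
  ψ.filter fun b => b.reg x = v

/-- A branch of the computation: the contents of the classical memory, and the vector of the
quantum memory. -/
structure RamState (w : ℕ) where
  reg : ℕ → BitVec w
  arr : ℕ → BitVec w → BitVec w
  vec : QVec w

/-- Overwrite classical register `x`. -/
def RamState.setReg {w : ℕ} (s : RamState w) (x : ℕ) (v : BitVec w) : RamState w :=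
  { s with reg := Function.update s.reg x v }

/-- Overwrite classical array `a`. -/
def RamState.setArr {w : ℕ} (s : RamState w) (a : ℕ) (f : BitVec w → BitVec w) : RamState w :=
  { s with arr := Function.update s.arr a f }

/-- Apply to the quantum memory the linear map that permutes the basis states by `f`. -/
noncomputable def RamState.mapBasis {w : ℕ} (s : RamState w) (f : QBasis w → QBasis w) :
    RamState w :=
  { s with vec := s.vec.mapDomain f }

/-- Apply to the quantum memory the linear map that is given by `f` on basis states. -/
noncomputable def RamState.mapLinear {w : ℕ} (s : RamState w) (f : QBasis w → QVec w) :
    RamState w :=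
  { s with vec := Finsupp.linearCombination ℂ f s.vec }

/-- Instructions.  Registers and arrays are named by natural numbers; the names are fixed in the
program, whereas an address inside an array is the content of a register.  The side conditions
make the quantum gates reversible. -/
inductive Instr
  /-- `x := v` -/
  | const (x v : ℕ)
  /-- `x := y o z` -/
  | op (o : WordOp) (x y z : ℕ)
  /-- `x := a[y]` -/
  | load (x a y : ℕ)
  /-- `a[y] := x` -/
  | store (a y x : ℕ)
  /-- set every cell of the classical array `a` to `0` (constant-time array initialisation) -/
  | clear (a : ℕ)
  /-- `x := ` entry `(y, z)` of input table `k` -/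
  | query (k x y z : ℕ)
  /-- add (bitwise modulo 2) classical register `y` to quantum register `x` -/
  | qset (x y : ℕ)
  /-- `|x, y, z⟩ ↦ |x ⊕ (y o z), y, z⟩` on quantum registers -/
  | qop (o : WordOp) (x y z : ℕ) (hy : x ≠ y) (hz : x ≠ z)
  /-- `|x, y⟩ ↦ |x ⊕ a[y], y⟩`: read the classical array `a` in superposition -/
  | qload (x a y : ℕ) (hy : x ≠ y)
  /-- exchange quantum register `x` with cell `y` of the quantum array `a`, in superposition -/
  | qswap (a x y : ℕ) (hy : x ≠ y)
  /-- `|x, y, z⟩ ↦ |x ⊕ A_k[y, z], y, z⟩`: the input oracle in superposition -/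
  | qquery (k x y z : ℕ) (hy : x ≠ y) (hz : x ≠ z)
  /-- Hadamard gate on the lowest bit of quantum register `x` -/
  | had (x : ℕ)
  /-- `T` gate on the lowest bit of quantum register `x` -/
  | phase (x : ℕ)
  /-- measure quantum register `y` and put the outcome into classical register `x` -/
  | measure (x y : ℕ)
  /-- discard the quantum memory (that is, measure it and forget the outcome), and continue
  with a fresh quantum memory that contains zeros -/
  | reset

/-- The branches into which one instruction takes a branch. -/
noncomputable def Instr.exec {w : ℕ} (X : WordInput w) (s : RamState w) :
    Instr → Multiset (RamState w)
  | .const x v => {s.setReg x (BitVec.ofNat w v)}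
  | .op o x y z => {s.setReg x (o.eval (s.reg y) (s.reg z))}
  | .load x a y => {s.setReg x (s.arr a (s.reg y))}
  | .store a y x => {s.setArr a (Function.update (s.arr a) (s.reg y) (s.reg x))}
  | .clear a => {s.setArr a fun _ => 0}
  | .query k x y z => {s.setReg x (X k (s.reg y) (s.reg z))}
  | .qset x y => {s.mapBasis fun b => b.xorReg x (s.reg y)}
  | .qop o x y z _ _ => {s.mapBasis fun b => b.xorReg x (o.eval (b.reg y) (b.reg z))}
  | .qload x a y _ => {s.mapBasis fun b => b.xorReg x (s.arr a (b.reg y))}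
  | .qswap a x y _ => {s.mapBasis fun b => b.swapCell a x y}
  | .qquery k x y z _ _ => {s.mapBasis fun b => b.xorReg x (X k (b.reg y) (b.reg z))}
  | .had x => {s.mapLinear (QBasis.hadamard x)}
  | .phase x => {s.mapLinear (QBasis.tGate x)}
  | .measure x y =>
      (s.vec.support.image fun b => b.reg y).val.map fun v =>
        { s.setReg x v with vec := s.vec.project y v }
  | .reset =>
      s.vec.support.val.map fun b =>
        { s with vec := Finsupp.single (QBasis.zero w) (s.vec b) }

/-- Programs. -/
inductive QProgram
  | instr (i : Instr)
  | seq (p q : QProgram)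
  /-- if register `x` is not `0` then `p` else `q` -/
  | ite (x : ℕ) (p q : QProgram)
  /-- while register `x` is not `0` do `p` -/
  | loop (x : ℕ) (p : QProgram)

/-- One step of a branch, which is given by the list of the programs that remain to be executed
and by the state. -/
noncomputable def QProgram.step {w : ℕ} (X : WordInput w) :
    List QProgram × RamState w → Multiset (List QProgram × RamState w)
  | ([], s) => {([], s)}
  | (.instr i :: k, s) => (i.exec X s).map fun s' => (k, s')
  | (.seq p q :: k, s) => {(p :: q :: k, s)}
  | (.ite x p q :: k, s) => {((if s.reg x ≠ 0 then p else q) :: k, s)}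
  | (.loop x p :: k, s) => {(if s.reg x ≠ 0 then p :: .loop x p :: k else k, s)}

/-- At the start classical register `0` contains `n`, and everything else contains `0`. -/
noncomputable def RamState.init (w n : ℕ) : RamState w where
  reg := Function.update (fun _ => 0) 0 (BitVec.ofNat w n)
  arr := fun _ _ => 0
  vec := Finsupp.single (QBasis.zero w) 1

/-- The branches after `t` steps of the program `P` on parameter `n` and input `X`. -/
noncomputable def QProgram.run {w : ℕ} (P : QProgram) (n : ℕ) (X : WordInput w) (t : ℕ) :
    Multiset (List QProgram × RamState w) :=
  (fun M => M.bind (QProgram.step X))^[t] {([P], RamState.init w n)}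

/-- Every branch has halted after `t` steps. -/
def QProgram.HaltsWithin {w : ℕ} (P : QProgram) (n : ℕ) (X : WordInput w) (t : ℕ) : Prop :=
  ∀ c ∈ P.run n X t, c.1 = []

open Classical in
/-- The probability that after `t` steps the program has halted in a state with property `good`. -/
noncomputable def QProgram.successProb {w : ℕ} (P : QProgram) (n : ℕ) (X : WordInput w) (t : ℕ)
    (good : RamState w → Prop) : ℝ :=
  ((P.run n X t).map fun c =>
    if c.1 = [] ∧ good c.2 then c.2.vec.normSq else 0).sum

/-! ## Computational problems and their quantum time complexity -/

/-- A problem on instances with a size parameter `n`: how an instance is presented to a machine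
with `w`-bit words, and which final states contain a correct answer. -/
structure RamProblem where
  Inst : ℕ → Type
  input : ∀ (w : ℕ) {n : ℕ}, Inst n → WordInput w
  correct : ∀ {w n : ℕ}, Inst n → RamState w → Prop

/-- The problem has a quantum algorithm that runs in time `O(n ^ e)`: one program which, on words
of length at least a suitable constant times `log n`, always halts after `O(n ^ e)` steps, and whose
answer is correct with probability at least `2 / 3`.  The time bound must not depend on `w`. -/
def RamProblem.HasQuantumAlgorithm (Q : RamProblem) (e : ℝ) : Prop :=
  ∃ (P : QProgram) (κ : ℕ) (C : ℝ), 1 ≤ κ ∧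
    ∀ n : ℕ, 1 ≤ n → ∀ w : ℕ, κ * (Nat.log 2 n + 1) ≤ w → ∀ x : Q.Inst n, ∃ t : ℕ, (t : ℝ) ≤ C * (n : ℝ) ^ e ∧
      P.HaltsWithin n (Q.input w x) t ∧
      2 / 3 ≤ P.successProb n (Q.input w x) t (Q.correct x)

/-! ## Matrices with entries in `ℤ ∪ {∞}` -/

/-- Square matrices over `ℤ ∪ {∞}`; the rows and columns are numbered `0, …, n - 1`. -/
abbrev WMatrix (n : ℕ) : Type := Matrix (Fin n) (Fin n) (WithTop ℤ)

/-- All finite entries have absolute value at most `n ^ c`. -/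
def WMatrix.Bounded {n : ℕ} (c : ℕ) (A : WMatrix n) : Prop :=
  ∀ (i j : Fin n) (z : ℤ), A i j = (z : WithTop ℤ) → |z| ≤ (n : ℤ) ^ c

/-- The word that tells whether an entry is finite. -/
def finiteWord (w : ℕ) : WithTop ℤ → BitVec w
  | none => 0
  | some _ => 1

/-- The word that contains the value of a finite entry. -/
def valueWord (w : ℕ) : WithTop ℤ → BitVec w
  | none => 0
  | some z => BitVec.ofInt w z

/-- The entry whose position is given by two words (`∞` outside the matrix). -/
def WMatrix.entry {n w : ℕ} (A : WMatrix n) (i j : BitVec w) : WithTop ℤ :=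
  if h : i.toNat < n ∧ j.toNat < n then A ⟨i.toNat, h.1⟩ ⟨j.toNat, h.2⟩ else ⊤

/-- A matrix as an input: table `0` tells which entries are finite, table `1` contains their
values. -/
def WMatrix.toInput {n : ℕ} (A : WMatrix n) (w : ℕ) : WordInput w := fun k i j =>
  match k with
  | 0 => finiteWord w (A.entry i j)
  | 1 => valueWord w (A.entry i j)
  | _ => 0

/-- Two matrices as an input: tables `0`, `1` for the first one, `2`, `3` for the second one. -/
def WMatrix.toInput₂ {n : ℕ} (A B : WMatrix n) (w : ℕ) : WordInput w := fun k =>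
  if k < 2 then A.toInput w k else B.toInput w (k - 2)

/-- The final state contains the matrix `D`, row by row, in the classical arrays `0` (which entries
are finite) and `1` (their values). -/
def WMatrix.IsOutput {n w : ℕ} (D : WMatrix n) (s : RamState w) : Prop :=
  ∀ i j : Fin n,
    s.arr 0 (BitVec.ofNat w (i * n + j)) = finiteWord w (D i j) ∧
    s.arr 1 (BitVec.ofNat w (i * n + j)) = valueWord w (D i j)

/-! ## Minimum weight triangle, distance product, and all pairs shortest paths -/

/-- The weight matrix of an undirected edge weighted graph without loops (`∞` for non-edges). -/
def WMatrix.IsGraph {n : ℕ} (A : WMatrix n) : Prop := A.IsSymm ∧ ∀ i, A i i = ⊤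

/-- `i, j, k` are the vertices of a triangle of the graph. -/
def WMatrix.IsTriangle {n : ℕ} (A : WMatrix n) (i j k : Fin n) : Prop :=
  A i j ≠ ⊤ ∧ A j k ≠ ⊤ ∧ A i k ≠ ⊤

/-- `i, j, k` are the vertices of a triangle of minimum total weight. -/
def WMatrix.IsMinTriangle {n : ℕ} (A : WMatrix n) (i j k : Fin n) : Prop :=
  A.IsTriangle i j k ∧
    ∀ i' j' k' : Fin n, A.IsTriangle i' j' k' → A i j + A j k + A i k ≤ A i' j' + A j' k' + A i' k'

/-- Given an edge weighted graph, find a triangle of minimum weight: array `0` contains `1`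
followed by the three vertices, or `0` in its first cell if there is no triangle. -/
def minTriangle (c : ℕ) : RamProblem where
  Inst n := {A : WMatrix n // A.IsGraph ∧ A.Bounded c}
  input w _ A := A.1.toInput w
  correct {w _} A s :=
    (s.arr 0 0 = 1 ∧ ∃ i j k, A.1.IsMinTriangle i j k ∧
      s.arr 0 (BitVec.ofNat w 1) = BitVec.ofNat w i ∧
      s.arr 0 (BitVec.ofNat w 2) = BitVec.ofNat w j ∧
      s.arr 0 (BitVec.ofNat w 3) = BitVec.ofNat w k) ∨
    (s.arr 0 0 = 0 ∧ ¬ ∃ i j k, A.1.IsTriangle i j k)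

/-- `(A ⋆ B)[i, j] = min_k (A[i, k] + B[k, j])`. -/
def WMatrix.distProd {n : ℕ} (A B : WMatrix n) : WMatrix n :=
  Matrix.of fun i j => Finset.univ.inf fun k => A i k + B k j

/-- Given two matrices, compute their distance product. -/
def distanceProduct (c : ℕ) : RamProblem where
  Inst n := {AB : WMatrix n × WMatrix n // AB.1.Bounded c ∧ AB.2.Bounded c}
  input w _ AB := AB.1.1.toInput₂ AB.1.2 w
  correct AB s := (AB.1.1.distProd AB.1.2).IsOutput s

/-- The weight of the walk that starts at `i` and then visits the vertices in the list. -/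
def WMatrix.walkWeight {n : ℕ} (A : WMatrix n) : Fin n → List (Fin n) → WithTop ℤ
  | _, [] => 0
  | i, j :: l => A i j + A.walkWeight j l

/-- The weights of the walks from `i` to `j`, including the empty walk if `i = j`. -/
def WMatrix.walkWeights {n : ℕ} (A : WMatrix n) (i j : Fin n) : Set (WithTop ℤ) :=
  {x | ∃ l : List (Fin n), (i :: l).getLast (List.cons_ne_nil i l) = j ∧ A.walkWeight i l = x}

/-- The directed graph with weight matrix `A` has no cycle of negative weight. -/
def WMatrix.NoNegCycle {n : ℕ} (A : WMatrix n) : Prop :=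
  ∀ i, ∀ x ∈ A.walkWeights i i, 0 ≤ x

/-- `D` is the matrix of the shortest path distances of the directed graph with weight matrix `A`. -/
def WMatrix.IsDistanceMatrix {n : ℕ} (A D : WMatrix n) : Prop :=
  ∀ i j, IsLeast (A.walkWeights i j) (D i j)

/-- Given an edge weighted directed graph without negative cycles, compute all distances. -/
def allPairsShortestPaths (c : ℕ) : RamProblem where
  Inst n := {A : WMatrix n // A.NoNegCycle ∧ A.Bounded c}
  input w _ A := A.1.toInput w
  correct A s := ∃ D : WMatrix _, A.1.IsDistanceMatrix D ∧ D.IsOutput s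

/-! Shortest paths reduce to distance products by repeated squaring: if there is no negative cycle
and the diagonal is set to `0`, then after `s` squarings every entry is at most the weight of each
walk with at most `2 ^ s` edges, and shortest walks may be taken without repeated vertices. A single
product and a sequence of `bits n` squarings are treated together, as the sequence
`WMatrix.factors`.

For one product `A ⋆ B`, all entries are determined by simultaneous binary search. A round asks for
every pair `(i, j)` whether the entry is below a threshold `θ i j`. In a tripartite graph with
weights `-θ i j`, `A i k` and `B k j`, the answer is yes exactly if the edge `ij` lies in a triangle
of negative weight. With `m` about `n ^ (1/3)`, each part is padded to `N = m ^ 3` vertices and cut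
into `m ^ 2` blocks of `m` vertices, so there are `m ^ 6 = N ^ 2` triples of blocks. For one triple
after the other, a minimum triangle of the instance on `3 m` vertices is sought. If it is negative,
its edge between the first two parts is deleted and the same triple is tried again; a triple is left
after `r` unsuccessful attempts in a row. At most `N ^ 2` edges can be deleted and `N ^ 2` triples
must be left, so `2 * m ^ 6 * r` calls suffice. At `O(m ^ (3/2 - ε))` steps per call this amounts to
`n ^ (5/2 - ε/3)`, up to three logarithmic factors: the number of products, the number of rounds,
and `r`.

A call must not copy its `m ^ 2` weights, which would cost more than the call itself. Therefore the
oracle queries of the given algorithm are redirected to the one stored matrix: the address of an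
entry is the sum of a row offset and a column offset, taken from two tables that are prepared in
time `O(m)`. In superposition the address is computed in clean scratch registers, used, and
uncomputed. Between calls the classical memory of the algorithm is cleared and the quantum memory is
discarded. This splits the computation into branches, each of which holds a scalar multiple of the
initial vector.

The error is one-sided. A returned triangle is looked up in the matrix and acted upon only if its
weight is negative, so no deletion is ever wrong. Harm is done only by `r` failures in a row on a
triple that still contains a negative triangle, which has probability at most `(1/3) ^ r`. A
potential (`loss`) bounds the failure probability of the remaining iterations, and its expectation
does not increase. With `r = (c + 20) * bits n`, the sum over all iterations, rounds and products is
at most `1/3`.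

The argument is carried by `Simulates.exists_runs` (redirected programs), `tri_call` (one call as a
bound on an expectation), `MainInv.processed` and `MainInv.loss_le` (one iteration),
`MainInv.detected` (the end of the main loop), `RoundInv.next` (one round of the search),
`tri_squares` (products), `fullProgram_spec`, and the estimates `error_le` and `time_le`. -/

/-! ## Composition of runs -/

namespace QProgram

variable {w : ℕ} (X : WordInput w)

/-- The configurations that are reached after `t` steps. -/
noncomputable def outs (t : ℕ) (c : List QProgram × RamState w) :
    Multiset (List QProgram × RamState w) :=
  (fun M => M.bind (step X))^[t] {c}

/-- A stack of programs, started in state `s`, halts within `t` steps in the states `M`. -/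
def Runs (k : List QProgram) (s : RamState w) (t : ℕ) (M : Multiset (RamState w)) : Prop :=
  outs X t (k, s) = M.map fun s' => ([], s')

variable {X}

theorem iterate_bind_eq (t : ℕ) (M : Multiset (List QProgram × RamState w)) :
    (fun M => M.bind (step X))^[t] M = M.bind (outs X t) := by
  induction t generalizing M with
  | zero =>
    exact ((Multiset.bind_singleton M id).trans (Multiset.map_id M)).symm
  | succ t ih =>
    rw [Function.iterate_succ_apply, ih, Multiset.bind_assoc]
    congr 1
    funext c
    simp only [outs, Function.iterate_succ_apply, Multiset.singleton_bind]
    rw [ih]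

theorem outs_zero (c : List QProgram × RamState w) : outs X 0 c = {c} := rfl

theorem outs_succ (t : ℕ) (c : List QProgram × RamState w) :
    outs X (t + 1) c = (step X c).bind (outs X t) := by
  rw [outs, Function.iterate_succ_apply, Multiset.singleton_bind, iterate_bind_eq]

theorem outs_nil (t : ℕ) (s : RamState w) : outs X t ([], s) = {([], s)} := by
  induction t with
  | zero => rfl
  | succ t ih => rw [outs_succ]; simp [step, ih]

theorem run_eq_outs (P : QProgram) (n : ℕ) (t : ℕ) :
    P.run n X t = outs X t ([P], RamState.init w n) := rfl

/-- Running a stack on top of another one. -/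
theorem step_append {k : List QProgram} (hk : k ≠ []) (k' : List QProgram) (s : RamState w) :
    step X (k ++ k', s) = (step X (k, s)).map fun c => (c.1 ++ k', c.2) := by
  match k, hk with
  | .instr i :: k, _ => simp [step]
  | .seq p q :: k, _ => simp [step]
  | .ite x p q :: k, _ => simp [step]
  | .loop x p :: k, _ => by_cases h : s.reg x = 0 <;> simp only [step, List.cons_append, Multiset.map_singleton, h, ne_eq, not_true_eq_false, not_false_eq_true, if_true, if_false]

theorem injective_halted : Function.Injective fun s : RamState w => (([] : List QProgram), s) :=
  fun _ _ h => (Prod.ext_iff.1 h).2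

theorem Runs.nil (s : RamState w) (t : ℕ) : Runs X [] s t {s} := by
  simp [Runs, outs_nil]

theorem Runs.nil_eq {s : RamState w} {t : ℕ} {M} (h : Runs X [] s t M) : M = {s} := by
  rw [Runs, outs_nil] at h
  exact (Multiset.map_injective injective_halted (by simpa using h)).symm

/-- If all configurations after `t` steps have halted then they arise from a run. -/
theorem exists_runs {k : List QProgram} {s : RamState w} {t : ℕ}
    (h : ∀ c ∈ outs X t (k, s), c.1 = []) : Runs X k s t ((outs X t (k, s)).map Prod.snd) := by
  rw [Runs, Multiset.map_map]
  conv_lhs => rw [← Multiset.map_id (outs X t (k, s))]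
  refine Multiset.map_congr rfl fun c hc => ?_
  exact Prod.ext (h c hc) rfl

theorem Runs.halted {k : List QProgram} {s : RamState w} {t : ℕ} {M} (h : Runs X k s t M) :
    ∀ c ∈ outs X t (k, s), c.1 = [] := by
  rw [Runs] at h
  rw [h]
  simp

theorem Runs.eq_map {k : List QProgram} {s : RamState w} {t : ℕ} {M} (h : Runs X k s t M) :
    M = (outs X t (k, s)).map Prod.snd := by
  rw [Runs] at h
  rw [h]
  simp

/-- A run of positive length is composed of one step and runs of its results. -/
theorem runs_succ {k : List QProgram} {s : RamState w} {t : ℕ} {M} (h : Runs X k s (t + 1) M) :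
    ∃ F : List QProgram × RamState w → Multiset (RamState w),
      M = (step X (k, s)).bind F ∧ ∀ c ∈ step X (k, s), Runs X c.1 c.2 t (F c) := by
  refine ⟨fun c => (outs X t c).map Prod.snd, ?_, fun c hc => exists_runs fun d hd => ?_⟩
  · rw [h.eq_map, outs_succ, Multiset.map_bind]
  · exact h.halted d (by rw [outs_succ]; exact Multiset.mem_bind.2 ⟨c, hc, hd⟩)

theorem Runs.of_step {k : List QProgram} {s : RamState w} {t : ℕ}
    {F : List QProgram × RamState w → Multiset (RamState w)}
    (h : ∀ c ∈ step X (k, s), Runs X c.1 c.2 t (F c)) :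
    Runs X k s (t + 1) ((step X (k, s)).bind F) := by
  rw [Runs, outs_succ, Multiset.map_bind]
  exact Multiset.bind_congr fun c hc => h c hc

/-- If a stack reaches, in one step, another one. -/
theorem Runs.of_step_singleton {k k' : List QProgram} {s s' : RamState w} {t : ℕ} {M}
    (h : step X (k, s) = {(k', s')}) (h' : Runs X k' s' t M) : Runs X k s (t + 1) M := by
  have := Runs.of_step (X := X) (k := k) (s := s) (t := t) (F := fun _ => M)
    (by rw [h]; simpa using h')
  rwa [h, Multiset.singleton_bind] at this

/-- Branches may halt before time `t`, and then the second stack receives the unused steps. The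
quantifier over the slack `d` accounts for this; that a run may be given more time is itself a
consequence of this lemma (`Runs.mono`). -/
theorem Runs.append {k k' : List QProgram} {s : RamState w} {t t' : ℕ} {M}
    {F : RamState w → Multiset (RamState w)} (h : Runs X k s t M)
    (h' : ∀ s' ∈ M, ∀ d, Runs X k' s' (t' + d) (F s')) : Runs X (k ++ k') s (t + t') (M.bind F) := by
  induction t generalizing k s M with
  | zero =>
    rw [Runs, outs_zero] at h
    obtain ⟨s', hM, hs⟩ := Multiset.map_eq_singleton.1 h.symm
    obtain ⟨rfl, rfl⟩ := Prod.ext_iff.1 hs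
    subst hM
    simpa using h' s' (by simp) 0
  | succ t ih =>
    by_cases hk : k = []
    · subst hk
      obtain rfl := h.nil_eq
      -- The first stack is already empty, so its whole remaining allowance becomes slack of the
      -- second one.
      have := h' s (by simp) (t + 1)
      rw [Multiset.singleton_bind]
      rwa [show t' + (t + 1) = t + 1 + t' by omega] at this
    · obtain ⟨G, rfl, hG⟩ := runs_succ h
      have key : Runs X (k ++ k') s (t + t' + 1) ((step X (k ++ k', s)).bind
          fun c => ((outs X (t + t') c).map Prod.snd)) := by
        refine Runs.of_step fun c hc => exists_runs ?_
        rw [step_append hk] at hc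
        obtain ⟨c, hc', rfl⟩ := Multiset.mem_map.1 hc
        exact (ih (hG c hc') fun s' hs' => h' s' (Multiset.mem_bind.2 ⟨c, hc', hs'⟩)).halted
      have e : t + 1 + t' = t + t' + 1 := by omega
      rw [e]
      convert key using 1
      rw [step_append hk, Multiset.bind_map, Multiset.bind_assoc]
      refine Multiset.bind_congr fun c hc => ?_
      exact (ih (hG c hc) fun s' hs' => h' s' (Multiset.mem_bind.2 ⟨c, hc, hs'⟩)).eq_map

theorem Runs.mono {k : List QProgram} {s : RamState w} {t t' : ℕ} {M} (h : Runs X k s t M)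
    (ht : t ≤ t') : Runs X k s t' M := by
  obtain ⟨d, rfl⟩ := Nat.exists_eq_add_of_le ht
  have := h.append (k' := []) (t' := d) (F := fun s => {s}) fun s' _ _ => Runs.nil s' _
  rwa [List.append_nil, Multiset.bind_singleton, Multiset.map_id'] at this

theorem Runs.append' {k k' : List QProgram} {s : RamState w} {t t' : ℕ} {M}
    {F : RamState w → Multiset (RamState w)} (h : Runs X k s t M)
    (h' : ∀ s' ∈ M, Runs X k' s' t' (F s')) : Runs X (k ++ k') s (t + t') (M.bind F) :=
  h.append fun s' hs' _ => (h' s' hs').mono (Nat.le_add_right _ _)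

theorem Runs.cons {p : QProgram} {k : List QProgram} {s : RamState w} {t t' : ℕ} {M}
    {F : RamState w → Multiset (RamState w)} (h : Runs X [p] s t M)
    (h' : ∀ s' ∈ M, Runs X k s' t' (F s')) : Runs X (p :: k) s (t + t') (M.bind F) :=
  h.append' h'

/-- Branches carry labels, such as a simulated state or an integer state, and the continuation is
described in terms of the label. This is harmless since the outcome of a run is determined by the
machine state alone. -/
theorem Runs.cons_map {ι : Type*} {p : QProgram} {k : List QProgram} {s : RamState w} {t t' : ℕ}
    {M : Multiset ι} {g : ι → RamState w} {G : ι → Multiset (RamState w)}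
    (h : Runs X [p] s t (M.map g)) (h' : ∀ e ∈ M, Runs X k (g e) t' (G e)) :
    Runs X (p :: k) s (t + t') (M.bind G) := by
  have := h.cons (k := k) (t' := t') (F := fun s' => (outs X t' (k, s')).map Prod.snd) fun s' hs' => by
    obtain ⟨e, he, rfl⟩ := Multiset.mem_map.1 hs'
    exact exists_runs (h' e he).halted
  rwa [Multiset.bind_map, Multiset.bind_congr fun e he => ((h' e he).eq_map).symm] at this

theorem Runs.instr (i : Instr) (s : RamState w) : Runs X [.instr i] s 1 (i.exec X s) := by
  rw [Runs, outs_succ]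
  simp [step, Multiset.bind_map, outs_zero, Multiset.bind_singleton]

theorem Runs.seq {p q : QProgram} {s : RamState w} {t t' : ℕ} {M}
    {F : RamState w → Multiset (RamState w)} (h : Runs X [p] s t M)
    (h' : ∀ s' ∈ M, Runs X [q] s' t' (F s')) :
    Runs X [.seq p q] s (t + t' + 1) (M.bind F) :=
  Runs.of_step_singleton rfl (h.cons h')

theorem Runs.loop_zero {x : ℕ} {p : QProgram} {s : RamState w} (h : s.reg x = 0) :
    Runs X [.loop x p] s 1 {s} :=
  Runs.of_step_singleton (k' := []) (s' := s) (by simp only [step, h, ne_eq, not_true_eq_false, if_false])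
    (Runs.nil s 0)

theorem Runs.loop_succ {x : ℕ} {p : QProgram} {s : RamState w} {t t' : ℕ} {M}
    {F : RamState w → Multiset (RamState w)} (hx : s.reg x ≠ 0) (h : Runs X [p] s t M)
    (h' : ∀ s' ∈ M, Runs X [.loop x p] s' t' (F s')) :
    Runs X [.loop x p] s (t + t' + 1) (M.bind F) :=
  Runs.of_step_singleton (k' := [p, .loop x p]) (s' := s) (by simp only [step, if_pos hx])
    (h.cons h')

end QProgram

/-! ## Conservation of probability -/

namespace QBasis

variable {w : ℕ}

theorem xorReg_reg_ne (b : QBasis w) {x y : ℕ} (h : x ≠ y) (v : BitVec w) :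
    (b.xorReg x v).reg y = b.reg y :=
  Function.update_of_ne h.symm _ _

theorem xorReg_reg_self (b : QBasis w) (x : ℕ) (v : BitVec w) :
    (b.xorReg x v).reg x = b.reg x ^^^ v :=
  Function.update_self _ _ _

theorem xorReg_xorReg (b : QBasis w) (x : ℕ) (u v : BitVec w) :
    (b.xorReg x u).xorReg x v = b.xorReg x (u ^^^ v) := by
  simp [xorReg, setReg, BitVec.xor_assoc]

theorem xorReg_zero (b : QBasis w) (x : ℕ) : b.xorReg x 0 = b := by
  simp [xorReg, setReg]

theorem xorReg_xorReg_self (b : QBasis w) (x : ℕ) (v : BitVec w) :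
    (b.xorReg x v).xorReg x v = b := by
  rw [xorReg_xorReg, BitVec.xor_self]; exact xorReg_zero b x

/-- A gate that adds to register `x` a value that does not depend on `x` is reversible. -/
theorem xorReg_involutive (x : ℕ) (f : QBasis w → BitVec w)
    (hf : ∀ b v, f (b.xorReg x v) = f b) : Function.Involutive fun b : QBasis w => b.xorReg x (f b) := by
  intro b
  simp only [hf, xorReg_xorReg_self]

theorem swapCell_involutive (a : ℕ) {x y : ℕ} (h : x ≠ y) :
    Function.Involutive fun b : QBasis w => b.swapCell a x y := by
  intro b
  simp [swapCell, Function.update_of_ne h.symm]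

end QBasis

namespace QVec

variable {w : ℕ}

theorem normSq_eq_sum (ψ : QVec w) {S : Finset (QBasis w)} (h : ψ.support ⊆ S) :
    ψ.normSq = ∑ b ∈ S, ‖ψ b‖ ^ 2 :=
  Finsupp.sum_of_support_subset ψ h _ (by simp)

theorem normSq_nonneg (ψ : QVec w) : 0 ≤ ψ.normSq :=
  Finset.sum_nonneg fun _ _ => by positivity

theorem normSq_single (b : QBasis w) (z : ℂ) : normSq (Finsupp.single b z) = ‖z‖ ^ 2 := by
  simp [normSq]

theorem normSq_mapDomain (ψ : QVec w) {f : QBasis w → QBasis w} (hf : f.Injective) :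
    normSq (ψ.mapDomain f) = ψ.normSq :=
  Finsupp.sum_mapDomain_index_inj hf

theorem normSq_smul (α : ℂ) (ψ : QVec w) : normSq (α • ψ) = ‖α‖ ^ 2 * ψ.normSq := by
  rw [normSq_eq_sum (α • ψ) Finsupp.support_smul, normSq_eq_sum ψ subset_rfl, Finset.mul_sum]
  simp [mul_pow]

theorem normSq_tGate (ψ : QVec w) (x : ℕ) :
    normSq (Finsupp.linearCombination ℂ (QBasis.tGate x) ψ) = ψ.normSq := by
  classical
  have h : ∀ b, (Finsupp.linearCombination ℂ (QBasis.tGate x) ψ) b = ψ b *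
      (if (b.reg x).getLsbD 0 then Complex.exp ((Real.pi / 4 : ℝ) * Complex.I) else 1) := by
    intro b
    rw [Finsupp.linearCombination_apply, Finsupp.sum_apply, Finsupp.sum,
      Finset.sum_eq_single b]
    · simp [QBasis.tGate]
    · intro b' _ hb'
      simp [QBasis.tGate, hb']
    · intro hb
      simp [Finsupp.notMem_support_iff.1 hb]
  rw [normSq_eq_sum (S := ψ.support), normSq_eq_sum ψ subset_rfl]
  · refine Finset.sum_congr rfl fun b _ => ?_
    rw [h]
    split_ifs
    · rw [norm_mul, Complex.norm_exp_ofReal_mul_I, mul_one]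
    · simp
  · intro b hb
    rw [Finsupp.mem_support_iff, h] at hb
    exact Finsupp.mem_support_iff.2 (left_ne_zero_of_mul hb)

/-- Flipping the lowest bit is an involution `f` of the basis that reverses the sign `g`. In the sum
of the squared norms the cross terms at `b` and `f b` cancel. At word length `0` there would be no
bit to flip. -/
theorem normSq_hadamard (hw : 1 ≤ w) (ψ : QVec w) (x : ℕ) :
    normSq (Finsupp.linearCombination ℂ (QBasis.hadamard x) ψ) = ψ.normSq := by
  classical
  set f : QBasis w → QBasis w := fun b => b.xorReg x 1 with hf
  have ff : ∀ b, f (f b) = b := fun b => b.xorReg_xorReg_self x 1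
  set g : QBasis w → ℂ := fun b => if (b.reg x).getLsbD 0 then -1 else 1 with hg
  have gf : ∀ b, g (f b) = - g b := by
    intro b
    have : ((f b).reg x).getLsbD 0 = !(b.reg x).getLsbD 0 := by
      rw [hf, QBasis.xorReg_reg_self, BitVec.getLsbD_xor]
      have hw' : 0 < w := hw
      simp [hw']
    simp only [hg, this]
    cases (b.reg x).getLsbD 0 <;> simp
  have gn : ∀ b, ‖g b‖ = 1 := fun b => by simp only [hg]; split_ifs <;> simp
  set c : ℂ := ((Real.sqrt 2)⁻¹ : ℂ) with hc
  -- A finite set that is closed under `f` and contains the supports before and after the gate, so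
  -- that sums over it can be reindexed by `f`.
  set S := ψ.support ∪ ψ.support.image f with hS
  have hSf : ∀ b ∈ S, f b ∈ S := by
    intro b hb
    rcases Finset.mem_union.1 hb with h | h
    · exact Finset.mem_union_right _ (Finset.mem_image_of_mem f h)
    · obtain ⟨b', h', rfl⟩ := Finset.mem_image.1 h
      rw [ff]; exact Finset.mem_union_left _ h'
  have h : ∀ b, (Finsupp.linearCombination ℂ (QBasis.hadamard x) ψ) b =
      c * (ψ (f b) + g b * ψ b) := by
    intro b
    rw [Finsupp.linearCombination_apply, Finsupp.sum_apply,
      Finsupp.sum_of_support_subset ψ (s := insert b (insert (f b) ψ.support))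
        (by intro; simp +contextual) _ (by simp)]
    have : ∀ b' ∈ insert b (insert (f b) ψ.support), (ψ b' • QBasis.hadamard x b') b =
        (if b' = f b then c * ψ (f b) else 0) + (if b' = b then c * (g b * ψ b) else 0) := by
      intro b' _
      have e1 : (f b' = b) ↔ (b' = f b) := ⟨fun h => by rw [← h, ff], fun h => by rw [h, ff]⟩
      simp only [QBasis.hadamard, Finsupp.smul_apply, Finsupp.add_apply, Finsupp.single_apply,
        smul_eq_mul]
      change ψ b' * (c * ((if f b' = b then 1 else 0) + (if b' = b then g b' else 0))) = _
      simp only [e1]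
      by_cases h1 : b' = f b <;> by_cases h2 : b' = b
      · subst h2; simp only [if_true, ← h1]; ring
      · subst h1; simp only [if_true, if_neg h2]; ring
      · subst h2; simp only [if_true, if_neg h1]; ring
      · simp [h1, h2]
    rw [Finset.sum_congr rfl this, Finset.sum_add_distrib, Finset.sum_ite_eq', Finset.sum_ite_eq']
    simp; ring
  have hsub : (Finsupp.linearCombination ℂ (QBasis.hadamard x) ψ).support ⊆ S := by
    intro b hb
    by_contra hbS
    have h1 : ψ b = 0 := Finsupp.notMem_support_iff.1 fun h' => hbS (Finset.mem_union_left _ h')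
    have h2 : ψ (f b) = 0 := Finsupp.notMem_support_iff.1 fun h' =>
      hbS (ff b ▸ Finset.mem_union_right _ (Finset.mem_image_of_mem f h'))
    rw [Finsupp.mem_support_iff, h, h1, h2] at hb
    simp at hb
  have reindex : ∀ F : QBasis w → ℝ, ∑ b ∈ S, F (f b) = ∑ b ∈ S, F b := fun F =>
    Finset.sum_bij' (fun b _ => f b) (fun b _ => f b) hSf hSf (fun b _ => ff b) (fun b _ => ff b)
      fun _ _ => rfl
  -- The cross term. Replacing `b` by `f b` conjugates the product and changes its sign, so the real
  -- parts add up to `0`.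
  set C : QBasis w → ℝ := fun b => (ψ (f b) * (starRingEnd ℂ) (g b * ψ b)).re with hC
  have hC0 : ∑ b ∈ S, C b = 0 := by
    have : ∑ b ∈ S, C b = - ∑ b ∈ S, C b := by
      conv_lhs => rw [← reindex C]
      rw [← Finset.sum_neg_distrib]
      refine Finset.sum_congr rfl fun b _ => ?_
      simp only [hC, ff, gf]
      have : g b = 1 ∨ g b = -1 := by simp only [hg]; split_ifs <;> simp
      rcases this with h' | h' <;> rw [h'] <;> simp [Complex.mul_re] <;> ring
    linarith
  have hc2 : ‖c‖ ^ 2 = 1 / 2 := by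
    rw [hc, ← Complex.ofReal_inv, Complex.norm_real, Real.norm_eq_abs, sq_abs, inv_pow,
      Real.sq_sqrt (by norm_num)]
    norm_num
  rw [normSq_eq_sum _ hsub, normSq_eq_sum ψ (S := S) Finset.subset_union_left]
  have : ∀ b ∈ S, ‖(Finsupp.linearCombination ℂ (QBasis.hadamard x) ψ) b‖ ^ 2 =
      1 / 2 * ‖ψ (f b)‖ ^ 2 + 1 / 2 * ‖ψ b‖ ^ 2 + C b := by
    intro b _
    rw [h, norm_mul, mul_pow, hc2, ← Complex.normSq_eq_norm_sq, Complex.normSq_add,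
      Complex.normSq_eq_norm_sq, Complex.normSq_eq_norm_sq, norm_mul, gn, one_mul]
    simp only [hC]; ring
  rw [Finset.sum_congr rfl this, Finset.sum_add_distrib, Finset.sum_add_distrib, hC0,
    ← Finset.mul_sum, ← Finset.mul_sum, reindex fun b => ‖ψ b‖ ^ 2]
  ring

theorem sum_normSq_project (ψ : QVec w) (y : ℕ) :
    ∑ v ∈ ψ.support.image (fun b => b.reg y), (ψ.project y v).normSq = ψ.normSq := by
  classical
  rw [normSq_eq_sum ψ subset_rfl,
    ← Finset.sum_fiberwise_of_maps_to (g := fun b : QBasis w => b.reg y)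
      (t := ψ.support.image fun b : QBasis w => b.reg y) fun b hb => Finset.mem_image_of_mem _ hb]
  refine Finset.sum_congr rfl fun v _ => ?_
  rw [project, normSq, Finsupp.sum, Finsupp.support_filter]
  refine Finset.sum_congr rfl fun b hb => ?_
  rw [Finsupp.filter_apply_pos (fun b : QBasis w => b.reg y = v) ψ (Finset.mem_filter.1 hb).2]

end QVec

/-- Word gates permute the basis, being involutions thanks to the side conditions of the
instructions. A measurement partitions the support by outcome, and `reset` partitions it into single
basis states. Hence the squared norms of the branches behave as probabilities. -/
theorem Instr.sum_normSq_exec {w : ℕ} (hw : 1 ≤ w) (X : WordInput w) (i : Instr) (s : RamState w) :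
    ((i.exec X s).map fun s' => s'.vec.normSq).sum = s.vec.normSq := by
  cases i with
  | qset x y =>
    simpa [exec, RamState.mapBasis] using QVec.normSq_mapDomain _
      (QBasis.xorReg_involutive x (fun _ => s.reg y) fun _ _ => rfl).injective
  | qop o x y z hy hz =>
    simpa [exec, RamState.mapBasis] using QVec.normSq_mapDomain _
      (QBasis.xorReg_involutive x (fun b => o.eval (b.reg y) (b.reg z)) fun b v => by
        rw [b.xorReg_reg_ne hy, b.xorReg_reg_ne hz]).injective
  | qload x a y hy =>
    simpa [exec, RamState.mapBasis] using QVec.normSq_mapDomain _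
      (QBasis.xorReg_involutive x (fun b => s.arr a (b.reg y)) fun b v => by
        rw [b.xorReg_reg_ne hy]).injective
  | qquery k x y z hy hz =>
    simpa [exec, RamState.mapBasis] using QVec.normSq_mapDomain _
      (QBasis.xorReg_involutive x (fun b => X k (b.reg y) (b.reg z)) fun b v => by
        rw [b.xorReg_reg_ne hy, b.xorReg_reg_ne hz]).injective
  | qswap a x y hy =>
    simpa [exec, RamState.mapBasis] using QVec.normSq_mapDomain _
      (QBasis.swapCell_involutive a hy).injective
  | had x => simpa [exec, RamState.mapLinear] using QVec.normSq_hadamard hw _ x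
  | phase x => simpa [exec, RamState.mapLinear] using QVec.normSq_tGate _ x
  | measure x y =>
    rw [exec, Multiset.map_map]
    exact QVec.sum_normSq_project s.vec y
  | reset =>
    rw [exec, Multiset.map_map, QVec.normSq_eq_sum s.vec subset_rfl]
    exact congrArg Multiset.sum (Multiset.map_congr rfl fun b _ => QVec.normSq_single _ _)
  | _ => simp [exec, RamState.setReg, RamState.setArr]

namespace QProgram

variable {w : ℕ} {X : WordInput w}

theorem sum_normSq_step (hw : 1 ≤ w) (c : List QProgram × RamState w) :
    ((step X c).map fun c' => c'.2.vec.normSq).sum = c.2.vec.normSq := by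
  match c with
  | ([], s) => simp [step]
  | (.instr i :: k, s) => simpa [step] using i.sum_normSq_exec hw X s
  | (.seq p q :: k, s) => simp [step]
  | (.ite x p q :: k, s) => simp [step]
  | (.loop x p :: k, s) => simp [step]

theorem sum_normSq_outs (hw : 1 ≤ w) (t : ℕ) (c : List QProgram × RamState w) :
    ((outs X t c).map fun c' => c'.2.vec.normSq).sum = c.2.vec.normSq := by
  induction t generalizing c with
  | zero => simp [outs_zero]
  | succ t ih =>
    rw [outs_succ, Multiset.map_bind, Multiset.sum_bind, ← sum_normSq_step hw c]
    exact congrArg Multiset.sum (Multiset.map_congr rfl fun c' _ => ih c')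

theorem Runs.sum_normSq (hw : 1 ≤ w) {k : List QProgram} {s : RamState w} {t : ℕ} {M}
    (h : Runs X k s t M) : (M.map fun s' => s'.vec.normSq).sum = s.vec.normSq := by
  rw [h.eq_map, Multiset.map_map]
  exact sum_normSq_outs hw t (k, s)

end QProgram

/-! ## Running a program on an input that is stored in classical arrays -/

/-- A number above all names of registers and arrays in an instruction. -/
def Instr.bound : Instr → ℕ
  | .const x _ => x + 1
  | .op _ x y z => x + y + z + 1
  | .load x a y => x + a + y + 1
  | .store a y x => x + a + y + 1
  | .clear a => a + 1
  | .query _ x y z => x + y + z + 1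
  | .qset x y => x + y + 1
  | .qop _ x y z _ _ => x + y + z + 1
  | .qload x a y _ => x + a + y + 1
  | .qswap a x y _ => x + a + y + 1
  | .qquery _ x y z _ _ => x + y + z + 1
  | .had x => x + 1
  | .phase x => x + 1
  | .measure x y => x + y + 1
  | .reset => 0

/-- A number above all names of registers and arrays in a program. -/
def QProgram.bound : QProgram → ℕ
  | .instr i => i.bound
  | .seq p q => p.bound + q.bound
  | .ite x p q => x + 1 + p.bound + q.bound
  | .loop x p => x + 1 + p.bound

/-- A sequence of instructions. -/
def QProgram.ofInstrs (i : Instr) : List Instr → QProgram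
  | [] => .instr i
  | j :: l => .seq (.instr i) (ofInstrs j l)

/-- Replace a query to table `0` or `1` at `(y, z)` by access to array `B` or `B + 1`, at the address
that is the sum of cell `y` of array `B + 2` and of cell `z` of array `B + 3`. -/
def Instr.redirect (B : ℕ) : Instr → QProgram
  | .query k x y z =>
    if k < 2 then
      .ofInstrs (.load B (B + 2) y) [.load (B + 1) (B + 3) z, .op .add B B (B + 1), .load x (B + k) B]
    else .instr (.const x 0)
  | .qquery k x y z _ _ =>
    if h : k < 2 ∧ x < B ∧ y < B ∧ z < B then
      .ofInstrs (.qload B (B + 2) y (by omega)) [.qload (B + 1) (B + 3) z (by omega),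
        .qop .add (B + 2) B (B + 1) (by omega) (by omega), .qload x (B + k) (B + 2) (by omega),
        .qop .add (B + 2) B (B + 1) (by omega) (by omega), .qload (B + 1) (B + 3) z (by omega),
        .qload B (B + 2) y (by omega)]
    else .instr (.const B 0)
  | i => .instr i

/-- Replace all queries by accesses to arrays. -/
def QProgram.redirect (B : ℕ) : QProgram → QProgram
  | .instr i => i.redirect B
  | .seq p q => .seq (p.redirect B) (q.redirect B)
  | .ite x p q => .ite x (p.redirect B) (q.redirect B)
  | .loop x p => .loop x (p.redirect B)

/-- The input that is stored in the arrays `B, …, B + 3`. -/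
def RamState.storedInput {w : ℕ} (B : ℕ) (s : RamState w) : WordInput w := fun k i j =>
  if k < 2 then s.arr (B + k) (s.arr (B + 2) i + s.arr (B + 3) j) else 0

namespace QProgram

variable {w : ℕ} {X : WordInput w}

theorem Runs.seq_singleton {p q : QProgram} {s s' : RamState w} {t t' : ℕ} {M}
    (h : Runs X [p] s t {s'}) (h' : Runs X [q] s' t' M) : Runs X [.seq p q] s (t + t' + 1) M := by
  have := h.seq (F := fun _ => M) (q := q) (t' := t') (by simpa using h')
  rwa [Multiset.singleton_bind] at this

theorem Runs.ofInstrs_cons {i j : Instr} {l : List Instr} {s s' : RamState w} {t : ℕ} {M}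
    (h : i.exec X s = {s'}) (h' : Runs X [ofInstrs j l] s' t M) :
    Runs X [ofInstrs i (j :: l)] s (t + 2) M := by
  have := (h ▸ Runs.instr (X := X) i s).seq_singleton h'
  rwa [show t + 2 = 1 + t + 1 by omega]

theorem Runs.ofInstrs_singleton {i : Instr} {s s' : RamState w} (h : i.exec X s = {s'}) :
    Runs X [ofInstrs i []] s 1 {s'} :=
  h ▸ Runs.instr (X := X) i s

end QProgram

/-- The state `s'` of the simulating machine represents the state `s` of the simulated one. -/
structure Simulates {w : ℕ} (B : ℕ) (α : ℂ) (s₀ s s' : RamState w) : Prop where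
  reg : ∀ x < B, s'.reg x = s.reg x
  arr : ∀ a < B, s'.arr a = s.arr a
  vec : s'.vec = α • s.vec
  clean : ∀ b ∈ s.vec.support, ∀ x, B ≤ x → b.reg x = 0
  outerReg : ∀ x, B + 2 ≤ x → s'.reg x = s₀.reg x
  outerArr : ∀ a, B ≤ a → s'.arr a = s₀.arr a

/-! ### Simulation of a program with redirected queries, instruction by instruction -/

namespace Simulates

open QProgram

variable {w B : ℕ} {α : ℂ} {s₀ s s' : RamState w} {X : WordInput w}

theorem setReg (h : Simulates B α s₀ s s') {x : ℕ} (hx : x < B) (v : BitVec w) :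
    Simulates B α s₀ (s.setReg x v) (s'.setReg x v) where
  reg y hy := by
    simp only [RamState.setReg, Function.update_apply]
    split_ifs
    · rfl
    · exact h.reg y hy
  arr := h.arr
  vec := h.vec
  clean := h.clean
  outerReg y hy := by
    rw [← h.outerReg y hy]
    exact Function.update_of_ne (by omega) _ _
  outerArr := h.outerArr

theorem setReg_scratch (h : Simulates B α s₀ s s') {x : ℕ} (hx : B ≤ x) (hx' : x < B + 2)
    (v : BitVec w) : Simulates B α s₀ s (s'.setReg x v) where
  reg y hy := by
    rw [← h.reg y hy]
    exact Function.update_of_ne (by omega) _ _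
  arr := h.arr
  vec := h.vec
  clean := h.clean
  outerReg y hy := by
    rw [← h.outerReg y hy]
    exact Function.update_of_ne (by omega) _ _
  outerArr := h.outerArr

theorem setArr (h : Simulates B α s₀ s s') {a : ℕ} (ha : a < B) (v : BitVec w → BitVec w) :
    Simulates B α s₀ (s.setArr a v) (s'.setArr a v) where
  reg := h.reg
  arr y hy := by
    simp only [RamState.setArr, Function.update_apply]
    split_ifs
    · rfl
    · exact h.arr y hy
  vec := h.vec
  clean := h.clean
  outerReg := h.outerReg
  outerArr y hy := by
    rw [← h.outerArr y hy]
    exact Function.update_of_ne (by omega) _ _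

theorem withVec (h : Simulates B α s₀ s s') {v : QVec w}
    (hv : ∀ b ∈ v.support, ∀ x, B ≤ x → b.reg x = 0) :
    Simulates B α s₀ { s with vec := v } { s' with vec := α • v } where
  reg := h.reg
  arr := h.arr
  vec := rfl
  clean := hv
  outerReg := h.outerReg
  outerArr := h.outerArr

/-- The two maps need to agree only on basis states with clean scratch registers, as no others occur
in the vector. This permits `f'` to use the scratch space as long as it restores it. -/
theorem mapBasis (h : Simulates B α s₀ s s') {f f' : QBasis w → QBasis w}
    (hf : ∀ b, (∀ x, B ≤ x → b.reg x = 0) → f' b = f b ∧ ∀ x, B ≤ x → (f b).reg x = 0) :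
    Simulates B α s₀ (s.mapBasis f) (s'.mapBasis f') := by
  classical
  have e : s'.vec.mapDomain f' = α • s.vec.mapDomain f := by
    rw [h.vec, Finsupp.mapDomain_smul]
    congr 1
    exact Finsupp.mapDomain_congr fun b hb => (hf b (h.clean b hb)).1
  have := h.withVec (v := s.vec.mapDomain f) fun b hb => by
    obtain ⟨b', hb', rfl⟩ := Finset.mem_image.1 (Finsupp.mapDomain_support hb)
    exact (hf b' (h.clean b' hb')).2
  rwa [← e] at this

theorem mapLinear (h : Simulates B α s₀ s s') {f : QBasis w → QVec w}
    (hf : ∀ b, (∀ x, B ≤ x → b.reg x = 0) → ∀ b' ∈ (f b).support, ∀ x, B ≤ x → b'.reg x = 0) :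
    Simulates B α s₀ (s.mapLinear f) (s'.mapLinear f) := by
  classical
  have := h.withVec (v := Finsupp.linearCombination ℂ f s.vec) fun b hb => by
    rw [Finsupp.linearCombination_apply] at hb
    obtain ⟨b', hb', hb''⟩ := Finset.mem_biUnion.1 (Finsupp.support_sum hb)
    exact hf b' (h.clean b' hb') b (Finsupp.support_smul hb'')
  rwa [← map_smul, ← h.vec] at this

theorem _root_.RamState.mapBasis_mapBasis (s : RamState w) (f g : QBasis w → QBasis w) :
    (s.mapBasis f).mapBasis g = s.mapBasis fun b => g (f b) := by
  simp only [RamState.mapBasis, ← Finsupp.mapDomain_comp]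
  rfl

theorem xorReg_clean {x : ℕ} (hx : x < B) (v : BitVec w) (b : QBasis w)
    (hb : ∀ x, B ≤ x → b.reg x = 0) (y : ℕ) (hy : B ≤ y) : (b.xorReg x v).reg y = 0 := by
  rw [b.xorReg_reg_ne (by omega), hb y hy]

/-- The uniform bound `13` is the cost of the longest replacement: seven instructions in sequence,
of which all but the last need one extra step for the sequencing. -/
theorem of_exec_singleton {i : Instr} {t t' : RamState w} (h : Simulates B α s₀ t t')
    {p : QProgram} {n : ℕ} (hn : n ≤ 13)
    (hi : i.exec (s₀.storedInput B) s = {t}) (hp : Runs X [p] s' n {t'}) :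
    ∃ M : Multiset (RamState w × RamState w), i.exec (s₀.storedInput B) s = M.map Prod.fst ∧
      Runs X [p] s' 13 (M.map Prod.snd) ∧ ∀ e ∈ M, Simulates B α s₀ e.1 e.2 :=
  ⟨{(t, t')}, by simpa using hi, by simpa using hp.mono hn, by simpa using h⟩

theorem exists_query (h : Simulates B α s₀ s s') {k x y z : ℕ}
    (hb : (Instr.query k x y z).bound ≤ B) :
    ∃ M : Multiset (RamState w × RamState w),
      (Instr.query k x y z).exec (s₀.storedInput B) s = M.map Prod.fst ∧
      Runs X [(Instr.query k x y z).redirect B] s' 13 (M.map Prod.snd) ∧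
      ∀ e ∈ M, Simulates B α s₀ e.1 e.2 := by
  simp only [Instr.bound] at hb
  by_cases hk : k < 2
  · simp only [Instr.redirect, if_pos hk]
    have h' := (((h.setReg_scratch (x := B) le_rfl (by omega)
      (s'.arr (B + 2) (s'.reg y))).setReg_scratch (x := B + 1) (by omega) (by omega)
      (s'.arr (B + 3) (s'.reg z))).setReg_scratch (x := B) (by omega) (by omega)
      (s'.arr (B + 2) (s'.reg y) + s'.arr (B + 3) (s'.reg z))).setReg (x := x) (by omega)
      (s₀.storedInput B k (s.reg y) (s.reg z))
    refine h'.of_exec_singleton (n := 7) (by omega) rfl ?_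
    refine Runs.ofInstrs_cons rfl (Runs.ofInstrs_cons rfl (Runs.ofInstrs_cons rfl
      (Runs.ofInstrs_singleton ?_)))
    have e1 : z ≠ B := by omega
    simp [Instr.exec, RamState.setReg, WordOp.eval, RamState.storedInput, hk, h.outerArr,
      h.reg y (by omega), h.reg z (by omega), Function.update_of_ne e1]
  · simp only [Instr.redirect, if_neg hk]
    refine (h.setReg (x := x) (by omega) 0).of_exec_singleton (n := 1) (by omega) ?_
      (Runs.instr _ _)
    simp [Instr.exec, RamState.storedInput, hk]

/-- Compute and uncompute: the two offsets are loaded into the scratch registers `B` and `B + 1`,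
their sum goes to `B + 2`, the entry at this address is added to `x`, and the first three operations
are undone in reverse order. They can be undone because none of them involves `x`, which differs
from `y` and `z`. -/
theorem exists_qquery (h : Simulates B α s₀ s s') {k x y z : ℕ} {hy : x ≠ y} {hz : x ≠ z}
    (hb : (Instr.qquery k x y z hy hz).bound ≤ B) :
    ∃ M : Multiset (RamState w × RamState w),
      (Instr.qquery k x y z hy hz).exec (s₀.storedInput B) s = M.map Prod.fst ∧
      Runs X [(Instr.qquery k x y z hy hz).redirect B] s' 13 (M.map Prod.snd) ∧
      ∀ e ∈ M, Simulates B α s₀ e.1 e.2 := by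
  simp only [Instr.bound] at hb
  by_cases hk : k < 2
  · have hc : k < 2 ∧ x < B ∧ y < B ∧ z < B := by omega
    simp only [Instr.redirect, dif_pos hc]
    refine of_exec_singleton (n := 13) ?_ le_rfl rfl
      (Runs.ofInstrs_cons rfl (Runs.ofInstrs_cons rfl (Runs.ofInstrs_cons rfl
      (Runs.ofInstrs_cons rfl (Runs.ofInstrs_cons rfl (Runs.ofInstrs_cons rfl
      (Runs.ofInstrs_singleton rfl)))))))
    simp only [RamState.mapBasis_mapBasis]
    refine h.mapBasis fun b hb => ⟨?_, xorReg_clean (by omega) _ _ hb⟩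
    have h0 := hb B le_rfl
    have h1 := hb (B + 1) (by omega)
    have h2 := hb (B + 2) (by omega)
    have e1 : x ≠ B := by omega
    have e2 : x ≠ B + 1 := by omega
    have e3 : x ≠ B + 2 := by omega
    have e4 : y ≠ B := by omega
    have e5 : y ≠ B + 1 := by omega
    have e6 : y ≠ B + 2 := by omega
    have e7 : z ≠ B := by omega
    have e8 : z ≠ B + 1 := by omega
    have e9 : z ≠ B + 2 := by omega
    refine QBasis.ext (funext fun r => ?_) rfl
    simp only [QBasis.xorReg, QBasis.setReg, RamState.mapBasis, WordOp.eval, RamState.storedInput,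
      hk, if_true, h.outerArr _ (show B ≤ B + 2 by omega), h.outerArr _ (show B ≤ B + 3 by omega),
      h.outerArr _ (show B ≤ B + k by omega)]
    by_cases r0 : r = B
    · subst r0
      simp [h0, h1, h2, Function.update_apply, e1, e2, e3, e4, e5, e6, e7, e8, e9, e1.symm,
        hy.symm, hz.symm]
    by_cases r1 : r = B + 1
    · subst r1
      simp [h0, h1, h2, Function.update_apply, e1, e2, e3, e4, e5, e6, e7, e8, e9, e2.symm,
        hy.symm, hz.symm]
    by_cases r2 : r = B + 2
    · subst r2
      simp [h0, h1, h2, e1, e2, e3, e4, e5, e6, e7, e8, e9, e1.symm,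
        e2.symm, e3.symm, hy.symm, hz.symm]
    simp [r0, r1, r2, h0, h1, h2, Function.update_apply, e1, e2, e3, e4, e5, e6, e7, e8, e9]
  · have hc : ¬ (k < 2 ∧ x < B ∧ y < B ∧ z < B) := by omega
    simp only [Instr.redirect, dif_neg hc]
    -- Stored tables other than `0` and `1` vanish, so the query acts as the identity. Its
    -- replacement writes to a classical scratch register merely in order to be an instruction.
    refine of_exec_singleton (n := 1) ?_ (by omega) rfl (Runs.instr _ _)
    have h' : Simulates B α s₀ (s.mapBasis fun b =>
        b.xorReg x (s₀.storedInput B k (b.reg y) (b.reg z))) (s'.mapBasis id) :=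
      h.mapBasis fun b hb => ⟨by simpa [RamState.storedInput, hk] using (b.xorReg_zero x).symm,
        xorReg_clean (by omega) _ _ hb⟩
    simp only [RamState.mapBasis, Finsupp.mapDomain_id] at h'
    exact h'.setReg_scratch le_rfl (by omega) _

/-- Since `α ≠ 0`, both vectors have the same support. Hence `measure` and `reset` produce the same
branches on both sides, and these can be paired. -/
theorem exists_instr (hα : α ≠ 0) (h : Simulates B α s₀ s s') {i : Instr} (hb : i.bound ≤ B) :
    ∃ M : Multiset (RamState w × RamState w), i.exec (s₀.storedInput B) s = M.map Prod.fst ∧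
      Runs X [i.redirect B] s' 13 (M.map Prod.snd) ∧ ∀ e ∈ M, Simulates B α s₀ e.1 e.2 := by
  cases i with
  | query k x y z => exact h.exists_query hb
  | qquery k x y z => exact h.exists_qquery hb
  | const x v =>
    exact (h.setReg (by simpa [Instr.bound] using hb) _).of_exec_singleton (n := 1) (by omega) rfl
      (Runs.instr _ _)
  | op o x y z =>
    simp only [Instr.bound] at hb
    refine (h.setReg (x := x) (by omega) _).of_exec_singleton (n := 1) (by omega) rfl ?_
    rw [← h.reg y (by omega), ← h.reg z (by omega)]
    exact Runs.instr _ _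
  | load x a y =>
    simp only [Instr.bound] at hb
    refine (h.setReg (x := x) (by omega) _).of_exec_singleton (n := 1) (by omega) rfl ?_
    rw [← h.reg y (by omega), ← h.arr a (by omega)]
    exact Runs.instr _ _
  | store a y x =>
    simp only [Instr.bound] at hb
    refine (h.setArr (a := a) (by omega) _).of_exec_singleton (n := 1) (by omega) rfl ?_
    rw [← h.reg y (by omega), ← h.reg x (by omega), ← h.arr a (by omega)]
    exact Runs.instr _ _
  | clear a =>
    exact (h.setArr (by simpa [Instr.bound] using hb) _).of_exec_singleton (n := 1) (by omega) rfl
      (Runs.instr _ _)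
  | qset x y =>
    simp only [Instr.bound] at hb
    refine (h.mapBasis (f := fun b => b.xorReg x (s.reg y)) (f' := fun b => b.xorReg x (s'.reg y))
      fun b hb => ⟨?_, xorReg_clean (by omega) _ _ hb⟩).of_exec_singleton (n := 1) (by omega) rfl
      (Runs.instr _ _)
    rw [h.reg y (by omega)]
  | qop o x y z hy hz =>
    simp only [Instr.bound] at hb
    exact (h.mapBasis fun b hb => ⟨rfl, xorReg_clean (by omega) _ _ hb⟩).of_exec_singleton
      (n := 1) (by omega) rfl (Runs.instr _ _)
  | qload x a y hy =>
    simp only [Instr.bound] at hb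
    refine (h.mapBasis (f := fun b => b.xorReg x (s.arr a (b.reg y)))
      (f' := fun b => b.xorReg x (s'.arr a (b.reg y)))
      fun b hb => ⟨?_, xorReg_clean (by omega) _ _ hb⟩).of_exec_singleton (n := 1) (by omega) rfl
      (Runs.instr _ _)
    rw [h.arr a (by omega)]
  | qswap a x y hy =>
    simp only [Instr.bound] at hb
    refine (h.mapBasis fun b hb => ⟨rfl, fun r hr => ?_⟩).of_exec_singleton
      (n := 1) (by omega) rfl (Runs.instr _ _)
    simp only [QBasis.swapCell]
    rw [Function.update_of_ne (by omega), hb r hr]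
  | had x =>
    classical
    simp only [Instr.bound] at hb
    refine (h.mapLinear fun b hb b' hb' => ?_).of_exec_singleton
      (n := 1) (by omega) rfl (Runs.instr _ _)
    rcases Finset.mem_union.1 (Finsupp.support_add (Finsupp.support_smul hb')) with h1 | h1
    · rw [Finset.mem_singleton.1 (Finsupp.support_single_subset h1)]
      exact xorReg_clean (by omega) _ _ hb
    · rw [Finset.mem_singleton.1 (Finsupp.support_single_subset h1)]
      exact hb
  | phase x =>
    refine (h.mapLinear fun b hb b' hb' => ?_).of_exec_singleton
      (n := 1) (by omega) rfl (Runs.instr _ _)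
    rw [Finset.mem_singleton.1 (Finsupp.support_single_subset hb')]
    exact hb
  | measure x y =>
    simp only [Instr.bound] at hb
    refine ⟨(s.vec.support.image fun b => b.reg y).val.map fun v =>
      ({ s.setReg x v with vec := s.vec.project y v },
        { s'.setReg x v with vec := s'.vec.project y v }), ?_, ?_, ?_⟩
    · simp [Instr.exec]
    · have : s'.vec.support = s.vec.support := by
        rw [h.vec]; exact Finsupp.support_smul_eq hα
      rw [Multiset.map_map, ← this]
      exact (Runs.instr _ _).mono (by omega)
    · intro e he
      obtain ⟨v, _, rfl⟩ := Multiset.mem_map.1 he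
      have := (h.setReg (x := x) (by omega) v).withVec (v := s.vec.project y v) fun b hb =>
        h.clean b (by
          rw [QVec.project, Finsupp.support_filter] at hb
          exact (Finset.mem_filter.1 hb).1)
      rwa [show α • s.vec.project y v = s'.vec.project y v by
        rw [h.vec]; exact Finsupp.filter_smul.symm] at this
  | reset =>
    refine ⟨s.vec.support.val.map fun b =>
      ({ s with vec := Finsupp.single (QBasis.zero w) (s.vec b) },
        { s' with vec := Finsupp.single (QBasis.zero w) (s'.vec b) }), ?_, ?_, ?_⟩
    · simp [Instr.exec]
    · have : s'.vec.support = s.vec.support := by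
        rw [h.vec]; exact Finsupp.support_smul_eq hα
      rw [Multiset.map_map, ← this]
      exact (Runs.instr _ _).mono (by omega)
    · intro e he
      obtain ⟨b, _, rfl⟩ := Multiset.mem_map.1 he
      have := h.withVec (v := Finsupp.single (QBasis.zero w) (s.vec b)) fun b' hb' x _ => by
        rw [Finset.mem_singleton.1 (Finsupp.support_single_subset hb')]; rfl
      rwa [Finsupp.smul_single, ← Finsupp.smul_apply, ← h.vec] at this

/-- The redirected program simulates the original one with constant overhead. -/
theorem exists_runs (hα : α ≠ 0) {k : List QProgram} (hk : ∀ p ∈ k, p.bound ≤ B) {t : ℕ} {N}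
    (h : Simulates B α s₀ s s') (hN : Runs (s₀.storedInput B) k s t N) :
    ∃ M : Multiset (RamState w × RamState w), N = M.map Prod.fst ∧
      Runs X (k.map (QProgram.redirect B)) s' (13 * t) (M.map Prod.snd) ∧
      ∀ e ∈ M, Simulates B α s₀ e.1 e.2 := by
  induction t generalizing k s s' N with
  | zero =>
    obtain ⟨s1, rfl, hs⟩ := Multiset.map_eq_singleton.1 hN.symm
    obtain ⟨rfl, rfl⟩ := Prod.ext_iff.1 hs
    exact ⟨{(_, s')}, rfl, Runs.nil _ _, by simpa using h⟩
  | succ t ih =>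
    match k, hk, hN with
    | [], _, hN =>
      rw [hN.nil_eq]
      exact ⟨{(_, s')}, rfl, Runs.nil _ _, by simpa using h⟩
    | .instr i :: k, hk, hN =>
      obtain ⟨F, rfl, hF⟩ := runs_succ hN
      obtain ⟨M, hM, hR, hS⟩ := h.exists_instr (X := X) hα (i := i) (hk (.instr i) (by simp))
      have key : ∀ e ∈ M, ∃ M' : Multiset (RamState w × RamState w), F (k, e.1) = M'.map Prod.fst ∧
          Runs X (k.map (QProgram.redirect B)) e.2 (13 * t) (M'.map Prod.snd) ∧
          ∀ e ∈ M', Simulates B α s₀ e.1 e.2 := by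
        intro e he
        refine ih (fun p hp => hk p (by simp [hp])) (hS e he) (hF (k, e.1) ?_)
        simp only [step]
        refine Multiset.mem_map_of_mem _ ?_
        rw [hM]
        exact Multiset.mem_map_of_mem _ he
      choose! G hG1 hG2 hG3 using key
      refine ⟨M.bind G, ?_, ?_, ?_⟩
      · simp only [step, Multiset.bind_map, hM, Multiset.map_bind]
        exact Multiset.bind_congr fun e he => hG1 e he
      · have := hR.cons_map (k := k.map (QProgram.redirect B)) (G := fun e => (G e).map Prod.snd)
          hG2
        rw [Multiset.map_bind]
        exact this.mono (by omega)
      · intro e he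
        obtain ⟨e', he', h2⟩ := Multiset.mem_bind.1 he
        exact hG3 e' he' e h2
    | .seq p q :: k, hk, hN =>
      obtain ⟨F, rfl, hF⟩ := runs_succ hN
      simp only [step, Multiset.mem_singleton, forall_eq, Multiset.singleton_bind] at hF ⊢
      have hpq := hk (.seq p q) (by simp)
      simp only [QProgram.bound] at hpq
      obtain ⟨M, h1, h2, h3⟩ := ih (k := p :: q :: k) (by
        intro r hr
        simp only [List.mem_cons] at hr
        rcases hr with rfl | rfl | hr
        · omega
        · omega
        · exact hk r (by simp [hr])) h hF
      exact ⟨M, h1, (Runs.of_step_singleton rfl h2).mono (by omega), h3⟩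
    | .ite x p q :: k, hk, hN =>
      obtain ⟨F, rfl, hF⟩ := runs_succ hN
      simp only [step, Multiset.mem_singleton, forall_eq, Multiset.singleton_bind] at hF ⊢
      have hpq := hk (.ite x p q) (by simp)
      simp only [QProgram.bound] at hpq
      obtain ⟨M, h1, h2, h3⟩ := ih (k := (if s.reg x ≠ 0 then p else q) :: k) (by
        intro r hr
        simp only [List.mem_cons] at hr
        rcases hr with rfl | hr
        · split_ifs <;> omega
        · exact hk r (by simp [hr])) h hF
      refine ⟨M, h1, (Runs.of_step_singleton (s' := s') ?_ h2).mono
        (show 13 * t + 1 ≤ 13 * (t + 1) by omega), h3⟩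
      simp only [List.map_cons, QProgram.redirect, step, h.reg x (by omega)]
      split_ifs <;> rfl
    | .loop x p :: k, hk, hN =>
      obtain ⟨F, rfl, hF⟩ := runs_succ hN
      simp only [step, Multiset.mem_singleton, forall_eq, Multiset.singleton_bind] at hF ⊢
      have hpq := hk (.loop x p) (by simp)
      simp only [QProgram.bound] at hpq
      obtain ⟨M, h1, h2, h3⟩ := ih (k := if s.reg x ≠ 0 then p :: .loop x p :: k else k) (by
        intro r hr
        split_ifs at hr
        · simp only [List.mem_cons] at hr
          rcases hr with rfl | rfl | hr
          · omega
          · simp only [QProgram.bound]; omega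
          · exact hk r (by simp [hr])
        · exact hk r (by simp [hr])) h hF
      refine ⟨M, h1, (Runs.of_step_singleton (s' := s') ?_ h2).mono
        (show 13 * t + 1 ≤ 13 * (t + 1) by omega), h3⟩
      simp only [List.map_cons, QProgram.redirect, step, h.reg x (by omega)]
      split_ifs <;> rfl

end Simulates

/-! ## Programs on integers -/

/-- Operations on integers, which are implemented by word operations as long as nothing
overflows. -/
inductive IntOp
  | add | sub | mul | div | mod | eq | lt

/-- The value of an operation. -/
def IntOp.eval : IntOp → ℤ → ℤ → ℤ
  | .add, x, y => x + y
  | .sub, x, y => x - y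
  | .mul, x, y => x * y
  | .div, x, y => x / y
  | .mod, x, y => x % y
  | .eq, x, y => if x = y then 1 else 0
  | .lt, x, y => if x < y then 1 else 0

/-- The implementation of an operation. -/
def IntOp.toWordOp : IntOp → WordOp
  | .add => .add
  | .sub => .sub
  | .mul => .mul
  | .div => .udiv
  | .mod => .umod
  | .eq => .eq
  | .lt => .slt

/-- The condition under which an operation does not overflow; `L` is half the number of words. -/
def IntOp.Safe (L : ℤ) : IntOp → ℤ → ℤ → Prop
  | .add, _, _ => True
  | .sub, _, _ => True
  | .mul, _, _ => True
  | .div, x, y => (0 ≤ x ∧ x < L) ∧ 0 ≤ y ∧ y < L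
  | .mod, x, y => (0 ≤ x ∧ x < L) ∧ 0 ≤ y ∧ y < L
  | .eq, x, y => (-L ≤ x ∧ x < L) ∧ -L ≤ y ∧ y < L
  | .lt, x, y => (-L ≤ x ∧ x < L) ∧ -L ≤ y ∧ y < L

/-- A classical memory that consists of integers, together with the tables of the input. -/
structure IState where
  reg : ℕ → ℤ
  arr : ℕ → ℤ → ℤ
  tab : ℕ → ℤ → ℤ → ℤ

/-- Overwrite a register. -/
def IState.setReg (σ : IState) (x : ℕ) (v : ℤ) : IState :=
  { σ with reg := Function.update σ.reg x v }

/-- Overwrite an array cell. -/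
def IState.setCell (σ : IState) (a : ℕ) (z v : ℤ) : IState :=
  { σ with arr := Function.update σ.arr a (Function.update (σ.arr a) z v) }

theorem IState.setReg_reg (σ : IState) (x : ℕ) (v : ℤ) (y : ℕ) :
    (σ.setReg x v).reg y = if y = x then v else σ.reg y :=
  Function.update_apply _ _ _ _

theorem IState.setReg_arr (σ : IState) (x : ℕ) (v : ℤ) : (σ.setReg x v).arr = σ.arr := rfl

theorem IState.setReg_tab (σ : IState) (x : ℕ) (v : ℤ) : (σ.setReg x v).tab = σ.tab := rfl

theorem IState.setCell_reg (σ : IState) (a : ℕ) (z v : ℤ) : (σ.setCell a z v).reg = σ.reg := rfl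

theorem IState.setCell_arr (σ : IState) (a : ℕ) (z v : ℤ) (b : ℕ) (z' : ℤ) :
    (σ.setCell a z v).arr b z' = if b = a ∧ z' = z then v else σ.arr b z' := by
  by_cases hb : b = a
  · subst hb; simp [setCell, Function.update_apply]
  · simp [setCell, hb]

theorem IState.setCell_tab (σ : IState) (a : ℕ) (z v : ℤ) : (σ.setCell a z v).tab = σ.tab := rfl

/-- Instructions for integers. -/
inductive IntInstr
  | const (x v : ℕ)
  | op (o : IntOp) (x y z : ℕ)
  | load (x a y : ℕ)
  | store (a y x : ℕ)
  | query (k x y z : ℕ)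

/-- The effect of an instruction. -/
def IntInstr.exec (σ : IState) : IntInstr → IState
  | .const x v => σ.setReg x v
  | .op o x y z => σ.setReg x (o.eval (σ.reg y) (σ.reg z))
  | .load x a y => σ.setReg x (σ.arr a (σ.reg y))
  | .store a y x => σ.setCell a (σ.reg y) (σ.reg x)
  | .query k x y z => σ.setReg x (σ.tab k (σ.reg y) (σ.reg z))

/-- The condition under which an instruction is implemented faithfully. -/
def IntInstr.Safe (L : ℤ) (σ : IState) : IntInstr → Prop
  | .const _ _ => True
  | .op o _ y z => o.Safe L (σ.reg y) (σ.reg z)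
  | .load _ _ y => 0 ≤ σ.reg y ∧ σ.reg y < 2 * L
  | .store _ y _ => 0 ≤ σ.reg y ∧ σ.reg y < L
  | .query _ _ y z => (0 ≤ σ.reg y ∧ σ.reg y < L) ∧ 0 ≤ σ.reg z ∧ σ.reg z < L

/-- The implementation of an instruction; the names of registers and arrays are shifted. -/
def IntInstr.toInstr (B : ℕ) : IntInstr → Instr
  | .const x v => .const (B + x) v
  | .op o x y z => .op o.toWordOp (B + x) (B + y) (B + z)
  | .load x a y => .load (B + x) (B + a) (B + y)
  | .store a y x => .store (B + a) (B + y) (B + x)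
  | .query k x y z => .query k (B + x) (B + y) (B + z)

/-- Execute a list of instructions. -/
def execAll : List IntInstr → IState → IState
  | [], σ => σ
  | i :: l, σ => execAll l (i.exec σ)

theorem execAll_append (l l' : List IntInstr) (σ : IState) :
    execAll (l ++ l') σ = execAll l' (execAll l σ) := by
  induction l generalizing σ with
  | nil => rfl
  | cons i l ih => exact ih _

/-- The register that an instruction changes. -/
def IntInstr.dest : IntInstr → Option ℕ
  | .const x _ => some x
  | .op _ x _ _ => some x
  | .load x _ _ => some x
  | .store _ _ _ => none
  | .query _ x _ _ => some x

/-- The array that an instruction changes. -/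
def IntInstr.arrDest : IntInstr → Option ℕ
  | .store a _ _ => some a
  | _ => none

theorem reg_execAll_of_notMem {l : List IntInstr} {r : ℕ} (h : r ∉ l.filterMap IntInstr.dest)
    (σ : IState) : (execAll l σ).reg r = σ.reg r := by
  induction l generalizing σ with
  | nil => rfl
  | cons i l ih =>
    rw [execAll]
    cases i <;> simp only [List.filterMap_cons, IntInstr.dest, List.mem_cons, not_or] at h <;>
      rw [ih (by first | exact h.2 | exact h)] <;>
      simp [IntInstr.exec, IState.setReg_reg, IState.setCell_reg, h]

theorem arr_execAll_of_notMem {l : List IntInstr} {a : ℕ} (h : a ∉ l.filterMap IntInstr.arrDest)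
    (σ : IState) : (execAll l σ).arr a = σ.arr a := by
  induction l generalizing σ with
  | nil => rfl
  | cons i l ih =>
    rw [execAll]
    cases i <;> simp only [List.filterMap_cons, IntInstr.arrDest, List.mem_cons, not_or] at h <;>
      rw [ih (by first | exact h.2 | exact h)] <;>
      first | rfl | (funext z; simp [IntInstr.exec, IState.setCell_arr, h])

theorem tab_execAll (l : List IntInstr) (σ : IState) : (execAll l σ).tab = σ.tab := by
  induction l generalizing σ with
  | nil => rfl
  | cons i l ih => rw [execAll, ih]; cases i <;> rfl

/-- All instructions of a list are implemented faithfully. -/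
def SafeAll (L : ℤ) : List IntInstr → IState → Prop
  | [], _ => True
  | i :: l, σ => i.Safe L σ ∧ SafeAll L l (i.exec σ)

theorem safeAll_append {L : ℤ} {l l' : List IntInstr} {σ : IState} :
    SafeAll L (l ++ l') σ ↔ SafeAll L l σ ∧ SafeAll L l' (execAll l σ) := by
  induction l generalizing σ with
  | nil => simp [SafeAll, execAll]
  | cons i l ih => simp [SafeAll, execAll, ih, and_assoc]

/-- The implementation of a nonempty list of instructions. -/
def code (B : ℕ) : List IntInstr → QProgram
  | [] => .instr .reset
  | i :: l => .ofInstrs (i.toInstr B) (l.map (IntInstr.toInstr B))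

/-- The integers in `σ` are represented by the words in the registers and arrays with names at
least `B` of `s`. -/
structure Represents {w : ℕ} (X : WordInput w) (B : ℕ) (σ : IState) (s : RamState w) : Prop where
  reg : ∀ x, s.reg (B + x) = BitVec.ofInt w (σ.reg x)
  arr : ∀ a z, 0 ≤ z → z < 2 ^ w → s.arr (B + a) (BitVec.ofInt w z) = BitVec.ofInt w (σ.arr a z)
  tab : ∀ k y z, 0 ≤ y → y < 2 ^ w → 0 ≤ z → z < 2 ^ w →
    X k (BitVec.ofInt w y) (BitVec.ofInt w z) = BitVec.ofInt w (σ.tab k y z)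

theorem BitVec.ofInt_injOn {w : ℕ} {x y : ℤ} (hx : 0 ≤ x) (hx' : x < 2 ^ w) (hy : 0 ≤ y)
    (hy' : y < 2 ^ w) (h : BitVec.ofInt w x = BitVec.ofInt w y) : x = y := by
  have := congrArg BitVec.toNat h
  rw [BitVec.toNat_ofInt, BitVec.toNat_ofInt] at this
  rw [Int.emod_eq_of_lt hx (by push_cast; exact hx'), Int.emod_eq_of_lt hy (by push_cast; exact hy')]
    at this
  omega

/-- Sums, differences and products are compatible with reduction modulo `2 ^ w` and need no
condition. Comparisons need arguments in the signed range, and unsigned division and remainder need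
them in its nonnegative half. -/
theorem IntOp.eval_toWordOp {w : ℕ} {L : ℤ} (hw : 1 ≤ w) (hL : 2 * L = 2 ^ w) (o : IntOp) {x y : ℤ}
    (h : o.Safe L x y) :
    o.toWordOp.eval (BitVec.ofInt w x) (BitVec.ofInt w y) = BitVec.ofInt w (o.eval x y) := by
  have hi : ∀ z : ℤ, -L ≤ z → z < L → (BitVec.ofInt w z).toInt = z := fun z h1 h2 => by
    obtain ⟨w, rfl⟩ := Nat.exists_eq_add_of_le' hw
    rw [pow_succ] at hL
    apply BitVec.toInt_ofInt_eq_self (by omega) <;> simp <;> omega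
  have hn : ∀ z : ℤ, 0 ≤ z → z < L → (BitVec.ofInt w z).toNat = z.toNat := fun z h1 h2 => by
    rw [BitVec.toNat_ofInt, Int.emod_eq_of_lt h1 (by push_cast; omega)]
  have hnn : ∀ z : ℕ, BitVec.ofNat w z = BitVec.ofInt w z := fun z => (BitVec.ofInt_natCast w z).symm
  cases o with
  | add => exact (BitVec.ofInt_add x y).symm
  | sub =>
    simp only [eval, toWordOp, WordOp.eval]
    rw [Int.sub_eq_add_neg, BitVec.ofInt_add, BitVec.ofInt_neg, BitVec.sub_eq_add_neg]
  | mul => exact (BitVec.ofInt_mul x y).symm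
  | div =>
    obtain ⟨⟨h1, h2⟩, h3, h4⟩ := h
    obtain ⟨a, rfl⟩ := Int.eq_ofNat_of_zero_le h1
    obtain ⟨b, rfl⟩ := Int.eq_ofNat_of_zero_le h3
    apply BitVec.eq_of_toNat_eq
    simp only [eval, toWordOp, WordOp.eval]
    rw [BitVec.toNat_udiv, hn _ h1 h2, hn _ h3 h4, hn]
    · rfl
    · exact Int.ediv_nonneg h1 h3
    · exact lt_of_le_of_lt (by exact_mod_cast Nat.div_le_self a b) h2
  | mod =>
    obtain ⟨⟨h1, h2⟩, h3, h4⟩ := h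
    obtain ⟨a, rfl⟩ := Int.eq_ofNat_of_zero_le h1
    obtain ⟨b, rfl⟩ := Int.eq_ofNat_of_zero_le h3
    apply BitVec.eq_of_toNat_eq
    simp only [eval, toWordOp, WordOp.eval]
    rw [BitVec.toNat_umod, hn _ h1 h2, hn _ h3 h4, hn]
    · rfl
    · exact_mod_cast Nat.zero_le (a % b)
    · exact lt_of_le_of_lt (by exact_mod_cast Nat.mod_le a b) h2
  | eq =>
    obtain ⟨⟨h1, h2⟩, h3, h4⟩ := h
    have : BitVec.ofInt w x = BitVec.ofInt w y ↔ x = y :=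
      ⟨fun h => by rw [← hi x h1 h2, h, hi y h3 h4], fun h => h ▸ rfl⟩
    simp only [eval, toWordOp, WordOp.eval, this]
    split_ifs
    · exact hnn 1
    · exact hnn 0
  | lt =>
    obtain ⟨⟨h1, h2⟩, h3, h4⟩ := h
    simp only [eval, toWordOp, WordOp.eval, hi x h1 h2, hi y h3 h4]
    split_ifs
    · exact hnn 1
    · exact hnn 0

namespace Represents

variable {w B : ℕ} {X : WordInput w} {σ : IState} {s : RamState w}

theorem setReg (h : Represents X B σ s) (x : ℕ) (v : ℤ) :
    Represents X B (σ.setReg x v) (s.setReg (B + x) (BitVec.ofInt w v)) where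
  reg y := by
    simp only [IState.setReg, RamState.setReg, Function.update_apply, Nat.add_left_cancel_iff]
    split_ifs
    · rfl
    · exact h.reg y
  arr := h.arr
  tab := h.tab

theorem setCell (h : Represents X B σ s) (a : ℕ) {z : ℤ} (h0 : 0 ≤ z) (h1 : z < 2 ^ w) (v : ℤ) :
    Represents X B (σ.setCell a z v) (s.setArr (B + a)
      (Function.update (s.arr (B + a)) (BitVec.ofInt w z) (BitVec.ofInt w v))) where
  reg := h.reg
  arr b y h2 h3 := by
    simp only [IState.setCell, RamState.setArr, Function.update_apply, Nat.add_left_cancel_iff]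
    by_cases hb : b = a
    · subst hb
      simp only [if_true, Function.update_apply]
      have : BitVec.ofInt w y = BitVec.ofInt w z ↔ y = z :=
        ⟨BitVec.ofInt_injOn h2 h3 h0 h1, fun h => h ▸ rfl⟩
      rw [if_congr this rfl rfl]
      split_ifs
      · rfl
      · exact h.arr b y h2 h3
    · simp only [if_neg hb]
      exact h.arr b y h2 h3
  tab := h.tab

theorem exec {L : ℤ} (hw : 1 ≤ w) (hL : 2 * L = 2 ^ w) (h : Represents X B σ s) {i : IntInstr}
    (hi : i.Safe L σ) :
    ∃ s', (i.toInstr B).exec X s = {s'} ∧ Represents X B (i.exec σ) s' ∧ s'.vec = s.vec := by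
  cases i with
  | const x v =>
    refine ⟨_, rfl, ?_, rfl⟩
    rw [← BitVec.ofInt_natCast]
    exact h.setReg x v
  | op o x y z =>
    refine ⟨_, rfl, ?_, rfl⟩
    rw [h.reg, h.reg, o.eval_toWordOp hw hL hi]
    exact h.setReg x _
  | load x a y =>
    refine ⟨_, rfl, ?_, rfl⟩
    rw [h.reg, h.arr a _ hi.1 (by have := hi.2; omega)]
    exact h.setReg x _
  | store a y x =>
    refine ⟨_, rfl, ?_, rfl⟩
    rw [h.reg, h.reg]
    exact h.setCell a hi.1 (by have := hi.1; have := hi.2; omega) _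
  | query k x y z =>
    refine ⟨_, rfl, ?_, rfl⟩
    rw [h.reg, h.reg, h.tab k _ _ hi.1.1 (by have := hi.1.1; have := hi.1.2; omega) hi.2.1
      (by have := hi.2.1; have := hi.2.2; omega)]
    exact h.setReg x _

end Represents

open QProgram

/-! ### Program logic: deterministic triples, and triples that bound an expectation -/

section Triples

variable {w : ℕ} (X : WordInput w) (B : ℕ)

/-- Started in a state that represents `σ`, the program `p` halts within `T` steps, in a single
branch, with the same quantum memory, in a state that represents some `σ'` with property `Q`. -/
def Det (p : QProgram) (T : ℕ) (σ : IState) (Q : IState → Prop) : Prop :=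
  ∀ s : RamState w, Represents X B σ s → ∃ σ' s', Runs X [p] s T {s'} ∧ Represents X B σ' s' ∧
    s'.vec = s.vec ∧ Q σ'

/-- Started in a state that represents `σ`, the program `p` halts within `T` steps in states that
represent states with property `Q`, and the expectation of `f` at the end is at most `b`. -/
def Tri (p : QProgram) (T : ℕ) (σ : IState) (b : ℝ) (Q : IState → Prop) (f : IState → ℝ) : Prop :=
  ∀ s : RamState w, Represents X B σ s → ∃ M : Multiset (IState × RamState w),
    Runs X [p] s T (M.map Prod.snd) ∧ (∀ e ∈ M, Represents X B e.1 e.2 ∧ Q e.1) ∧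
    (M.map fun e => f e.1 * e.2.vec.normSq).sum ≤ b * s.vec.normSq

variable {X B}

theorem det_code {L : ℤ} (hw : 1 ≤ w) (hL : 2 * L = 2 ^ w) {l : List IntInstr} (hl : l ≠ [])
    {σ : IState} (hs : SafeAll L l σ) : Det X B (code B l) (2 * l.length) σ (· = execAll l σ) := by
  have key : ∀ (l : List IntInstr) (i : IntInstr) (σ : IState), SafeAll L (i :: l) σ →
      ∀ s : RamState w, Represents X B σ s → ∃ s',
      Runs X [code B (i :: l)] s (2 * (i :: l).length) {s'} ∧
      Represents X B (execAll (i :: l) σ) s' ∧ s'.vec = s.vec := by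
    intro l
    induction l with
    | nil =>
      intro i σ hs s hr
      obtain ⟨s', h1, h2, h3⟩ := hr.exec hw hL hs.1
      exact ⟨s', (Runs.ofInstrs_singleton h1).mono (by simp), h2, h3⟩
    | cons j l ih =>
      intro i σ hs s hr
      obtain ⟨s', h1, h2, h3⟩ := hr.exec hw hL hs.1
      obtain ⟨s'', h4, h5, h6⟩ := ih j _ hs.2 s' h2
      refine ⟨s'', (Runs.ofInstrs_cons h1 h4).mono ?_, h5, h6.trans h3⟩
      simp only [List.length_cons]; omega
  match l, hl with
  | i :: l, _ =>
    intro s hr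
    obtain ⟨s', h1, h2, h3⟩ := key l i σ hs s hr
    exact ⟨_, s', h1, h2, h3, rfl⟩

theorem Det.mono {p : QProgram} {T T' : ℕ} {σ : IState} {Q Q' : IState → Prop}
    (h : Det X B p T σ Q) (hT : T ≤ T') (hQ : ∀ σ', Q σ' → Q' σ') : Det X B p T' σ Q' := by
  intro s hs
  obtain ⟨σ', s', h1, h2, h3, h4⟩ := h s hs
  exact ⟨σ', s', h1.mono hT, h2, h3, hQ _ h4⟩

theorem Det.seq {p q : QProgram} {T T' : ℕ} {σ : IState} {Q Q' : IState → Prop}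
    (h : Det X B p T σ Q) (h' : ∀ σ', Q σ' → Det X B q T' σ' Q') :
    Det X B (.seq p q) (T + T' + 1) σ Q' := by
  intro s hs
  obtain ⟨σ', s', h1, h2, h3, h4⟩ := h s hs
  obtain ⟨σ'', s'', h5, h6, h7, h8⟩ := h' σ' h4 s' h2
  exact ⟨σ'', s'', h1.seq_singleton h5, h6, h7.trans h3, h8⟩

theorem ofInt_ne_zero {n : ℕ} (h0 : 0 < n) (h : n < 2 ^ w) : BitVec.ofInt w n ≠ 0 := by
  intro h'
  have := congrArg BitVec.toNat h'
  rw [BitVec.ofInt_natCast, BitVec.toNat_ofNat, Nat.mod_eq_of_lt h] at this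
  simp at this
  omega

/-- Rule for a loop with a counter that decreases to `0`. -/
theorem Det.loop {p : QProgram} {T x : ℕ} (inv : ℕ → IState → Prop)
    (hx : ∀ k σ, inv k σ → σ.reg x = k) {n : ℕ} (hn : n < 2 ^ w)
    (h : ∀ k < n, ∀ σ, inv (k + 1) σ → Det X B p T σ (inv k)) {σ : IState} (hσ : inv n σ) :
    Det X B (.loop (B + x) p) (n * (T + 1) + 1) σ (inv 0) := by
  induction n generalizing σ with
  | zero =>
    intro s hs
    refine ⟨σ, s, (Runs.loop_zero ?_).mono (by omega), hs, rfl, hσ⟩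
    rw [hs.reg, hx _ _ hσ]; simp
  | succ n ih =>
    intro s hs
    obtain ⟨σ', s', h1, h2, h3, h4⟩ := h n (by omega) σ hσ s hs
    obtain ⟨σ'', s'', h5, h6, h7, h8⟩ := ih (by omega) (fun k hk => h k (by omega)) h4 s' h2
    refine ⟨σ'', s'', ?_, h6, h7.trans h3, h8⟩
    have := Runs.loop_succ (X := X) (x := B + x) (t' := n * (T + 1) + 1) (F := fun _ => {s''})
      (by rw [hs.reg, hx _ _ hσ]; exact ofInt_ne_zero (by omega) hn) h1 (by simpa using h5)
    rw [Multiset.singleton_bind] at this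
    exact this.mono (by rw [Nat.succ_mul]; omega)

theorem Det.tri {p : QProgram} {T : ℕ} {σ : IState} {b : ℝ} {Q : IState → Prop}
    {f : IState → ℝ} (h : Det X B p T σ Q) (hf : ∀ σ', Q σ' → f σ' ≤ b) : Tri X B p T σ b Q f := by
  intro s hs
  obtain ⟨σ', s', h1, h2, h3, h4⟩ := h s hs
  refine ⟨{(σ', s')}, by simpa using h1, by simpa using ⟨h2, h4⟩, ?_⟩
  simpa [h3] using mul_le_mul_of_nonneg_right (hf _ h4) s.vec.normSq_nonneg

theorem Tri.mono {p : QProgram} {T T' : ℕ} {σ : IState} {b b' : ℝ} {Q Q' : IState → Prop}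
    {f f' : IState → ℝ} (h : Tri X B p T σ b Q f) (hT : T ≤ T') (hb : b ≤ b')
    (hQ : ∀ σ', Q σ' → Q' σ') (hf : ∀ σ', Q σ' → f' σ' ≤ f σ') : Tri X B p T' σ b' Q' f' := by
  intro s hs
  obtain ⟨M, h1, h2, h3⟩ := h s hs
  refine ⟨M, h1.mono hT, fun e he => ⟨(h2 e he).1, hQ _ (h2 e he).2⟩, ?_⟩
  calc _ ≤ (M.map fun e => f e.1 * e.2.vec.normSq).sum :=
        Multiset.sum_map_le_sum_map _ _ fun e he =>
          mul_le_mul_of_nonneg_right (hf _ (h2 e he).2) e.2.vec.normSq_nonneg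
    _ ≤ _ := h3
    _ ≤ _ := mul_le_mul_of_nonneg_right hb s.vec.normSq_nonneg

/-- A constant has expectation exactly `c` by the conservation of the norm. This lets failure bounds
for different phases be added. -/
theorem Tri.add_const (hw : 1 ≤ w) {p : QProgram} {T : ℕ} {σ : IState} {b : ℝ}
    {Q : IState → Prop} {f : IState → ℝ} (h : Tri X B p T σ b Q f) (c : ℝ) :
    Tri X B p T σ (b + c) Q fun σ' => f σ' + c := by
  intro s hs
  obtain ⟨M, h1, h2, h3⟩ := h s hs
  refine ⟨M, h1, h2, ?_⟩
  have := h1.sum_normSq hw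
  rw [Multiset.map_map] at this
  simp only [add_mul]
  rw [Multiset.sum_map_add, Multiset.sum_map_mul_left]
  simp only [Function.comp_def] at this
  rw [this]
  linarith

/-- The tower property of expectations: the bound `f σ'` for the continuation from `σ'` is the
function whose expectation the first program controls. -/
theorem Tri.of_bind {p : QProgram} {k : List QProgram} {T T' : ℕ} {σ : IState} {b : ℝ}
    {Q Q' : IState → Prop} {f f' : IState → ℝ} (h : Tri X B p T σ b Q f)
    (h' : ∀ σ', Q σ' → ∀ s : RamState w, Represents X B σ' s →
      ∃ M : Multiset (IState × RamState w), Runs X k s T' (M.map Prod.snd) ∧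
      (∀ e ∈ M, Represents X B e.1 e.2 ∧ Q' e.1) ∧
      (M.map fun e => f' e.1 * e.2.vec.normSq).sum ≤ f σ' * s.vec.normSq)
    (s : RamState w) (hs : Represents X B σ s) :
    ∃ M : Multiset (IState × RamState w), Runs X (p :: k) s (T + T') (M.map Prod.snd) ∧
      (∀ e ∈ M, Represents X B e.1 e.2 ∧ Q' e.1) ∧
      (M.map fun e => f' e.1 * e.2.vec.normSq).sum ≤ b * s.vec.normSq := by
  obtain ⟨M, h1, h2, h3⟩ := h s hs
  have key : ∀ e ∈ M, ∃ M' : Multiset (IState × RamState w), Runs X k e.2 T' (M'.map Prod.snd) ∧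
      (∀ e ∈ M', Represents X B e.1 e.2 ∧ Q' e.1) ∧
      (M'.map fun e => f' e.1 * e.2.vec.normSq).sum ≤ f e.1 * e.2.vec.normSq :=
    fun e he => h' e.1 (h2 e he).2 e.2 (h2 e he).1
  choose! G hG1 hG2 hG3 using key
  refine ⟨M.bind G, ?_, ?_, ?_⟩
  · rw [Multiset.map_bind]
    exact h1.cons_map hG1
  · intro e he
    obtain ⟨e', he', h4⟩ := Multiset.mem_bind.1 he
    exact hG2 e' he' e h4
  · rw [Multiset.map_bind, Multiset.sum_bind]
    exact (Multiset.sum_map_le_sum_map _ _ hG3).trans h3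

theorem Tri.seq {p q : QProgram} {T T' : ℕ} {σ : IState} {b : ℝ}
    {Q Q' : IState → Prop} {f f' : IState → ℝ} (h : Tri X B p T σ b Q f)
    (h' : ∀ σ', Q σ' → Tri X B q T' σ' (f σ') Q' f') :
    Tri X B (.seq p q) (T + T' + 1) σ b Q' f' := by
  intro s hs
  obtain ⟨M, h1, h2, h3⟩ := h.of_bind h' s hs
  exact ⟨M, Runs.of_step_singleton rfl h1, h2, h3⟩

/-- Rule for a loop with a counter that decreases to `0`. -/
theorem Tri.loop {p : QProgram} {T x : ℕ} (inv : ℕ → IState → Prop) (f : ℕ → IState → ℝ)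
    (hx : ∀ k σ, inv k σ → σ.reg x = k) {n : ℕ} (hn : n < 2 ^ w)
    (h : ∀ k < n, ∀ σ, inv (k + 1) σ → Tri X B p T σ (f (k + 1) σ) (inv k) (f k)) {σ : IState}
    (hσ : inv n σ) :
    Tri X B (.loop (B + x) p) (n * (T + 1) + 1) σ (f n σ) (inv 0) (f 0) := by
  induction n generalizing σ with
  | zero =>
    intro s hs
    refine ⟨{(σ, s)}, by
      simpa using (Runs.loop_zero (X := X) (p := p) (by rw [hs.reg, hx _ _ hσ]; simp)),
      by simpa using ⟨hs, hσ⟩, by simp⟩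
  | succ n ih =>
    intro s hs
    obtain ⟨M, h1, h2, h3⟩ := (h n (by omega) σ hσ).of_bind (k := [.loop (B + x) p])
      (fun σ' hσ' => ih (by omega) (fun k hk => h k (by omega)) hσ') s hs
    refine ⟨M, (Runs.of_step_singleton (k' := [p, .loop (B + x) p]) (s' := s) ?_ h1).mono ?_, h2, h3⟩
    · simp only [step]
      rw [if_pos]
      rw [hs.reg, hx _ _ hσ]; exact ofInt_ne_zero (by omega) hn
    · rw [Nat.succ_mul]; omega

end Triples

/-! ## Calls of a minimum triangle algorithm -/

/-- Set all classical registers and arrays with names below a bound to `0`. -/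
def zeroBelow : ℕ → QProgram
  | 0 => .instr (.clear 0)
  | k + 1 => .seq (zeroBelow k) (.ofInstrs (.const k 0) [.clear k])

/-- Run `P` on parameter `3 m` (outer register `7`) and on the stored input, and then put the cells
`1, 2, 3` of array `0` into the outer registers `30, 31, 32`. -/
def callProgram (B : ℕ) (P : QProgram) : QProgram :=
  .seq (.instr .reset) (.seq (zeroBelow B) (.seq (.instr (.op .bor 0 (B + 7) (B + 7)))
    (.seq (P.redirect B) (.ofInstrs (.load (B + 30) 0 (B + 8))
      [.load (B + 31) 0 (B + 9), .load (B + 32) 0 (B + 10)]))))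

/-- The base case of `zeroBelow` clears array `0`, since a program consists of at least one
instruction. For this reason arrays are only said to survive if `1 ≤ a`. -/
theorem runs_zeroBelow {w : ℕ} {X : WordInput w} (k : ℕ) (s : RamState w) :
    ∃ s', Runs X [zeroBelow k] s (5 * k + 1) {s'} ∧ s'.vec = s.vec ∧
      (∀ x < k, s'.reg x = 0) ∧ (∀ x, k ≤ x → s'.reg x = s.reg x) ∧
      (∀ a < k, s'.arr a = fun _ => 0) ∧ ∀ a, k ≤ a → 1 ≤ a → s'.arr a = s.arr a := by
  induction k with
  | zero =>
    refine ⟨_, Runs.instr _ _, rfl, by simp, fun _ _ => rfl, by simp, fun a _ ha => ?_⟩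
    exact Function.update_of_ne (by omega) _ _
  | succ k ih =>
    obtain ⟨s', h1, h2, h3, h4, h5, h6⟩ := ih
    refine ⟨(s'.setReg k (BitVec.ofNat w 0)).setArr k fun _ => 0,
      (h1.seq_singleton (Runs.ofInstrs_cons rfl (Runs.ofInstrs_singleton rfl))).mono
      (by omega), h2, fun x hx => ?_, fun x hx => ?_, fun a ha => ?_, fun a ha ha' => ?_⟩
    · by_cases e : x = k
      · subst e; exact Function.update_self _ _ _
      · exact (Function.update_of_ne e _ _).trans (h3 x (by omega))
    · exact (Function.update_of_ne (by omega) _ _).trans (h4 x (by omega))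
    · by_cases e : a = k
      · subst e; exact Function.update_self _ _ _
      · exact (Function.update_of_ne e _ _).trans (h5 a (by omega))
    · exact (Function.update_of_ne (by omega) _ _).trans (h6 a (by omega) ha')

/-- The effect of a call with result `u, v, z`. -/
def IState.afterCall (σ : IState) (u₀ v₀ u v z : ℤ) : IState :=
  ((((σ.setReg 0 u₀).setReg 1 v₀).setReg 30 u).setReg 31 v).setReg 32 z

/-- The result of a call is correct. -/
def WMatrix.CorrectCall {n : ℕ} (A : WMatrix n) (u v z : ℤ) : Prop :=
  (∃ i j k : Fin n, A.IsMinTriangle i j k ∧ u = (i : ℕ) ∧ v = (j : ℕ) ∧ z = (k : ℕ)) ∨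
    ¬ ∃ i j k, A.IsTriangle i j k

theorem BitVec.ofInt_toNat {w : ℕ} (x : BitVec w) : BitVec.ofInt w (x.toNat : ℤ) = x := by
  rw [BitVec.ofInt_natCast, BitVec.ofNat_toNat, BitVec.setWidth_eq]

theorem successProb_eq {w n t : ℕ} {P : QProgram} {X : WordInput w} {N : Multiset (RamState w)}
    (h : Runs X [P] (RamState.init w n) t N) (good : RamState w → Prop) [DecidablePred good] :
    P.successProb n X t good = (N.map fun s => if good s then s.vec.normSq else 0).sum := by
  rw [QProgram.successProb, run_eq_outs, h, Multiset.map_map]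
  congr 1
  refine Multiset.map_congr rfl fun s _ => ?_
  simp

theorem normSq_init (w n : ℕ) : (RamState.init w n).vec.normSq = 1 := by
  simp [RamState.init, QVec.normSq_single]

/-! ### A call of the given algorithm, as a bound on an expectation -/

section

variable {w B : ℕ} {X : WordInput w} {P : QProgram} {c n TP : ℕ}
  {A : (minTriangle c).Inst n} {σ : IState} {f : IState → ℝ} {x y : ℝ}

/-- The value of `f` is at most `y` on branches with a correct answer and at most `x ≥ y` on the
others. Correct branches have total weight at least `2/3`, so the mean is at most `y + (x - y) / 3`.
The initial vector is `α` times the zero state, hence all weights are scaled by `‖α‖ ^ 2`. -/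
theorem exists_runs_call (hw : 1 ≤ w) (hB : 1 ≤ B) (hPB : P.bound ≤ B) (hn : n < 2 ^ w)
    (hP : ∃ t ≤ TP, P.HaltsWithin n ((minTriangle c).input w A) t ∧
      2 / 3 ≤ P.successProb n ((minTriangle c).input w A) t ((minTriangle c).correct A))
    (h7 : σ.reg 7 = n) (h8 : σ.reg 8 = 1) (h9 : σ.reg 9 = 2) (h10 : σ.reg 10 = 3)
    (hyx : y ≤ x)
    (hf : ∀ u₀ v₀ u v z : ℤ, 0 ≤ u → u < 2 ^ w → 0 ≤ v → v < 2 ^ w → 0 ≤ z → z < 2 ^ w →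
      f (σ.afterCall u₀ v₀ u v z) ≤ x)
    (hf' : ∀ u₀ v₀ u v z : ℤ, 0 ≤ u → u < 2 ^ w → 0 ≤ v → v < 2 ^ w → 0 ≤ z → z < 2 ^ w →
      A.1.CorrectCall u v z → f (σ.afterCall u₀ v₀ u v z) ≤ y)
    {s : RamState w} (hs : Represents X B σ s)
    (hX : s.storedInput B = (minTriangle c).input w A) {α : ℂ} (hα : α ≠ 0)
    (hv : s.vec = Finsupp.single (QBasis.zero w) α) :
    ∃ M : Multiset (IState × RamState w),
      Runs X [.seq (zeroBelow B) (.seq (.instr (.op .bor 0 (B + 7) (B + 7)))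
        (.seq (P.redirect B) (.ofInstrs (.load (B + 30) 0 (B + 8))
        [.load (B + 31) 0 (B + 9), .load (B + 32) 0 (B + 10)])))] s (13 * TP + 5 * B + 10)
        (M.map Prod.snd) ∧
      (∀ e ∈ M, Represents X B e.1 e.2 ∧ ∃ u₀ v₀ u v z : ℤ, (0 ≤ u ∧ u < 2 ^ w) ∧
        (0 ≤ v ∧ v < 2 ^ w) ∧ (0 ≤ z ∧ z < 2 ^ w) ∧ e.1 = σ.afterCall u₀ v₀ u v z) ∧
      (M.map fun e => f e.1 * e.2.vec.normSq).sum ≤ (y + (x - y) / 3) * s.vec.normSq := by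
  classical
  obtain ⟨t, ht, hhalt, hprob⟩ := hP
  obtain ⟨s1, r1, v1, z1, o1, a1, b1⟩ := runs_zeroBelow (X := X) B s
  set s2 : RamState w := s1.setReg 0 (BitVec.ofNat w n) with hs2
  have r2 : Runs X [.instr (.op .bor 0 (B + 7) (B + 7))] s1 1 {s2} := by
    have := Runs.instr (X := X) (.op .bor 0 (B + 7) (B + 7)) s1
    simp only [Instr.exec, WordOp.eval, BitVec.or_self] at this
    rwa [o1 _ (by omega), hs.reg, h7, BitVec.ofInt_natCast] at this
  have o2 : ∀ x, B ≤ x → s2.reg x = s.reg x := fun x hx =>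
    (Function.update_of_ne (by omega) _ _).trans (o1 x hx)
  have b2 : ∀ a, B ≤ a → s2.arr a = s.arr a := fun a ha => b1 a ha (by omega)
  have hX2 : s2.storedInput B = (minTriangle c).input w A := by
    rw [← hX]
    funext k i j
    simp only [RamState.storedInput]
    rw [b2 _ (by omega), b2 _ (by omega), b2 _ (by omega)]
  -- After the clearing, the memory below `B` is exactly an initial state with parameter `n`. The
  -- offset tables and the matrix lie above it and are left alone.
  have sim : Simulates B α s2 (RamState.init w n) s2 :=
    { reg := fun x hx => by
        by_cases e : x = 0
        · subst e; simp [hs2, RamState.setReg, RamState.init]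
        · simp only [hs2, RamState.setReg, RamState.init, Function.update_of_ne e]
          exact z1 x hx
      arr := fun a ha => a1 a ha
      vec := by
        change s1.vec = α • Finsupp.single _ 1
        rw [v1, hv, Finsupp.smul_single, smul_eq_mul, mul_one]
      clean := fun b hb x _ => by
        rw [Finset.mem_singleton.1 (Finsupp.support_single_subset hb)]; rfl
      outerReg := fun _ _ => rfl
      outerArr := fun _ _ => rfl }
  have hN := QProgram.exists_runs (X := (minTriangle c).input w A) (k := [P])
    (s := RamState.init w n) (t := t) hhalt
  obtain ⟨M, e1, e2, e3⟩ := sim.exists_runs (X := X) hα (by simpa using hPB) (hX2.symm ▸ hN)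
  set N := (outs ((minTriangle c).input w A) t ([P], RamState.init w n)).map Prod.snd with hNdef
  have hsum := hN.sum_normSq hw
  rw [normSq_init] at hsum
  rw [successProb_eq hN] at hprob
  have e1' : N = M.map Prod.fst := by rw [hNdef, ← hX2]; exact e1
  -- The scratch registers `B` and `B + 1` of the simulation are the outer registers `0` and `1`, so
  -- a call leaves arbitrary values there. The outer program keeps nothing in them.
  set g : RamState w → IState := fun s => σ.afterCall (s.reg B).toNat (s.reg (B + 1)).toNat
    (s.arr 0 (BitVec.ofNat w 1)).toNat (s.arr 0 (BitVec.ofNat w 2)).toNat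
    (s.arr 0 (BitVec.ofNat w 3)).toNat with hg
  set G : RamState w → RamState w := fun s => ((s.setReg (B + 30) (s.arr 0 (BitVec.ofNat w 1))).setReg
    (B + 31) (s.arr 0 (BitVec.ofNat w 2))).setReg (B + 32) (s.arr 0 (BitVec.ofNat w 3)) with hG
  have bnd : ∀ x : BitVec w, 0 ≤ (x.toNat : ℤ) ∧ (x.toNat : ℤ) < 2 ^ w := fun x =>
    ⟨by positivity, by exact_mod_cast x.isLt⟩
  have loads : ∀ e ∈ M, Runs X [.ofInstrs (.load (B + 30) 0 (B + 8))
      [.load (B + 31) 0 (B + 9), .load (B + 32) 0 (B + 10)]] e.2 5 {G e.2} := by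
    intro e he
    refine Runs.ofInstrs_cons rfl (Runs.ofInstrs_cons rfl (Runs.ofInstrs_singleton ?_))
    have h8' : e.2.reg (B + 8) = BitVec.ofNat w 1 := by
      rw [(e3 e he).outerReg _ (by omega), o2 _ (by omega), hs.reg, h8]; simp
    have h9' : e.2.reg (B + 9) = BitVec.ofNat w 2 := by
      rw [(e3 e he).outerReg _ (by omega), o2 _ (by omega), hs.reg, h9]; simp
    have h10' : e.2.reg (B + 10) = BitVec.ofNat w 3 := by
      rw [(e3 e he).outerReg _ (by omega), o2 _ (by omega), hs.reg, h10]; simp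
    simp [Instr.exec, RamState.setReg, hG, h8', h9', h10']
  refine ⟨M.map fun e => (g e.2, G e.2), ?_, ?_, ?_⟩
  · have h3 : Runs X [.seq (P.redirect B) (.ofInstrs (.load (B + 30) 0 (B + 8))
        [.load (B + 31) 0 (B + 9), .load (B + 32) 0 (B + 10)])] s2 (13 * t + 5 + 1)
        (M.bind fun e => {G e.2}) :=
      Runs.of_step_singleton rfl (Runs.cons_map e2 loads)
    rw [Multiset.bind_singleton] at h3
    rw [Multiset.map_map]
    exact (r1.seq_singleton (r2.seq_singleton h3)).mono (by omega)
  · intro e he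
    obtain ⟨d, hd, rfl⟩ := Multiset.mem_map.1 he
    refine ⟨⟨fun x => ?_, fun a z h0 h1 => ?_, hs.tab⟩, _, _, _, _, _, bnd _, bnd _, bnd _, rfl⟩
    · by_cases x0 : x = 0
      · subst x0
        simp [hg, hG, IState.afterCall, IState.setReg, RamState.setReg]
      by_cases x1 : x = 1
      · subst x1
        simp [hg, hG, IState.afterCall, IState.setReg, RamState.setReg]
      have hx : d.2.reg (B + x) = BitVec.ofInt w (σ.reg x) := by
        rw [(e3 d hd).outerReg _ (by omega), o2 _ (by omega), hs.reg]
      simp only [hg, hG, IState.afterCall, IState.setReg, RamState.setReg, Function.update_apply,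
        Nat.add_left_cancel_iff, x0, x1, if_false]
      split_ifs
      · exact (BitVec.ofInt_toNat _).symm
      · exact (BitVec.ofInt_toNat _).symm
      · exact (BitVec.ofInt_toNat _).symm
      · exact hx
    · change d.2.arr (B + a) _ = _
      rw [(e3 d hd).outerArr _ (by omega), b2 _ (by omega), hs.arr a z h0 h1]
      rfl
  · rw [Multiset.map_map]
    have hvG : ∀ e ∈ M, (G e.2).vec.normSq = ‖α‖ ^ 2 * e.1.vec.normSq := fun e he => by
      change e.2.vec.normSq = _
      rw [(e3 e he).vec, QVec.normSq_smul]
    have hfg : ∀ e ∈ M, f (g e.2) ≤ if (minTriangle c).correct A e.1 then y else x := by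
      intro e he
      split_ifs with hc
      · refine hf' _ _ _ _ _ (bnd _).1 (bnd _).2 (bnd _).1 (bnd _).2 (bnd _).1 (bnd _).2 ?_
        rcases hc with ⟨_, i, j, k, hm, hi, hj, hk⟩ | ⟨_, hc⟩
        · refine Or.inl ⟨i, j, k, hm, ?_, ?_, ?_⟩
          · rw [(e3 e he).arr 0 (by omega), hi, BitVec.toNat_ofNat, Nat.mod_eq_of_lt (by omega)]
          · rw [(e3 e he).arr 0 (by omega), hj, BitVec.toNat_ofNat, Nat.mod_eq_of_lt (by omega)]
          · rw [(e3 e he).arr 0 (by omega), hk, BitVec.toNat_ofNat, Nat.mod_eq_of_lt (by omega)]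
        · exact Or.inr hc
      · exact hf _ _ _ _ _ (bnd _).1 (bnd _).2 (bnd _).1 (bnd _).2 (bnd _).1 (bnd _).2
    calc _ ≤ (M.map fun e => ‖α‖ ^ 2 * (x * e.1.vec.normSq -
            (x - y) * if (minTriangle c).correct A e.1 then e.1.vec.normSq else 0)).sum := by
          refine Multiset.sum_map_le_sum_map _ _ fun e he => ?_
          simp only [Function.comp_apply]
          rw [hvG e he]
          have h1 := mul_le_mul_of_nonneg_right (hfg e he) e.1.vec.normSq_nonneg
          have h2 : (if (minTriangle c).correct A e.1 then y else x) * e.1.vec.normSq =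
              x * e.1.vec.normSq -
              (x - y) * if (minTriangle c).correct A e.1 then e.1.vec.normSq else 0 := by
            split_ifs <;> ring
          have h3 : (0 : ℝ) ≤ ‖α‖ ^ 2 := by positivity
          nlinarith [mul_le_mul_of_nonneg_left (h2 ▸ h1) h3]
      _ = ‖α‖ ^ 2 * (x * 1 - (x - y) *
            (N.map fun s => if (minTriangle c).correct A s then s.vec.normSq else 0).sum) := by
          rw [← hsum, e1', Multiset.map_map, Multiset.map_map, Multiset.sum_map_mul_left,
            Multiset.sum_map_sub, Multiset.sum_map_mul_left, Multiset.sum_map_mul_left]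
          rfl
      _ ≤ (y + (x - y) / 3) * ‖α‖ ^ 2 := by
          rw [mul_comm]
          refine mul_le_mul_of_nonneg_right ?_ (by positivity)
          nlinarith [mul_le_mul_of_nonneg_left hprob (sub_nonneg.2 hyx)]
      _ = _ := by rw [hv, QVec.normSq_single]

/-- The initial `reset` creates one branch for each basis state `b` in the support, with the vector
`s.vec b` times the zero state. The bound for a single branch is summed over them, and their weights
add up to the squared norm. -/
theorem tri_call (hw : 1 ≤ w) (hB : 1 ≤ B) (hPB : P.bound ≤ B) (hn : n < 2 ^ w)
    (hP : ∃ t ≤ TP, P.HaltsWithin n ((minTriangle c).input w A) t ∧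
      2 / 3 ≤ P.successProb n ((minTriangle c).input w A) t ((minTriangle c).correct A))
    (h7 : σ.reg 7 = n) (h8 : σ.reg 8 = 1) (h9 : σ.reg 9 = 2) (h10 : σ.reg 10 = 3)
    (hX : ∀ s : RamState w, Represents X B σ s → s.storedInput B = (minTriangle c).input w A)
    (hyx : y ≤ x)
    (hf : ∀ u₀ v₀ u v z : ℤ, 0 ≤ u → u < 2 ^ w → 0 ≤ v → v < 2 ^ w → 0 ≤ z → z < 2 ^ w →
      f (σ.afterCall u₀ v₀ u v z) ≤ x)
    (hf' : ∀ u₀ v₀ u v z : ℤ, 0 ≤ u → u < 2 ^ w → 0 ≤ v → v < 2 ^ w → 0 ≤ z → z < 2 ^ w →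
      A.1.CorrectCall u v z → f (σ.afterCall u₀ v₀ u v z) ≤ y) :
    Tri X B (callProgram B P) (13 * TP + 5 * B + 12) σ (y + (x - y) / 3)
      (fun σ' => ∃ u₀ v₀ u v z : ℤ, (0 ≤ u ∧ u < 2 ^ w) ∧
        (0 ≤ v ∧ v < 2 ^ w) ∧ (0 ≤ z ∧ z < 2 ^ w) ∧ σ' = σ.afterCall u₀ v₀ u v z) f := by
  intro s hs
  set S : QBasis w → RamState w := fun b =>
    { s with vec := Finsupp.single (QBasis.zero w) (s.vec b) } with hS
  have hR : ∀ b, Represents X B σ (S b) := fun b => ⟨hs.reg, hs.arr, hs.tab⟩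
  have key := fun b (hb : b ∈ s.vec.support.val) =>
    exists_runs_call hw hB hPB hn hP h7 h8 h9 h10 hyx hf hf' (hR b) (hX _ (hR b))
      (Finsupp.mem_support_iff.1 hb) rfl
  choose! G hG1 hG2 hG3 using key
  refine ⟨s.vec.support.val.bind G, ?_, fun e he => ?_, ?_⟩
  · rw [Multiset.map_bind]
    have h1 : Runs X [.instr .reset] s 1 (s.vec.support.val.map S) := Runs.instr _ _
    exact (Runs.of_step_singleton rfl (h1.cons_map hG1)).mono (by omega)
  · obtain ⟨b, hb, he⟩ := Multiset.mem_bind.1 he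
    exact hG2 b hb e he
  · rw [Multiset.map_bind, Multiset.sum_bind]
    refine (Multiset.sum_map_le_sum_map _ _ hG3).trans (le_of_eq ?_)
    rw [Multiset.sum_map_mul_left, QVec.normSq_eq_sum s.vec subset_rfl]
    congr 1
    exact congrArg Multiset.sum (Multiset.map_congr rfl fun b _ => QVec.normSq_single _ _)

end

/-! ## The weight matrix in the memory -/

/-- Whether a weight is finite. -/
def finFlag : WithTop ℤ → ℤ
  | none => 0
  | some _ => 1

/-- The value of a finite weight, and `0` for `∞`. -/
def finValue : WithTop ℤ → ℤ
  | none => 0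
  | some z => z

theorem finiteWord_eq (w : ℕ) (a : WithTop ℤ) : finiteWord w a = BitVec.ofInt w (finFlag a) := by
  cases a with
  | top => exact (BitVec.ofInt_natCast w 0).symm
  | coe a => exact (BitVec.ofInt_natCast w 1).symm

theorem valueWord_eq (w : ℕ) (a : WithTop ℤ) : valueWord w a = BitVec.ofInt w (finValue a) := by
  cases a with
  | top => exact (BitVec.ofInt_natCast w 0).symm
  | coe a => rfl

@[simp] theorem finFlag_top : finFlag ⊤ = 0 := rfl
@[simp] theorem finValue_top : finValue ⊤ = 0 := rfl
@[simp] theorem finFlag_coe (z : ℤ) : finFlag (z : WithTop ℤ) = 1 := rfl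
@[simp] theorem finValue_coe (z : ℤ) : finValue (z : WithTop ℤ) = z := rfl

/-- The matrix that is stored, row by row with rows of length `S`, in the arrays `0` (flags) and
`1` (values). -/
noncomputable def storedMat (S : ℤ) (a : ℕ → ℤ → ℤ) (x y : ℤ) : WithTop ℤ :=
  if (0 ≤ x ∧ x < S) ∧ (0 ≤ y ∧ y < S) ∧ a 0 (x * S + y) = 1 then a 1 (x * S + y) else ⊤

/-- The arrays `0` and `1` contain the matrix `W`. -/
def Stores (S : ℤ) (a : ℕ → ℤ → ℤ) (W : ℤ → ℤ → WithTop ℤ) : Prop :=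
  ∀ x y, 0 ≤ x → x < S → 0 ≤ y → y < S →
    a 0 (x * S + y) = finFlag (W x y) ∧ a 1 (x * S + y) = finValue (W x y)

theorem Stores.congr {S : ℤ} {a a' : ℕ → ℤ → ℤ} {W : ℤ → ℤ → WithTop ℤ} (h : Stores S a W)
    (h0 : a' 0 = a 0) (h1 : a' 1 = a 1) : Stores S a' W := by
  intro x y hx hx' hy hy'
  rw [h0, h1]
  exact h x y hx hx' hy hy'

theorem Stores.mat_eq {S : ℤ} {a : ℕ → ℤ → ℤ} {W : ℤ → ℤ → WithTop ℤ} (h : Stores S a W)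
    (hW : ∀ x y, W x y ≠ ⊤ → (0 ≤ x ∧ x < S) ∧ 0 ≤ y ∧ y < S) : storedMat S a = W := by
  funext x y
  rw [storedMat]
  by_cases hxy : (0 ≤ x ∧ x < S) ∧ 0 ≤ y ∧ y < S
  · obtain ⟨⟨h1, h2⟩, h3, h4⟩ := hxy
    obtain ⟨h5, h6⟩ := h x y h1 h2 h3 h4
    rw [h5, h6]
    cases hc : W x y with
    | top => simp
    | coe z => simp [h1, h2, h3, h4]
  · rw [if_neg fun h => hxy ⟨h.1, h.2.1⟩]
    by_contra hne
    exact hxy (hW x y (Ne.symm hne))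

/-- Overwrite the entries `(x, y)` and `(y, x)`. -/
noncomputable def symUpdate (W : ℤ → ℤ → WithTop ℤ) (x y : ℤ) (e : WithTop ℤ) (x' y' : ℤ) :
    WithTop ℤ :=
  if (x' = x ∧ y' = y) ∨ (x' = y ∧ y' = x) then e else W x' y'

/-- The code that processes an answer has no branches and always writes an entry. A rejected answer
writes the old entry back, which changes nothing in a symmetric matrix. -/
theorem symUpdate_self {W : ℤ → ℤ → WithTop ℤ} (hW : ∀ x y, W x y = W y x) (x y : ℤ) :
    symUpdate W x y (W x y) = W := by
  funext x' y'
  simp only [symUpdate]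
  split_ifs with h
  · rcases h with ⟨rfl, rfl⟩ | ⟨rfl, rfl⟩
    · rfl
    · exact hW _ _
  · rfl

theorem add_mul_inj {S x y x' y' : ℤ} (hy : 0 ≤ y) (hyS : y < S) (hy' : 0 ≤ y') (hyS' : y' < S) :
    x * S + y = x' * S + y' ↔ x = x' ∧ y = y' := by
  constructor
  · intro h
    have h1 : (x * S + y) / S = (x' * S + y') / S := by rw [h]
    have h2 : (x * S + y) % S = (x' * S + y') % S := by rw [h]
    rw [mul_comm, mul_comm x', Int.mul_add_ediv_left _ _ (by omega),
      Int.mul_add_ediv_left _ _ (by omega), Int.ediv_eq_zero_of_lt hy hyS,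
      Int.ediv_eq_zero_of_lt hy' hyS'] at h1
    rw [mul_comm, mul_comm x', Int.mul_add_emod_self_left, Int.mul_add_emod_self_left,
      Int.emod_eq_of_lt hy hyS, Int.emod_eq_of_lt hy' hyS'] at h2
    omega
  · rintro ⟨rfl, rfl⟩; rfl

/-- Write the entry with flag in register `f` and value in register `v` to the positions `(x, y)`
and `(y, x)`, which are given by registers. -/
def putCode (x y f v : ℕ) : List IntInstr :=
  [.op .mul 60 x 5, .op .add 60 60 y, .store 0 60 f, .store 1 60 v,
    .op .mul 60 y 5, .op .add 60 60 x, .store 0 60 f, .store 1 60 v]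

section

variable {S L : ℤ} {σ : IState} {x y f v : ℕ}

theorem reg_execAll_putCode {r : ℕ} (hr : r ≠ 60) :
    (execAll (putCode x y f v) σ).reg r = σ.reg r := by
  simp [putCode, execAll, IntInstr.exec, IState.setReg_reg, IState.setCell_reg, hr]

theorem tab_execAll_putCode : (execAll (putCode x y f v) σ).tab = σ.tab := rfl

theorem arr_execAll_putCode {a : ℕ} (ha : 2 ≤ a) :
    (execAll (putCode x y f v) σ).arr a = σ.arr a := by
  funext z
  simp [putCode, execAll, IntInstr.exec, IState.setReg_arr, IState.setCell_arr,
    show a ≠ 0 by omega, show a ≠ 1 by omega]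

theorem mul_add_lt_mul_self {S x y : ℤ} (h1 : x < S) (h2 : 0 ≤ x) (h3 : y < S) :
    x * S + y < S * S := by nlinarith

theorem safeAll_putCode (h5 : σ.reg 5 = S) (hx : x ≠ 60) (hy : y ≠ 60)
    (hx0 : 0 ≤ σ.reg x) (hxS : σ.reg x < S) (hy0 : 0 ≤ σ.reg y) (hyS : σ.reg y < S)
    (hL : S * S < L) : SafeAll L (putCode x y f v) σ := by
  have h1 := mul_add_lt_mul_self hxS hx0 hyS
  have h2 := mul_add_lt_mul_self hyS hy0 hxS
  have h3 : 0 ≤ σ.reg x * S := by nlinarith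
  have h4 : 0 ≤ σ.reg y * S := by nlinarith
  simp [putCode, SafeAll, IntInstr.Safe, IntOp.Safe, IntOp.eval, IntInstr.exec, IState.setReg_reg,
    IState.setCell_reg, hx, hy, h5]
  omega

theorem stores_execAll_putCode {W : ℤ → ℤ → WithTop ℤ} (h : Stores S σ.arr W) (h5 : σ.reg 5 = S)
    (hx : x ≠ 60) (hy : y ≠ 60) (hf : f ≠ 60) (hv : v ≠ 60)
    (hx0 : 0 ≤ σ.reg x) (hxS : σ.reg x < S) (hy0 : 0 ≤ σ.reg y) (hyS : σ.reg y < S)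
    {e : WithTop ℤ} (hfe : σ.reg f = finFlag e) (hve : σ.reg v = finValue e) :
    Stores S (execAll (putCode x y f v) σ).arr (symUpdate W (σ.reg x) (σ.reg y) e) := by
  intro x' y' hx' hxS' hy' hyS'
  have h1 := h x' y' hx' hxS' hy' hyS'
  simp only [putCode, execAll, IntInstr.exec, IState.setReg_reg, IState.setCell_reg,
    IState.setReg_arr, IState.setCell_arr, hx, hy, hf, hv, h5, IntOp.eval, symUpdate,
    add_mul_inj hy' hyS' hx0 hxS, add_mul_inj hy' hyS' hy0 hyS, hfe, hve, if_true, if_false,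
    Nat.reduceEqDiff, true_and, false_and, zero_ne_one, one_ne_zero]
  by_cases c1 : x' = σ.reg x ∧ y' = σ.reg y <;> by_cases c2 : x' = σ.reg y ∧ y' = σ.reg x <;>
    simp [c1, c2, h1]

end

/-! ### The tripartite graph and the numerical parameters -/

/-- Two vertices in different parts of the tripartite graph with parts `1, …, N`,
`N + 1, …, 2 N`, `2 N + 1, …, 3 N`. -/
def Cross (N x y : ℤ) : Prop :=
  (1 ≤ x ∧ x ≤ N ∧ N < y ∧ y ≤ 3 * N) ∨ (N < x ∧ x ≤ 2 * N ∧ 1 ≤ y ∧ y ≤ N) ∨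
  (N < x ∧ x ≤ 2 * N ∧ 2 * N < y ∧ y ≤ 3 * N) ∨ (2 * N < x ∧ x ≤ 3 * N ∧ 1 ≤ y ∧ y ≤ 2 * N)

/-- The matrix of a tripartite graph with weights at most `H`. -/
structure Tripartite (N H : ℤ) (W : ℤ → ℤ → WithTop ℤ) : Prop where
  symm : ∀ x y, W x y = W y x
  cross : ∀ x y, W x y ≠ ⊤ → Cross N x y
  bound : ∀ x y (z : ℤ), W x y = z → |z| ≤ H

theorem Tripartite.update {N H : ℤ} {W : ℤ → ℤ → WithTop ℤ} (h : Tripartite N H W) {x y : ℤ}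
    {e : WithTop ℤ} (hc : e ≠ ⊤ → Cross N x y) (he : ∀ z : ℤ, e = z → |z| ≤ H) :
    Tripartite N H (symUpdate W x y e) where
  symm x' y' := by
    simp only [symUpdate]
    rw [h.symm x' y']
    exact if_congr (by tauto) rfl rfl
  cross x' y' := by
    simp only [symUpdate]
    split_ifs with h'
    · intro h1
      have := hc h1
      unfold Cross at this ⊢
      omega
    · exact h.cross x' y'
  bound x' y' := by
    simp only [symUpdate]
    split_ifs
    · exact he
    · exact h.bound x' y'

theorem Tripartite.mem_range {N H : ℤ} {W : ℤ → ℤ → WithTop ℤ} (h : Tripartite N H W) (x y : ℤ)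
    (hxy : W x y ≠ ⊤) : (0 ≤ x ∧ x < 3 * N + 1) ∧ 0 ≤ y ∧ y < 3 * N + 1 := by
  have := h.cross x y hxy
  unfold Cross at this
  omega

/-- Parameters of the main program: `m ^ 3` is the number of rows of the padded matrices, `r` the
number of repetitions of the calls, `2 ^ q` a bound for all weights, `L` half the number of words. -/
structure Params where
  n : ℕ
  m : ℕ
  r : ℕ
  q : ℕ
  L : ℤ

namespace Params

variable (p : Params)

/-- The number of rows of the padded matrices. -/
def N : ℤ := (p.m : ℤ) ^ 3

/-- The number of rows of the matrix in the memory. -/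
def S : ℤ := 3 * p.N + 1

/-- The number of blocks. -/
def t : ℤ := (p.m : ℤ) ^ 2

/-- A bound for all weights. -/
def top : ℤ := 2 ^ p.q

/-- The number of calls in one round. -/
def calls : ℕ := 2 * p.m ^ 6 * p.r

/-- Conditions on the parameters. -/
structure Ok : Prop where
  n_pos : 1 ≤ p.n
  n_le : p.n ≤ p.m ^ 3
  r_pos : 1 ≤ p.r
  S_lt : p.S * p.S < p.L
  calls_lt : (p.calls : ℤ) + 1 < p.L
  top_lt : 8 * p.top < p.L
  q_lt : (p.q : ℤ) + 1 < p.L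

end Params

/-- The registers that contain parameters, and the zeros in the arrays that describe the vertices
of an instance. -/
structure Env (p : Params) (σ : IState) : Prop where
  r2 : σ.reg 2 = p.n
  r3 : σ.reg 3 = p.m
  r4 : σ.reg 4 = p.N
  r5 : σ.reg 5 = p.S
  r6 : σ.reg 6 = p.t
  r7 : σ.reg 7 = 3 * p.m
  r8 : σ.reg 8 = 1
  r9 : σ.reg 9 = 2
  r10 : σ.reg 10 = 3
  r11 : σ.reg 11 = 2 * p.N
  r13 : σ.reg 13 = p.top
  r14 : σ.reg 14 = p.r
  r15 : σ.reg 15 = p.calls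
  r16 : σ.reg 16 = p.N * p.N
  r25 : σ.reg 25 = p.q + 1
  a2 : ∀ z : ℤ, 3 * (p.m : ℤ) ≤ z → σ.arr 2 z = 0
  a3 : ∀ z : ℤ, 3 * (p.m : ℤ) ≤ z → σ.arr 3 z = 0

theorem Env.congr {p : Params} {σ σ' : IState} (h : Env p σ)
    (hr : ∀ r, 2 ≤ r → r ≤ 25 → r ≠ 12 → (r < 17 ∨ 23 < r) → σ'.reg r = σ.reg r)
    (h2 : ∀ z : ℤ, 3 * (p.m : ℤ) ≤ z → σ'.arr 2 z = σ.arr 2 z)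
    (h3 : ∀ z : ℤ, 3 * (p.m : ℤ) ≤ z → σ'.arr 3 z = σ.arr 3 z) : Env p σ' := by
  obtain ⟨r2, r3, r4, r5, r6, r7, r8, r9, r10, r11, r13, r14, r15, r16, r25, a2, a3⟩ := h
  constructor
  case a2 => exact fun z hz => (h2 z hz).trans (a2 z hz)
  case a3 => exact fun z hz => (h3 z hz).trans (a3 z hz)
  all_goals rw [hr _ (by norm_num) (by norm_num) (by norm_num) (by norm_num)]; assumption

namespace Params.Ok

variable {p : Params}

theorem m_pos (h : p.Ok) : 1 ≤ p.m := by
  by_contra h0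
  have h1 := h.n_le
  have h2 := h.n_pos
  rw [show p.m = 0 by omega] at h1
  omega

theorem N_pos (h : p.Ok) : 1 ≤ p.N := by
  have := h.m_pos
  have : (1 : ℤ) ≤ p.m := by exact_mod_cast this
  exact one_le_pow₀ this

theorem t_pos (h : p.Ok) : 1 ≤ p.t := by
  have := h.m_pos
  have : (1 : ℤ) ≤ p.m := by exact_mod_cast this
  exact one_le_pow₀ this

theorem top_pos : 1 ≤ p.top := one_le_pow₀ (by norm_num)

theorem N_eq : p.N = p.t * p.m := by simp only [N, t]; ring

theorem m_le (h : p.Ok) : (p.m : ℤ) ≤ p.N := by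
  have := h.t_pos
  rw [N_eq]; nlinarith

theorem t_le (h : p.Ok) : p.t ≤ p.N := by
  have := h.m_pos
  have := h.t_pos
  rw [N_eq]; nlinarith

theorem NN_le (h : p.Ok) : p.N * p.N < p.L := by
  have := h.N_pos
  have h1 := h.S_lt
  simp only [S] at h1
  nlinarith

theorem S_le (h : p.Ok) : p.S < p.L := by
  have := h.S_lt
  have := h.N_pos
  have h1 : 1 ≤ p.S := by simp only [S]; omega
  nlinarith

end Params.Ok

/-! ## Sweeps over all pairs of indices -/

/-- Decrease the sweep counter, and compute the indices and vertices that belong to it. -/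
def sweepHead : List IntInstr :=
  [.op .sub 17 17 8, .op .div 33 17 4, .op .mod 34 17 4, .op .add 35 33 8, .op .add 36 34 4,
    .op .add 36 36 8, .op .add 37 34 11, .op .add 37 37 8, .op .add 38 33 11, .op .add 38 38 8]

/-- Execute `body` for all pairs of indices. -/
def sweep (B : ℕ) (body : List IntInstr) : QProgram :=
  .seq (code B [.const 17 0, .op .add 17 17 16]) (.loop (B + 17) (code B (sweepHead ++ body)))

/-- The contents of the registers after `sweepHead`. -/
structure AtCell (N i j : ℤ) (σ : IState) : Prop where
  r17 : σ.reg 17 = i * N + j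
  r33 : σ.reg 33 = i
  r34 : σ.reg 34 = j
  r35 : σ.reg 35 = i + 1
  r36 : σ.reg 36 = j + N + 1
  r37 : σ.reg 37 = j + 2 * N + 1
  r38 : σ.reg 38 = i + 2 * N + 1

/-- The parts of the memory that are not changed by sweeps. -/
structure SweepFrame (σ σ' : IState) : Prop where
  reg : ∀ r < 33, r ≠ 17 → σ'.reg r = σ.reg r
  a2 : σ'.arr 2 = σ.arr 2
  a3 : σ'.arr 3 = σ.arr 3
  tab : σ'.tab = σ.tab

theorem SweepFrame.trans {σ σ' σ'' : IState} (h : SweepFrame σ σ') (h' : SweepFrame σ' σ'') :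
    SweepFrame σ σ'' :=
  ⟨fun r h1 h2 => (h'.reg r h1 h2).trans (h.reg r h1 h2), h'.a2.trans h.a2, h'.a3.trans h.a3,
    h'.tab.trans h.tab⟩

theorem SweepFrame.env {p : Params} {σ σ' : IState} (h : SweepFrame σ σ') (hE : Env p σ) :
    Env p σ' :=
  hE.congr (fun r _ h2 _ h4 => h.reg r (by omega) (by omega)) (fun z _ => by rw [h.a2])
    (fun z _ => by rw [h.a3])

section

variable {w : ℕ} {X : WordInput w} {B : ℕ} {p : Params} {σ : IState}

theorem Params.cast_m6 : ((p.m ^ 6 : ℕ) : ℤ) = p.N * p.N := by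
  simp only [Params.N]; push_cast; ring

theorem sweepHead_spec (ok : p.Ok) (hE : Env p σ) {i j : ℤ} (hi : 0 ≤ i) (hiN : i < p.N)
    (hj : 0 ≤ j) (hjN : j < p.N) (h17 : σ.reg 17 = i * p.N + j + 1) :
    SafeAll p.L sweepHead σ ∧ SweepFrame σ (execAll sweepHead σ) ∧
      AtCell p.N i j (execAll sweepHead σ) ∧ (execAll sweepHead σ).arr = σ.arr := by
  have h1 : (i * p.N + j) / p.N = i := by
    rw [mul_comm, Int.mul_add_ediv_left _ _ (by omega), Int.ediv_eq_zero_of_lt hj hjN, add_zero]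
  have h2 : (i * p.N + j) % p.N = j := by
    rw [mul_comm, Int.mul_add_emod_self_left, Int.emod_eq_of_lt hj hjN]
  have h3 := mul_add_lt_mul_self hiN hi hjN
  have h4 := ok.NN_le
  have h5 : 0 ≤ i * p.N := by nlinarith
  have h6 : p.N < p.L := by have := ok.S_le; simp only [Params.S] at this; omega
  refine ⟨?_, ⟨fun r hr hr' => ?_, rfl, rfl, rfl⟩, ?_, rfl⟩
  · simp only [sweepHead, SafeAll, IntInstr.Safe, IntOp.Safe, IntOp.eval, IntInstr.exec,
      IState.setReg_reg, h17, hE.r8, hE.r4, Nat.reduceEqDiff, if_true, if_false,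
      add_sub_cancel_right, true_and, and_true]
    omega
  · exact reg_execAll_of_notMem (by simp [sweepHead, IntInstr.dest]; omega) _
  · constructor <;>
    simp only [sweepHead, execAll, IntInstr.exec, IState.setReg_reg, IntOp.eval, h17, hE.r8, hE.r4,
      hE.r11, add_sub_cancel_right, h1, h2, Nat.reduceEqDiff, if_true, if_false]

/-- The counter runs down from `N * N = m ^ 6`, and its value `k = i * N + j` encodes a pair of
indices. Thus `I k` typically says that the cells with number at least `k` have been treated. The
head of the body has ten instructions, which accounts for `20` of the `21` extra steps. -/
theorem det_sweep (hw : 1 ≤ w) (hL : 2 * p.L = 2 ^ w) (ok : p.Ok) (hE : Env p σ)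
    {body : List IntInstr} (I : ℕ → (ℕ → ℤ → ℤ) → Prop) (h0 : I (p.m ^ 6) σ.arr)
    (step : ∀ i j : ℤ, 0 ≤ i → i < p.N → 0 ≤ j → j < p.N → ∀ k : ℕ, (k : ℤ) = i * p.N + j →
      ∀ σ', SweepFrame σ σ' → AtCell p.N i j σ' → I (k + 1) σ'.arr →
      SafeAll p.L body σ' ∧ (execAll body σ').reg 17 = σ'.reg 17 ∧
        SweepFrame σ' (execAll body σ') ∧ I k (execAll body σ').arr) :
    Det X B (sweep B body) (p.m ^ 6 * (2 * body.length + 21) + 6) σ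
      fun σ' => SweepFrame σ σ' ∧ I 0 σ'.arr := by
  have hN := ok.N_pos
  set inv : ℕ → IState → Prop := fun k σ' => (σ'.reg 17 = k ∧ (k : ℤ) ≤ p.N * p.N) ∧
    SweepFrame σ σ' ∧ I k σ'.arr with hinv
  have hloop : ∀ k < p.m ^ 6, ∀ σ', inv (k + 1) σ' →
      Det X B (code B (sweepHead ++ body)) (2 * body.length + 20) σ' (inv k) := by
    rintro k - σ' ⟨⟨h17, hk⟩, hF, hI⟩
    push_cast at hk h17
    set i : ℤ := k / p.N with hi
    set j : ℤ := k % p.N with hj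
    have hij : (k : ℤ) = i * p.N + j := by
      rw [hi, hj, mul_comm]; exact (Int.mul_ediv_add_emod (k : ℤ) p.N).symm
    have hi0 : 0 ≤ i := Int.ediv_nonneg (by positivity) (by omega)
    have hiN : i < p.N := Int.ediv_lt_of_lt_mul (by omega) (by omega)
    have hj0 : 0 ≤ j := Int.emod_nonneg _ (by omega)
    have hjN : j < p.N := Int.emod_lt_of_pos _ (by omega)
    obtain ⟨h1, h2, h3, h4⟩ := sweepHead_spec ok (hF.env hE) hi0 hiN hj0 hjN (h17.trans (by rw [hij]))
    obtain ⟨h5, h6, h7, h8⟩ := step i j hi0 hiN hj0 hjN k hij _ (hF.trans h2) h3 (h4.symm ▸ hI)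
    refine (det_code hw hL (by simp [sweepHead]) (safeAll_append.2 ⟨h1, h5⟩)).mono ?_ ?_
    · simp [sweepHead]; omega
    · rintro _ rfl
      rw [execAll_append]
      exact ⟨⟨by rw [h6, h3.r17, hij], by omega⟩, (hF.trans h2).trans h7, h8⟩
  have hm : p.m ^ 6 < 2 ^ w := by
    have h1 := ok.NN_le
    have h2 : 0 ≤ p.N * p.N := by positivity
    have : ((p.m ^ 6 : ℕ) : ℤ) < 2 ^ w := by rw [Params.cast_m6]; omega
    exact_mod_cast this
  refine ((det_code hw hL (by simp) (by simp [SafeAll, IntInstr.Safe, IntOp.Safe])).seq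
    (T' := p.m ^ 6 * (2 * body.length + 21) + 1) (Q' := inv 0) ?_).mono ?_ ?_
  · rintro _ rfl
    refine Det.loop inv (fun k σ h => h.1.1) hm hloop ⟨⟨?_, by rw [Params.cast_m6]⟩,
      ⟨fun r hr hr' => ?_, rfl, rfl, rfl⟩, h0⟩
    · rw [Params.cast_m6]
      simp [execAll, IntInstr.exec, IState.setReg_reg, IntOp.eval, hE.r16]
    · simp [execAll, IntInstr.exec, IState.setReg_reg, hr']
  · simp only [List.length_cons, List.length_nil]; omega
  · exact fun σ' h => h.2

/-- Put thresholds into the matrix. -/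
def thresholdBody : List IntInstr :=
  [.load 39 4 17, .op .add 40 39 12, .const 41 0, .op .sub 42 41 40] ++ putCode 35 36 8 42

theorem cell_inj {N i j i' j' : ℤ} (hj : 0 ≤ j) (hjN : j < N) (hj' : 0 ≤ j') (hjN' : j' < N)
    (h : i * N + j = i' * N + j') : i = i' ∧ j = j' :=
  (add_mul_inj hj hjN hj' hjN').1 h

/-- Every edge between the first two parts receives the negated threshold; this also restores the
edges that the previous round deleted. The two factors are stored at positions that involve the
third part and stay as they are. -/
theorem det_threshold (hw : 1 ≤ w) (hL : 2 * p.L = 2 ^ w) (ok : p.Ok) (hE : Env p σ)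
    {W : ℤ → ℤ → WithTop ℤ} (hS : Stores p.S σ.arr W) (hT : Tripartite p.N p.top W)
    (hlo : ∀ i j, 0 ≤ i → i < p.N → 0 ≤ j → j < p.N →
      |σ.arr 4 (i * p.N + j) + σ.reg 12| ≤ p.top) :
    Det X B (sweep B thresholdBody) (p.m ^ 6 * 45 + 6) σ fun σ' => SweepFrame σ σ' ∧
      σ'.arr 4 = σ.arr 4 ∧ ∃ W', Stores p.S σ'.arr W' ∧ Tripartite p.N p.top W' ∧
      (∀ x y, 2 * p.N < x ∨ 2 * p.N < y → W' x y = W x y) ∧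
      ∀ i j, 0 ≤ i → i < p.N → 0 ≤ j → j < p.N →
        W' (i + 1) (j + p.N + 1) = ((-(σ.arr 4 (i * p.N + j) + σ.reg 12) : ℤ) : WithTop ℤ) := by
  have hN := ok.N_pos
  refine (det_sweep hw hL ok hE (fun k a => a 4 = σ.arr 4 ∧ ∃ W', Stores p.S a W' ∧
      Tripartite p.N p.top W' ∧ (∀ x y, 2 * p.N < x ∨ 2 * p.N < y → W' x y = W x y) ∧
      ∀ i j, 0 ≤ i → i < p.N → 0 ≤ j → j < p.N → (k : ℤ) ≤ i * p.N + j →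
        W' (i + 1) (j + p.N + 1) = ((-(σ.arr 4 (i * p.N + j) + σ.reg 12) : ℤ) : WithTop ℤ))
    ⟨rfl, W, hS, hT, fun _ _ _ => rfl, fun i j hi hiN hj hjN h => ?_⟩ ?_).mono
      (by simp [thresholdBody, putCode]) fun σ' h => ⟨h.1, h.2.1, ?_⟩
  · rw [Params.cast_m6] at h
    have := mul_add_lt_mul_self hiN hi hjN
    omega
  · rintro i j hi hiN hj hjN k hk σ' hF hC ⟨h4, W', hS', hT', hW, hW'⟩
    have hE' := hF.env hE
    set σ1 := execAll [.load 39 4 17, .op .add 40 39 12, .const 41 0, .op .sub 42 41 40] σ' with hσ1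
    have r42 : σ1.reg 42 = -(σ.arr 4 (i * p.N + j) + σ.reg 12) := by
      simp [hσ1, execAll, IntInstr.exec, IState.setReg_reg, IntOp.eval, hC.r17, h4,
        hF.reg 12]
    have rr : ∀ r < 39, σ1.reg r = σ'.reg r := by
      intro r hr
      exact reg_execAll_of_notMem (by simp [IntInstr.dest]; omega) _
    have ra : σ1.arr = σ'.arr := rfl
    have hx0 : 0 ≤ σ1.reg 35 ∧ σ1.reg 35 < p.S := by
      rw [rr _ (by omega), hC.r35, Params.S]; omega
    have hy0 : 0 ≤ σ1.reg 36 ∧ σ1.reg 36 < p.S := by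
      rw [rr _ (by omega), hC.r36, Params.S]; omega
    have h5 : σ1.reg 5 = p.S := by rw [rr _ (by omega), hE'.r5]
    have hS1 := stores_execAll_putCode (S := p.S) (σ := σ1) (x := 35) (y := 36) (f := 8) (v := 42)
      (ra ▸ hS') h5 (by omega) (by omega) (by omega) (by omega) hx0.1 hx0.2 hy0.1 hy0.2
      (e := ((-(σ.arr 4 (i * p.N + j) + σ.reg 12) : ℤ) : WithTop ℤ))
      (by rw [rr _ (by omega), hE'.r8]; rfl) (by rw [r42]; rfl)
    rw [rr 35 (by omega), rr 36 (by omega), hC.r35, hC.r36] at hS1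
    have hNN := mul_add_lt_mul_self hiN hi hjN
    have hNN' := ok.NN_le
    have hiN' : 0 ≤ i * p.N := by nlinarith
    refine ⟨safeAll_append.2 ⟨?_, safeAll_putCode h5 (by omega) (by omega) hx0.1 hx0.2 hy0.1 hy0.2
      ok.S_lt⟩, ?_, ⟨fun r hr hr' => ?_, ?_, ?_, ?_⟩, ?_, symUpdate W' (i + 1) (j + p.N + 1)
        ((-(σ.arr 4 (i * p.N + j) + σ.reg 12) : ℤ) : WithTop ℤ), ?_, ?_, fun x y hxy => ?_,
        fun i' j' hi' hiN' hj' hjN' hk' => ?_⟩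
    · simp [SafeAll, IntInstr.Safe, IntOp.Safe, hC.r17]
      omega
    · rw [thresholdBody, execAll_append, reg_execAll_putCode (by omega), rr _ (by omega)]
    · rw [thresholdBody, execAll_append, reg_execAll_putCode (by omega), rr _ (by omega)]
    · rw [thresholdBody, execAll_append, arr_execAll_putCode (by omega)]; rfl
    · rw [thresholdBody, execAll_append, arr_execAll_putCode (by omega)]; rfl
    · rw [thresholdBody, execAll_append, tab_execAll_putCode]; rfl
    · rw [thresholdBody, execAll_append, arr_execAll_putCode (by omega), ← h4]; rfl
    · rw [thresholdBody, execAll_append]; exact hS1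
    · refine hT'.update (fun _ => by unfold Cross; omega) fun z hz => ?_
      rw [← WithTop.coe_injective hz, abs_neg]
      exact hlo i j hi hiN hj hjN
    · rw [symUpdate, if_neg (by omega), hW x y hxy]
    · rw [symUpdate]
      split_ifs with hc
      · have : i' = i ∧ j' = j := by omega
        rw [this.1, this.2]
      · refine hW' i' j' hi' hiN' hj' hjN' ?_
        by_contra hlt
        have := cell_inj hj hjN hj' hjN' (show i * p.N + j = i' * p.N + j' by push_cast at hlt; omega)
        omega
  · obtain ⟨-, W', h1, h2, h3, h4⟩ := h.2
    refine ⟨W', h1, h2, h3, fun i j hi hiN hj hjN => h4 i j hi hiN hj hjN ?_⟩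
    push_cast
    nlinarith

/-- Add the step to the lower bounds for those pairs whose entry in the matrix is still finite. -/
def raiseBody : List IntInstr :=
  [.op .mul 43 35 5, .op .add 43 43 36, .load 44 0 43, .op .mul 44 44 12, .load 39 4 17,
    .op .add 39 39 44, .store 4 17 39]

/-- An edge that has survived the main loop means that the entry is not below the threshold, so the
lower half of the interval is discarded. Multiplication by the flag takes the place of a case
distinction. -/
theorem det_raise (hw : 1 ≤ w) (hL : 2 * p.L = 2 ^ w) (ok : p.Ok) (hE : Env p σ)
    {W : ℤ → ℤ → WithTop ℤ} (hS : Stores p.S σ.arr W) :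
    Det X B (sweep B raiseBody) (p.m ^ 6 * 35 + 6) σ fun σ' => SweepFrame σ σ' ∧
      Stores p.S σ'.arr W ∧ ∀ i j, 0 ≤ i → i < p.N → 0 ≤ j → j < p.N →
        σ'.arr 4 (i * p.N + j) =
          σ.arr 4 (i * p.N + j) + finFlag (W (i + 1) (j + p.N + 1)) * σ.reg 12 := by
  have hN := ok.N_pos
  refine (det_sweep hw hL ok hE (fun k a => a 0 = σ.arr 0 ∧ a 1 = σ.arr 1 ∧
      ∀ i j, 0 ≤ i → i < p.N → 0 ≤ j → j < p.N → a 4 (i * p.N + j) =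
        σ.arr 4 (i * p.N + j) + if (k : ℤ) ≤ i * p.N + j then
          finFlag (W (i + 1) (j + p.N + 1)) * σ.reg 12 else 0)
    ⟨rfl, rfl, fun i j hi hiN hj hjN => ?_⟩ ?_).mono
      (by simp [raiseBody]) fun σ' h => ⟨h.1, hS.congr h.2.1 h.2.2.1, ?_⟩
  · have := mul_add_lt_mul_self hiN hi hjN
    rw [Params.cast_m6, if_neg (by omega), add_zero]
  · rintro i j hi hiN hj hjN k hk σ' hF hC ⟨h0, h1, h4⟩
    have hE' := hF.env hE
    have hadr := mul_add_lt_mul_self (show i + 1 < p.S by rw [Params.S]; omega) (by omega)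
      (show j + p.N + 1 < p.S by rw [Params.S]; omega)
    have hadr0 : 0 ≤ (i + 1) * p.S := by
      have : 0 ≤ p.S := by rw [Params.S]; omega
      nlinarith
    have hadr' := ok.S_lt
    have hNN := mul_add_lt_mul_self hiN hi hjN
    have hNN' := ok.NN_le
    have hiN' : 0 ≤ i * p.N := by nlinarith
    have hfl := (hS (i + 1) (j + p.N + 1) (by omega) (by rw [Params.S]; omega) (by omega)
      (by rw [Params.S]; omega)).1
    refine ⟨?_, ?_, ⟨fun r hr hr' => ?_, ?_, ?_, rfl⟩, ?_, ?_, ?_⟩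
    · simp [raiseBody, SafeAll, IntInstr.Safe, IntOp.Safe, IntOp.eval, IntInstr.exec,
        IState.setReg_reg, hC.r17, hC.r35, hC.r36, hE'.r5]
      omega
    · simp [raiseBody, execAll, IntInstr.exec, IState.setReg_reg, IState.setCell_reg]
    · exact reg_execAll_of_notMem (by simp [raiseBody, IntInstr.dest]; omega) _
    · exact arr_execAll_of_notMem (by simp [raiseBody, IntInstr.arrDest]) _
    · exact arr_execAll_of_notMem (by simp [raiseBody, IntInstr.arrDest]) _
    · funext z; simp [raiseBody, execAll, IntInstr.exec, IState.setReg_arr, IState.setCell_arr, h0]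
    · funext z; simp [raiseBody, execAll, IntInstr.exec, IState.setReg_arr, IState.setCell_arr, h1]
    · intro i' j' hi' hiN' hj' hjN'
      have e4 := h4 i' j' hi' hiN' hj' hjN'
      have e5 := h4 i j hi hiN hj hjN
      simp only [raiseBody, execAll, IntInstr.exec, IState.setReg_arr, IState.setCell_arr,
        IState.setReg_reg, IntOp.eval, hC.r17, hC.r35, hC.r36, hE'.r5, h0, hfl, Nat.reduceEqDiff, if_true, if_false, true_and]
      by_cases hc : i' * p.N + j' = i * p.N + j
      · obtain ⟨rfl, rfl⟩ := cell_inj hj' hjN' hj hjN hc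
        simp [e5, hk, hF.reg 12]
      · simp only [hc, if_false]
        rw [e4]
        congr 1
        exact if_congr (by push_cast; omega) rfl rfl
  · intro i j hi hiN hj hjN
    rw [h.2.2.2 i j hi hiN hj hjN, if_pos (by push_cast; nlinarith)]

/-- Write two entries, computed by `pre`, to the matrix, and initialise the lower bounds. -/
def fillBody (pre : List IntInstr) : List IntInstr :=
  pre ++ (putCode 35 37 41 42 ++ (putCode 38 36 45 46 ++
    [.const 43 0, .op .sub 43 43 13, .store 4 17 43]))

/-- The code `pre` computes flags and values of the entries `(i, j)` of `U` and `V`. -/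
def Computes (p : Params) (σ : IState) (pre : List IntInstr) (U V : ℤ → ℤ → WithTop ℤ) : Prop :=
  ∀ i j : ℤ, 0 ≤ i → i < p.N → 0 ≤ j → j < p.N → ∀ σ', SweepFrame σ σ' → AtCell p.N i j σ' →
    σ'.arr 4 (i * p.N + j) = σ.arr 4 (i * p.N + j) →
    SafeAll p.L pre σ' ∧ (∀ r < 39, (execAll pre σ').reg r = σ'.reg r) ∧
    (execAll pre σ').arr = σ'.arr ∧ (execAll pre σ').tab = σ'.tab ∧
    (execAll pre σ').reg 41 = finFlag (U i j) ∧ (execAll pre σ').reg 42 = finValue (U i j) ∧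
    (execAll pre σ').reg 45 = finFlag (V i j) ∧ (execAll pre σ').reg 46 = finValue (V i j)

/-- The invariant also records that array `4` is unchanged at cells that are still to be visited:
when a product is put back into the matrix, `pre` reads the lower bound of a cell just before the
same pass resets it to `-p.top`. -/
theorem det_fill (hw : 1 ≤ w) (hL : 2 * p.L = 2 ^ w) (ok : p.Ok) (hE : Env p σ)
    {W U V : ℤ → ℤ → WithTop ℤ} (hS : Stores p.S σ.arr W) (hT : Tripartite p.N p.top W)
    {pre : List IntInstr} (hpre : Computes p σ pre U V)
    (hU : ∀ i j (z : ℤ), U i j = z → |z| ≤ p.top) (hV : ∀ i j (z : ℤ), V i j = z → |z| ≤ p.top) :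
    Det X B (sweep B (fillBody pre)) (p.m ^ 6 * (2 * pre.length + 59) + 6) σ
      fun σ' => SweepFrame σ σ' ∧
      ∃ W', Stores p.S σ'.arr W' ∧ Tripartite p.N p.top W' ∧
      ∀ i j, 0 ≤ i → i < p.N → 0 ≤ j → j < p.N → W' (i + 1) (j + 2 * p.N + 1) = U i j ∧
        W' (i + 2 * p.N + 1) (j + p.N + 1) = V i j ∧ σ'.arr 4 (i * p.N + j) = -p.top := by
  have hN := ok.N_pos
  refine (det_sweep hw hL ok hE (fun k a => ∃ W', Stores p.S a W' ∧ Tripartite p.N p.top W' ∧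
      ∀ i j, 0 ≤ i → i < p.N → 0 ≤ j → j < p.N →
        ((k : ℤ) ≤ i * p.N + j → W' (i + 1) (j + 2 * p.N + 1) = U i j ∧
          W' (i + 2 * p.N + 1) (j + p.N + 1) = V i j ∧ a 4 (i * p.N + j) = -p.top) ∧
        (i * p.N + j < (k : ℤ) → a 4 (i * p.N + j) = σ.arr 4 (i * p.N + j)))
    ⟨W, hS, hT, fun i j hi hiN hj hjN => ⟨fun h => ?_, fun _ => rfl⟩⟩ ?_).mono
      (Nat.add_le_add_right (Nat.mul_le_mul_left _ (by simp [fillBody, putCode]; omega)) _) fun σ' h => ⟨h.1, ?_⟩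
  · rw [Params.cast_m6] at h
    have := mul_add_lt_mul_self hiN hi hjN
    omega
  · rintro i j hi hiN hj hjN k hk σ' hF hC ⟨W', hS', hT', hW'⟩
    have hE' := hF.env hE
    obtain ⟨hs, hr, ha, ht, h41, h42, h45, h46⟩ := hpre i j hi hiN hj hjN σ' hF hC
      ((hW' i j hi hiN hj hjN).2 (by push_cast; omega))
    set σ1 := execAll pre σ' with hσ1
    set σ2 := execAll (putCode 35 37 41 42) σ1 with hσ2
    set σ3 := execAll (putCode 38 36 45 46) σ2 with hσ3
    have hex : execAll (fillBody pre) σ' =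
        execAll [.const 43 0, .op .sub 43 43 13, .store 4 17 43] σ3 := by
      simp only [fillBody, execAll_append, hσ1, hσ2, hσ3]
    have r2 : ∀ r ≠ 60, σ2.reg r = σ1.reg r := fun r hr => reg_execAll_putCode hr
    have r3 : ∀ r ≠ 60, σ3.reg r = σ1.reg r := fun r hr =>
      (reg_execAll_putCode hr).trans (r2 r hr)
    have r3' : ∀ r < 39, σ3.reg r = σ'.reg r := fun r h => (r3 r (by omega)).trans (hr r h)
    have a3 : ∀ a, 2 ≤ a → σ3.arr a = σ'.arr a := fun a h =>
      (arr_execAll_putCode h).trans ((arr_execAll_putCode h).trans (by rw [ha]))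
    have hx : σ1.reg 35 = i + 1 := (hr _ (by omega)).trans hC.r35
    have hy : σ1.reg 37 = j + 2 * p.N + 1 := (hr _ (by omega)).trans hC.r37
    have hx' : σ2.reg 38 = i + 2 * p.N + 1 := (r2 _ (by omega)).trans ((hr _ (by omega)).trans hC.r38)
    have hy' : σ2.reg 36 = j + p.N + 1 := (r2 _ (by omega)).trans ((hr _ (by omega)).trans hC.r36)
    have h5 : σ1.reg 5 = p.S := (hr _ (by omega)).trans hE'.r5
    have h5' : σ2.reg 5 = p.S := (r2 _ (by omega)).trans h5
    have bx : 0 ≤ σ1.reg 35 ∧ σ1.reg 35 < p.S := by rw [hx, Params.S]; omega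
    have by' : 0 ≤ σ1.reg 37 ∧ σ1.reg 37 < p.S := by rw [hy, Params.S]; omega
    have bx' : 0 ≤ σ2.reg 38 ∧ σ2.reg 38 < p.S := by rw [hx', Params.S]; omega
    have by'' : 0 ≤ σ2.reg 36 ∧ σ2.reg 36 < p.S := by rw [hy', Params.S]; omega
    have hS1 := stores_execAll_putCode (S := p.S) (σ := σ1) (x := 35) (y := 37) (f := 41) (v := 42)
      (ha ▸ hS') h5 (by omega) (by omega) (by omega) (by omega) bx.1 bx.2 by'.1 by'.2 h41 h42
    have hS2 := stores_execAll_putCode (S := p.S) (σ := σ2) (x := 38) (y := 36) (f := 45) (v := 46)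
      hS1 h5' (by omega) (by omega) (by omega) (by omega) bx'.1 bx'.2 by''.1 by''.2
      ((r2 _ (by omega)).trans h45) ((r2 _ (by omega)).trans h46)
    rw [hx, hy, hx', hy'] at hS2
    have hNN := mul_add_lt_mul_self hiN hi hjN
    have hNN' := ok.NN_le
    have hiN' : 0 ≤ i * p.N := by nlinarith
    have f17 : σ3.reg 17 = i * p.N + j := (r3' _ (by omega)).trans hC.r17
    have f13 : σ3.reg 13 = p.top := (r3' _ (by omega)).trans hE'.r13
    rw [hex]
    refine ⟨?_, ?_, ⟨fun r hr hr' => ?_, ?_, ?_, ?_⟩, _, hS2.congr ?_ ?_, ?_,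
      fun i' j' hi' hiN' hj' hjN' => ⟨fun hk' => ?_, fun hk' => ?_⟩⟩
    · rw [fillBody, safeAll_append, safeAll_append, safeAll_append]
      refine ⟨hs, safeAll_putCode h5 (by omega) (by omega) bx.1 bx.2 by'.1 by'.2 ok.S_lt,
        safeAll_putCode h5' (by omega) (by omega) bx'.1 bx'.2 by''.1 by''.2 ok.S_lt, ?_⟩
      simp [SafeAll, IntInstr.Safe, IntOp.Safe, IntOp.eval, IntInstr.exec, IState.setReg_reg,
        ← hσ1, ← hσ2, ← hσ3, f17]
      omega
    · simp [execAll, IntInstr.exec, IState.setReg_reg, IState.setCell_reg, r3' 17]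
    · simp only [execAll, IntInstr.exec, IState.setReg_reg, IState.setCell_reg]
      rw [if_neg (by omega), if_neg (by omega), r3' r (by omega)]
    · rw [← a3 2 (by omega)]
      funext z; simp [execAll, IntInstr.exec, IState.setReg_arr, IState.setCell_arr]
    · rw [← a3 3 (by omega)]
      funext z; simp [execAll, IntInstr.exec, IState.setReg_arr, IState.setCell_arr]
    · exact ht
    · funext z; simp [execAll, IntInstr.exec, IState.setReg_arr, IState.setCell_arr, hσ3]
    · funext z; simp [execAll, IntInstr.exec, IState.setReg_arr, IState.setCell_arr, hσ3]
    · exact (hT'.update (fun _ => by unfold Cross; omega) (hU i j)).update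
        (fun _ => by unfold Cross; omega) (hV i j)
    · simp only [execAll, IntInstr.exec, IState.setReg_arr, IState.setCell_arr, IState.setReg_reg,
        IntOp.eval, f17, f13, Nat.reduceEqDiff, if_true, if_false, true_and]
      by_cases hc : i' = i ∧ j' = j
      · obtain ⟨rfl, rfl⟩ := hc
        refine ⟨?_, ?_, by simp⟩
        · rw [symUpdate, if_neg (by omega), symUpdate, if_pos (by omega)]
        · rw [symUpdate, if_pos (by omega)]
      · have hne : i' * p.N + j' ≠ i * p.N + j := fun h => hc (cell_inj hj' hjN' hj hjN h)
        obtain ⟨g1, g2, g3⟩ := (hW' i' j' hi' hiN' hj' hjN').1 (by push_cast; omega)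
        refine ⟨?_, ?_, ?_⟩
        · rw [symUpdate, if_neg (by omega), symUpdate, if_neg (by omega), g1]
        · rw [symUpdate, if_neg (by omega), symUpdate, if_neg (by omega), g2]
        · rw [if_neg hne, a3 4 (by omega), g3]
    · have hne : i' * p.N + j' ≠ i * p.N + j := by omega
      simp only [execAll, IntInstr.exec, IState.setReg_arr, IState.setCell_arr, IState.setReg_reg,
        IntOp.eval, f17, f13, Nat.reduceEqDiff, if_true, if_false, true_and, hne]
      rw [a3 4 (by omega), (hW' i' j' hi' hiN' hj' hjN').2 (by push_cast; omega)]
  · obtain ⟨W', h1, h2, h3⟩ := h.2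
    exact ⟨W', h1, h2, fun i j hi hiN hj hjN => (h3 i j hi hiN hj hjN).1 (by push_cast; nlinarith)⟩

end

/-! ## One call in the main loop -/

/-- The index of the block of rows, columns or middle vertices in triple `τ` of blocks. -/
def blk (p : Params) (τ c : ℤ) : ℤ :=
  if c = 0 then τ % p.t else if c = 1 then τ / p.t % p.t else τ / p.t / p.t % p.t

/-- The vertex with number `x` of the instance for triple `τ` of blocks. -/
def vtx (p : Params) (τ x : ℤ) : ℤ :=
  blk p τ (x / p.m) * p.m + x % p.m + x / p.m * p.N + 1

/-- Decrease the main counter, and determine the blocks. -/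
def decodeCode : List IntInstr :=
  [.op .sub 18 18 8, .op .mod 33 21 6, .op .div 34 21 6, .op .mod 35 34 6, .op .div 36 34 6,
    .op .mod 37 36 6, .const 38 0, .store 5 38 33, .store 5 8 35, .store 5 9 37, .const 23 0,
    .op .add 23 23 7]

/-- Determine one vertex of the instance. -/
def vertexBody : List IntInstr :=
  [.op .sub 23 23 8, .op .div 33 23 3, .op .mod 34 23 3, .load 35 5 33, .op .mul 35 35 3,
    .op .mul 36 33 4, .op .add 35 35 34, .op .add 35 35 36, .op .add 35 35 8, .op .mul 36 35 5,
    .store 2 23 36, .store 3 23 35]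

/-- Prepare the instance for the next call. -/
def setupProgram (B : ℕ) : QProgram :=
  .seq (code B decodeCode) (.loop (B + 23) (code B vertexBody))

/-- The effect of the preparation of an instance. -/
structure SetUp (p : Params) (σ σ' : IState) : Prop where
  reg : ∀ r < 33, r ≠ 18 → r ≠ 23 → σ'.reg r = σ.reg r
  r18 : σ'.reg 18 = σ.reg 18 - 1
  arr : ∀ a, a ≠ 2 → a ≠ 3 → a ≠ 5 → σ'.arr a = σ.arr a
  tab : σ'.tab = σ.tab
  a2 : ∀ z : ℤ, 0 ≤ z → z < 3 * (p.m : ℤ) → σ'.arr 2 z = vtx p (σ.reg 21) z * p.S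
  a3 : ∀ z : ℤ, 0 ≤ z → z < 3 * (p.m : ℤ) → σ'.arr 3 z = vtx p (σ.reg 21) z
  a2' : ∀ z : ℤ, 3 * (p.m : ℤ) ≤ z → σ'.arr 2 z = σ.arr 2 z
  a3' : ∀ z : ℤ, 3 * (p.m : ℤ) ≤ z → σ'.arr 3 z = σ.arr 3 z

theorem SetUp.env {p : Params} {σ σ' : IState} (h : SetUp p σ σ') (hE : Env p σ) : Env p σ' :=
  hE.congr (fun r _ h2 _ h4 => h.reg r (by omega) (by omega) (by omega)) h.a2' h.a3'

section

variable {w : ℕ} {X : WordInput w} {B : ℕ} {p : Params} {σ : IState}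

theorem Params.Ok.blk_bounds (ok : p.Ok) (τ c : ℤ) : 0 ≤ blk p τ c ∧ blk p τ c < p.t := by
  have := ok.t_pos
  unfold blk
  split_ifs
  all_goals exact ⟨Int.emod_nonneg _ (by omega), Int.emod_lt_of_pos _ (by omega)⟩

theorem Params.Ok.part_bounds (ok : p.Ok) {x : ℤ} (h0 : 0 ≤ x) (h3 : x < 3 * p.m) :
    0 ≤ x / p.m ∧ x / p.m ≤ 2 ∧ 0 ≤ x % p.m ∧ x % p.m < p.m := by
  have := ok.m_pos
  refine ⟨Int.ediv_nonneg h0 (by omega), ?_, Int.emod_nonneg _ (by omega),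
    Int.emod_lt_of_pos _ (by omega)⟩
  have : x / p.m < 3 := Int.ediv_lt_of_lt_mul (by omega) (by omega)
  omega

theorem Params.Ok.offset_lt (ok : p.Ok) {b x : ℤ} (hb : b < p.t) (hb0 : 0 ≤ b) (hx : x < p.m)
    (hx0 : 0 ≤ x) : 0 ≤ b * p.m + x ∧ b * p.m + x < p.N := by
  have := ok.m_pos
  rw [Params.Ok.N_eq]
  constructor <;> nlinarith

theorem Params.Ok.vtx_part (ok : p.Ok) (τ : ℤ) {x : ℤ} (h0 : 0 ≤ x) (h3 : x < 3 * p.m) :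
    (x / p.m = 0 ∨ x / p.m = 1 ∨ x / p.m = 2) ∧ x / p.m * p.N + 1 ≤ vtx p τ x ∧
      vtx p τ x ≤ x / p.m * p.N + p.N := by
  obtain ⟨h1, h2, h4, h5⟩ := ok.part_bounds h0 h3
  obtain ⟨h6, h7⟩ := ok.blk_bounds τ (x / p.m)
  have := ok.offset_lt h7 h6 h5 h4
  unfold vtx
  omega

theorem Params.Ok.vtx_bounds (ok : p.Ok) (τ : ℤ) {x : ℤ} (h0 : 0 ≤ x) (h3 : x < 3 * p.m) :
    1 ≤ vtx p τ x ∧ vtx p τ x ≤ 3 * p.N := by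
  have := ok.N_pos
  obtain ⟨h1 | h1 | h1, h2, h4⟩ := ok.vtx_part τ h0 h3 <;> rw [h1] at h2 h4 <;> omega

/-- Only the `3 m` row offsets and column offsets are written, never the weights. The cost linear in
`m` is what keeps the preparation cheaper than the call. -/
theorem det_setup (hw : 1 ≤ w) (hL : 2 * p.L = 2 ^ w) (ok : p.Ok) (hE : Env p σ)
    (h0 : 0 ≤ σ.reg 21) (h1 : σ.reg 21 < p.L) :
    Det X B (setupProgram B) (75 * p.m + 26) σ (SetUp p σ) := by
  have ht := ok.t_pos
  have hN := ok.N_pos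
  have hm : (1 : ℤ) ≤ p.m := by exact_mod_cast ok.m_pos
  have hSL := ok.S_lt
  have hSL' := ok.S_le
  have hS3 : 3 * p.N < p.L := by rw [Params.S] at hSL'; omega
  have hmN := ok.m_le
  have htN := ok.t_le
  set τ := σ.reg 21 with hτ
  have d1 : 0 ≤ τ / p.t ∧ τ / p.t ≤ τ :=
    ⟨Int.ediv_nonneg h0 (by omega), Int.ediv_le_self _ h0⟩
  have d2 : 0 ≤ τ / p.t / p.t ∧ τ / p.t / p.t ≤ τ :=
    ⟨Int.ediv_nonneg d1.1 (by omega), (Int.ediv_le_self _ d1.1).trans d1.2⟩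
  set σ1 := execAll decodeCode σ with hσ1
  have e5 : ∀ c, 0 ≤ c → c ≤ 2 → σ1.arr 5 c = blk p τ c := by
    intro c hc hc2
    simp only [hσ1, decodeCode, execAll, IntInstr.exec, IState.setReg_reg, IState.setCell_reg,
      IState.setReg_arr, IState.setCell_arr, IntOp.eval, hE.r8, hE.r6, hE.r9, ← hτ,
      Nat.reduceEqDiff, if_true, if_false, true_and, blk]
    have : c = 0 ∨ c = 1 ∨ c = 2 := by omega
    rcases this with rfl | rfl | rfl <;> simp
  have e23 : σ1.reg 23 = 3 * p.m := by
    simp only [hσ1, decodeCode, execAll, IntInstr.exec, IState.setReg_reg, IState.setCell_reg,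
      IntOp.eval, hE.r7, Nat.reduceEqDiff, if_true, if_false]
    simp
  have e18 : σ1.reg 18 = σ.reg 18 - 1 := by
    simp only [hσ1, decodeCode, execAll, IntInstr.exec, IState.setReg_reg, IState.setCell_reg,
      IntOp.eval, hE.r8, Nat.reduceEqDiff, if_true, if_false]
  have er : ∀ r < 33, r ≠ 18 → r ≠ 23 → σ1.reg r = σ.reg r := fun r _ _ _ =>
    reg_execAll_of_notMem (by simp [decodeCode, IntInstr.dest]; omega) _
  have ea : ∀ a, a ≠ 5 → σ1.arr a = σ.arr a := fun a _ =>
    arr_execAll_of_notMem (by simp [decodeCode, IntInstr.arrDest]; omega) _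
  set inv : ℕ → IState → Prop := fun k σ' => σ'.reg 23 = k ∧ (k : ℤ) ≤ 3 * p.m ∧
    (∀ r < 33, r ≠ 23 → σ'.reg r = σ1.reg r) ∧ (∀ a, a ≠ 2 → a ≠ 3 → σ'.arr a = σ1.arr a) ∧
    σ'.tab = σ.tab ∧ (∀ z : ℤ, k ≤ z → z < 3 * p.m → σ'.arr 2 z = vtx p τ z * p.S ∧
      σ'.arr 3 z = vtx p τ z) ∧ ∀ z : ℤ, 3 * (p.m : ℤ) ≤ z → σ'.arr 2 z = σ.arr 2 z ∧ σ'.arr 3 z = σ.arr 3 z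
    with hinv
  have hbody : ∀ k < 3 * p.m, ∀ σ', inv (k + 1) σ' → Det X B (code B vertexBody) 24 σ' (inv k) := by
    rintro k hk σ' ⟨g23, -, gr, ga, gt, gz, gz'⟩
    have g8 : σ'.reg 8 = 1 := by rw [gr _ (by omega) (by omega), er _ (by omega) (by omega) (by omega), hE.r8]
    have g3 : σ'.reg 3 = p.m := by rw [gr _ (by omega) (by omega), er _ (by omega) (by omega) (by omega), hE.r3]
    have g4 : σ'.reg 4 = p.N := by rw [gr _ (by omega) (by omega), er _ (by omega) (by omega) (by omega), hE.r4]
    have g5 : σ'.reg 5 = p.S := by rw [gr _ (by omega) (by omega), er _ (by omega) (by omega) (by omega), hE.r5]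
    have hk3 : (k : ℤ) < 3 * p.m := by omega
    have hk0 : (0 : ℤ) ≤ k := by positivity
    obtain ⟨p1, p2, p3, p4⟩ := ok.part_bounds hk0 hk3
    obtain ⟨v1, v2⟩ := ok.vtx_bounds τ hk0 hk3
    have g35 : σ'.arr 5 ((k : ℤ) / p.m) = blk p τ ((k : ℤ) / p.m) := by
      rw [ga _ (by omega) (by omega), e5 _ p1 p2]
    push_cast at g23
    refine (det_code hw hL (by simp [vertexBody]) ?_).mono (by simp [vertexBody]) ?_
    · simp only [vertexBody, SafeAll, IntInstr.Safe, IntOp.Safe, IntOp.eval, IntInstr.exec,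
        IState.setReg_reg, IState.setCell_reg, g23, g8, g3, Nat.reduceEqDiff, if_true, if_false,
        add_sub_cancel_right, true_and, and_true]
      omega
    · rintro _ rfl
      refine ⟨?_, by omega, fun r hr hr' => ?_, fun a ha ha' => ?_, ?_, fun z hz hz3 => ?_,
        fun z hz => ?_⟩
      · simp only [vertexBody, execAll, IntInstr.exec, IState.setReg_reg, IState.setCell_reg,
          IntOp.eval, g23, g8, Nat.reduceEqDiff, if_true, if_false, add_sub_cancel_right]
      · rw [reg_execAll_of_notMem (by simp [vertexBody, IntInstr.dest]; omega), gr r hr hr']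
      · rw [arr_execAll_of_notMem (by simp [vertexBody, IntInstr.arrDest]; omega), ga a ha ha']
      · rw [tab_execAll, gt]
      · simp only [vertexBody, execAll, IntInstr.exec, IState.setReg_reg, IState.setCell_reg,
          IState.setReg_arr, IState.setCell_arr, IntOp.eval, g23, g8, g3, g4, g5, g35,
          Nat.reduceEqDiff, if_true, if_false, add_sub_cancel_right, true_and, false_and]
        by_cases hzk : z = k
        · subst hzk
          simp only [if_true]
          exact ⟨rfl, rfl⟩
        · simp only [hzk, if_false]
          exact gz z (by push_cast; omega) hz3
      · have hzk : z ≠ k := by omega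
        simp only [vertexBody, execAll, IntInstr.exec, IState.setReg_reg, IState.setCell_reg,
          IState.setReg_arr, IState.setCell_arr, IntOp.eval, g23, g8,
          Nat.reduceEqDiff, if_true, if_false, add_sub_cancel_right, true_and, false_and, hzk]
        exact gz' z hz
  refine ((det_code hw hL (l := decodeCode) (by simp [decodeCode]) ?_).seq
    (T' := 3 * p.m * (24 + 1) + 1) (Q' := inv 0) ?_).mono ?_ ?_
  · simp only [decodeCode, SafeAll, IntInstr.Safe, IntOp.Safe, IntOp.eval, IntInstr.exec,
      IState.setReg_reg, IState.setCell_reg, hE.r8, hE.r6, hE.r9, ← hτ, Nat.reduceEqDiff, if_true,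
      if_false, true_and, and_true]
    simp
    omega
  · rintro _ rfl
    refine Det.loop inv (fun k σ h => h.1) ?_ hbody ⟨by rw [← hσ1, e23]; push_cast; ring,
      by push_cast; omega, fun _ _ _ => rfl, fun _ _ _ => rfl, tab_execAll _ _,
      fun z hz hz3 => ?_, fun z _ => ⟨?_, ?_⟩⟩
    · have : ((3 * p.m : ℕ) : ℤ) < 2 ^ w := by push_cast; omega
      exact_mod_cast this
    · push_cast at hz; omega
    · rw [← hσ1, ea _ (by omega)]
    · rw [← hσ1, ea _ (by omega)]
  · simp [decodeCode]; omega
  · rintro σ' ⟨-, -, hr, ha, ht, hz, hz'⟩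
    exact ⟨fun r h1 h2 h3 => (hr r h1 h3).trans (er r h1 h2 h3),
      (hr _ (by omega) (by omega)).trans e18,
      fun a h1 h2 h3 => (ha a h1 h2).trans (ea a h3), ht,
      fun z h1 h2 => (hz z (by simpa using h1) h2).1, fun z h1 h2 => (hz z (by simpa using h1) h2).2,
      fun z h => (hz' z h).1, fun z h => (hz' z h).2⟩

/-! ### Verification of an answer, and deletion of an edge -/

/-- Reorder three vertices such that the third one is above `M` if one of them is. -/
def reorder (M a b c : ℤ) : ℤ × ℤ × ℤ :=
  if M < a then (if M < b then (c, a, b) else (c, b, a)) else if M < b then (a, c, b) else (a, b, c)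

/-- The vertices form a triangle of negative weight, and the first two are not in the third part. -/
def Accept (N : ℤ) (W : ℤ → ℤ → WithTop ℤ) (v : ℤ × ℤ × ℤ) : Prop :=
  W v.1 v.2.1 + W v.1 v.2.2 + W v.2.1 v.2.2 < 0 ∧ v.1 ≤ 2 * N ∧ v.2.1 ≤ 2 * N

/-- Look up the vertices that were found, and reorder them. -/
def reorderCode : List IntInstr :=
  [.load 33 3 30, .load 34 3 31, .load 35 3 32,
    .op .lt 36 11 33, .op .sub 37 35 33, .op .mul 37 36 37, .op .add 33 33 37, .op .sub 35 35 37,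
    .op .lt 36 11 34, .op .sub 37 35 34, .op .mul 37 36 37, .op .add 34 34 37, .op .sub 35 35 37]

/-- Look up the weights of the triangle. -/
def weightCode : List IntInstr :=
  [.op .mul 38 33 5, .op .add 39 38 34, .load 40 0 39, .load 41 1 39,
    .op .add 39 38 35, .load 42 0 39, .load 43 1 39,
    .op .mul 38 34 5, .op .add 39 38 35, .load 44 0 39, .load 45 1 39]

/-- Decide whether the triangle is accepted. -/
def acceptCode : List IntInstr :=
  [.op .add 46 41 43, .op .add 46 46 45, .const 47 0, .op .lt 46 46 47,
    .op .mul 46 46 40, .op .mul 46 46 42, .op .mul 46 46 44,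
    .op .lt 47 11 33, .op .sub 47 8 47, .op .mul 46 46 47,
    .op .lt 47 11 34, .op .sub 47 8 47, .op .mul 46 46 47,
    .op .sub 47 8 46, .op .mul 48 40 47, .op .mul 49 41 47]

/-- Update the number of the triple of blocks and the number of the attempt. -/
def countCode : List IntInstr :=
  [.op .add 22 22 8, .op .mul 22 22 47, .op .lt 50 22 14, .op .sub 50 8 50, .op .add 21 21 50,
    .op .sub 50 8 50, .op .mul 22 22 50]

/-- Process the result of a call. -/
def processCode : List IntInstr :=
  reorderCode ++ (weightCode ++ (acceptCode ++ (putCode 33 34 48 49 ++ countCode)))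

/-- The result of a call, reordered. -/
def found (p : Params) (σ : IState) : ℤ × ℤ × ℤ :=
  reorder (2 * p.N) (σ.arr 3 (σ.reg 30)) (σ.arr 3 (σ.reg 31)) (σ.arr 3 (σ.reg 32))

/-- The effect of the processing of the result. -/
structure Processed (p : Params) (W : ℤ → ℤ → WithTop ℤ) (σ σ' : IState) : Prop where
  reg : ∀ r < 33, r ≠ 21 → r ≠ 22 → σ'.reg r = σ.reg r
  arr : ∀ a, 2 ≤ a → σ'.arr a = σ.arr a
  tab : σ'.tab = σ.tab
  accept : Accept p.N W (found p σ) →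
    Stores p.S σ'.arr (symUpdate W (found p σ).1 (found p σ).2.1 ⊤) ∧
    σ'.reg 21 = σ.reg 21 ∧ σ'.reg 22 = 0
  reject : ¬ Accept p.N W (found p σ) → Stores p.S σ'.arr W ∧
    ((σ.reg 22 + 1 < p.r ∧ σ'.reg 21 = σ.reg 21 ∧ σ'.reg 22 = σ.reg 22 + 1) ∨
      (σ.reg 22 + 1 = p.r ∧ σ'.reg 21 = σ.reg 21 + 1 ∧ σ'.reg 22 = 0))

theorem finValue_abs_le {N H : ℤ} {W : ℤ → ℤ → WithTop ℤ} (hT : Tripartite N H W) (hH : 0 ≤ H)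
    (x y : ℤ) : |finValue (W x y)| ≤ H := by
  cases h : W x y with
  | top => simpa using hH
  | coe z => exact hT.bound x y z h

theorem finFlag_eq (a : WithTop ℤ) : (finFlag a = 0 ∧ a = ⊤) ∨ finFlag a = 1 ∧ a ≠ ⊤ := by
  cases a with
  | top => simp
  | coe z => simp

/-- The right-hand side is what the machine tests: a product of three flags, and the sign of the sum
of the stored values. -/
theorem add_lt_zero_iff {a b c : WithTop ℤ} : a + b + c < 0 ↔
    a ≠ ⊤ ∧ b ≠ ⊤ ∧ c ≠ ⊤ ∧ finValue a + finValue b + finValue c < 0 := by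
  cases a with
  | top => simp
  | coe a =>
    cases b with
    | top => simp
    | coe b =>
      cases c with
      | top => simp
      | coe c => simp; norm_cast

/-- Nothing is assumed about the answer except that it consists of words. This is why
`IntInstr.Safe` permits loads at any address below `2 * L = 2 ^ w`. By `h3` every number is
translated to a vertex of the stored matrix, possibly the isolated vertex `0`, and the test of the
weight rejects wrong answers. -/
theorem det_process (hw : 1 ≤ w) (hL : 2 * p.L = 2 ^ w) (ok : p.Ok) (hE : Env p σ)
    {W : ℤ → ℤ → WithTop ℤ} (hS : Stores p.S σ.arr W) (hT : Tripartite p.N p.top W)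
    (h3 : ∀ z, 0 ≤ z → 0 ≤ σ.arr 3 z ∧ σ.arr 3 z ≤ 3 * p.N)
    (h30 : 0 ≤ σ.reg 30 ∧ σ.reg 30 < 2 ^ w) (h31 : 0 ≤ σ.reg 31 ∧ σ.reg 31 < 2 ^ w)
    (h32 : 0 ≤ σ.reg 32 ∧ σ.reg 32 < 2 ^ w) (h22 : 0 ≤ σ.reg 22) (h22' : σ.reg 22 < p.r) 
    (hr : (p.r : ℤ) < p.L) :
    Det X B (code B processCode) 110 σ (Processed p W σ) := by
  classical
  have hN := ok.N_pos
  have hSL := ok.S_lt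
  have hSL' := ok.S_le
  have hS3 : 3 * p.N < p.L := by rw [Params.S] at hSL'; omega
  have ga := h3 _ h30.1
  have gb := h3 _ h31.1
  have gc := h3 _ h32.1
  set ga' := σ.arr 3 (σ.reg 30) with hga
  set gb' := σ.arr 3 (σ.reg 31) with hgb
  set gc' := σ.arr 3 (σ.reg 32) with hgc
  set σ1 := execAll reorderCode σ with hσ1
  have e1 : σ1.reg 33 = (found p σ).1 ∧ σ1.reg 34 = (found p σ).2.1 ∧
      σ1.reg 35 = (found p σ).2.2 := by
    simp only [hσ1, reorderCode, execAll, IntInstr.exec, IState.setReg_reg, IState.setReg_arr,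
      IntOp.eval, hE.r11, Nat.reduceEqDiff, if_true, if_false, found, reorder, ← hga, ← hgb, ← hgc]
    split_ifs <;> simp
  have s1 : SafeAll p.L reorderCode σ := by
    simp only [reorderCode, SafeAll, IntInstr.Safe, IntOp.Safe, IntInstr.exec, IState.setReg_reg,
      IState.setReg_arr, IntOp.eval, hE.r11, Nat.reduceEqDiff, if_true, if_false, ← hga, ← hgb,
      ← hgc, true_and, and_true, hL, h30, h31, h32]
    omega
  have hf : (0 ≤ (found p σ).1 ∧ (found p σ).1 < p.S) ∧
      (0 ≤ (found p σ).2.1 ∧ (found p σ).2.1 < p.S) ∧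
      (0 ≤ (found p σ).2.2 ∧ (found p σ).2.2 < p.S) := by
    simp only [found, reorder, ← hga, ← hgb, ← hgc, Params.S]
    split_ifs <;> simp only <;> omega
  obtain ⟨⟨a, b, c⟩, hv⟩ : ∃ v, found p σ = v := ⟨_, rfl⟩
  rw [hv] at e1 hf
  obtain ⟨e33, e34, e35⟩ := e1
  obtain ⟨⟨fa, fa'⟩, ⟨fb, fb'⟩, fc, fc'⟩ := hf
  simp only at e33 e34 e35 fa fa' fb fb' fc fc'
  have r1 : ∀ r < 33, σ1.reg r = σ.reg r := fun r _ =>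
    reg_execAll_of_notMem (by simp [reorderCode, IntInstr.dest]; omega) _
  have a1 : σ1.arr = σ.arr := rfl
  set σ2 := execAll weightCode σ1 with hσ2
  have r2 : ∀ r < 38, σ2.reg r = σ1.reg r := fun r _ =>
    reg_execAll_of_notMem (by simp [weightCode, IntInstr.dest]; omega) _
  have a2 : σ2.arr = σ.arr := rfl
  obtain ⟨wab, wab'⟩ := hS a b fa fa' fb fb'
  obtain ⟨wac, wac'⟩ := hS a c fa fa' fc fc'
  obtain ⟨wbc, wbc'⟩ := hS b c fb fb' fc fc'
  have w5 : σ1.reg 5 = p.S := (r1 _ (by omega)).trans hE.r5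
  have s2 : SafeAll p.L weightCode σ1 := by
    simp only [weightCode, SafeAll, IntInstr.Safe, IntOp.Safe, IntInstr.exec, IState.setReg_reg,
      IntOp.eval, e33, e34, e35, w5, Nat.reduceEqDiff, if_true, if_false, true_and, and_true]
    have := mul_add_lt_mul_self fa' fa fb'
    have := mul_add_lt_mul_self fa' fa fc'
    have := mul_add_lt_mul_self fb' fb fc'
    have : 0 ≤ a * p.S := mul_nonneg fa (by omega)
    have : 0 ≤ b * p.S := mul_nonneg fb (by omega)
    omega
  have e2 : σ2.reg 40 = finFlag (W a b) ∧ σ2.reg 41 = finValue (W a b) ∧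
      σ2.reg 42 = finFlag (W a c) ∧ σ2.reg 43 = finValue (W a c) ∧
      σ2.reg 44 = finFlag (W b c) ∧ σ2.reg 45 = finValue (W b c) := by
    simp only [hσ2, weightCode, execAll, IntInstr.exec, IState.setReg_reg, IState.setReg_arr,
      IntOp.eval, e33, e34, e35, w5, Nat.reduceEqDiff, if_true, if_false, a1, wab, wab', wac, wac',
      wbc, wbc', and_self]
  obtain ⟨e40, e41, e42, e43, e44, e45⟩ := e2
  set σ3 := execAll acceptCode σ2 with hσ3
  have r3 : ∀ r < 46, σ3.reg r = σ2.reg r := fun r _ =>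
    reg_execAll_of_notMem (by simp [acceptCode, IntInstr.dest]; omega) _
  have r3' : ∀ r < 33, σ3.reg r = σ.reg r := fun r hr =>
    (r3 r (by omega)).trans ((r2 r (by omega)).trans (r1 r hr))
  have w8 : σ2.reg 8 = 1 := (r2 _ (by omega)).trans ((r1 _ (by omega)).trans hE.r8)
  have w11 : σ2.reg 11 = 2 * p.N := (r2 _ (by omega)).trans ((r1 _ (by omega)).trans hE.r11)
  have w33 : σ2.reg 33 = a := (r2 _ (by omega)).trans e33
  have w34 : σ2.reg 34 = b := (r2 _ (by omega)).trans e34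
  have htop := ok.top_lt
  have htop1 := Params.Ok.top_pos (p := p)
  have s3 : SafeAll p.L acceptCode σ2 := by
    simp only [acceptCode, SafeAll, IntInstr.Safe, IntOp.Safe, IntInstr.exec, IState.setReg_reg,
      IntOp.eval, e41, e43, e45, w8, w11, w33, w34, Nat.reduceEqDiff, if_true, if_false, true_and,
      and_true]
    have h1 := abs_le.1 (finValue_abs_le hT (by omega) a b)
    have h2 := abs_le.1 (finValue_abs_le hT (by omega) a c)
    have h3 := abs_le.1 (finValue_abs_le hT (by omega) b c)
    rw [Params.S] at fa' fb'
    push_cast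
    omega
  have e47 : σ3.reg 47 = (if Accept p.N W (a, b, c) then 0 else 1) ∧
      σ3.reg 48 = finFlag (W a b) * σ3.reg 47 ∧ σ3.reg 49 = finValue (W a b) * σ3.reg 47 := by
    simp only [hσ3, acceptCode, execAll, IntInstr.exec, IState.setReg_reg, IntOp.eval, e40, e41,
      e42, e43, e44, e45, w8, w11, w33, w34, Nat.reduceEqDiff, if_true, if_false, and_true, Accept,
      add_lt_zero_iff, Nat.cast_zero]
    -- A missing edge makes the product of the flags `0`, and then the comparison of the values is
    -- irrelevant. Otherwise all flags are `1`, and three comparisons remain.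
    rcases finFlag_eq (W a b) with ⟨q1, q1'⟩ | ⟨q1, q1'⟩
    · simp [q1']
    rcases finFlag_eq (W a c) with ⟨q2, q2'⟩ | ⟨q2, q2'⟩
    · simp [q2']
    rcases finFlag_eq (W b c) with ⟨q3, q3'⟩ | ⟨q3, q3'⟩
    · simp [q3']
    simp only [q1, q2, q3, ne_eq, q1', q2', q3', not_false_eq_true, true_and, mul_one]
    by_cases c1 : finValue (W a b) + finValue (W a c) + finValue (W b c) < 0 <;>
    by_cases c2 : 2 * p.N < a <;> by_cases c3 : 2 * p.N < b <;>
    simp [c1, c2, c3, not_le.2, not_lt.1]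
  obtain ⟨e47, e48, e49⟩ := e47
  -- Register `47` contains `0` upon acceptance and `1` otherwise. Multiplying flag and value by it
  -- yields the representation of this entry, as `⊤` has flag and value `0`.
  set e : WithTop ℤ := if Accept p.N W (a, b, c) then ⊤ else W a b with he
  have f48 : σ3.reg 48 = finFlag e := by
    rw [e48, e47, he]; split_ifs <;> simp
  have f49 : σ3.reg 49 = finValue e := by
    rw [e49, e47, he]; split_ifs <;> simp
  have x33 : σ3.reg 33 = a := (r3 _ (by omega)).trans w33
  have x34 : σ3.reg 34 = b := (r3 _ (by omega)).trans w34
  have x5 : σ3.reg 5 = p.S := (r3' _ (by omega)).trans hE.r5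
  set σ4 := execAll (putCode 33 34 48 49) σ3 with hσ4
  have r4 : ∀ r ≠ 60, σ4.reg r = σ3.reg r := fun r hr => reg_execAll_putCode hr
  have hS4 := stores_execAll_putCode (S := p.S) (σ := σ3) (x := 33) (y := 34) (f := 48) (v := 49)
    (show Stores p.S σ3.arr W from hS) x5 (by omega) (by omega) (by omega) (by omega)
    (by rw [x33]; exact fa) (by rw [x33]; exact fa') (by rw [x34]; exact fb)
    (by rw [x34]; exact fb') f48 f49
  rw [x33, x34] at hS4
  have s4 : SafeAll p.L (putCode 33 34 48 49) σ3 :=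
    safeAll_putCode x5 (by omega) (by omega) (by rw [x33]; exact fa) (by rw [x33]; exact fa')
      (by rw [x34]; exact fb) (by rw [x34]; exact fb') hSL
  have y8 : σ4.reg 8 = 1 := (r4 _ (by omega)).trans ((r3' _ (by omega)).trans hE.r8)
  have y14 : σ4.reg 14 = p.r := (r4 _ (by omega)).trans ((r3' _ (by omega)).trans hE.r14)
  have y21 : σ4.reg 21 = σ.reg 21 := (r4 _ (by omega)).trans (r3' _ (by omega))
  have y22 : σ4.reg 22 = σ.reg 22 := (r4 _ (by omega)).trans (r3' _ (by omega))
  have y47 : σ4.reg 47 = (if Accept p.N W (a, b, c) then 0 else 1) := (r4 _ (by omega)).trans e47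
  have s5 : SafeAll p.L countCode σ4 := by
    simp only [countCode, SafeAll, IntInstr.Safe, IntOp.Safe, IntInstr.exec, IState.setReg_reg,
      IntOp.eval, y8, y14, y22, y47, Nat.reduceEqDiff, if_true, if_false, true_and, and_true]
    split_ifs <;> omega
  have hex : execAll processCode σ = execAll countCode σ4 := by
    simp only [processCode, execAll_append, hσ1, hσ2, hσ3, hσ4]
  have e5 : (execAll countCode σ4).reg 21 = σ.reg 21 + (1 - if (σ.reg 22 + 1) *
        (if Accept p.N W (a, b, c) then 0 else 1) < p.r then 1 else 0) ∧
      (execAll countCode σ4).reg 22 = (σ.reg 22 + 1) * (if Accept p.N W (a, b, c) then 0 else 1) *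
        (1 - (1 - if (σ.reg 22 + 1) *
        (if Accept p.N W (a, b, c) then 0 else 1) < p.r then 1 else 0)) := by
    simp only [countCode, execAll, IntInstr.exec, IState.setReg_reg, IntOp.eval, y8, y14, y21, y22,
      y47, Nat.reduceEqDiff, if_true, if_false, and_self]
  have hrpos : (1 : ℤ) ≤ p.r := by exact_mod_cast ok.r_pos
  have a4 : ∀ a', 2 ≤ a' → σ4.arr a' = σ.arr a' := fun a' ha => by
    rw [hσ4, arr_execAll_putCode ha]; rfl
  have t4 : σ4.tab = σ.tab := rfl
  have hsafe : SafeAll p.L processCode σ := by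
    simp only [processCode, safeAll_append]
    exact ⟨s1, s2, s3, s4, s5⟩
  rw [← hσ4] at hS4
  clear_value σ4
  have a5 : (execAll countCode σ4).arr = σ4.arr := rfl
  refine (det_code hw hL (by simp [processCode, reorderCode]) hsafe).mono
    (by simp [processCode, reorderCode, weightCode, acceptCode, putCode, countCode]) ?_
  · rintro _ rfl
    rw [hex]
    refine ⟨fun r h1 h2 h3 => ?_, fun a' ha => ?_, ?_, ?_, ?_⟩
    · rw [reg_execAll_of_notMem (by simp [countCode, IntInstr.dest]; omega), r4 _ (by omega),
        r3' _ (by omega)]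
    · rw [a5, a4 a' ha]
    · rw [tab_execAll, t4]
    · rw [hv]
      intro hacc
      rw [he, if_pos hacc] at hS4
      -- Upon acceptance the attempt counter becomes `0`, which is less than `r ≥ 1`, so the same
      -- triple of blocks is tried again.
      rw [a5, e5.1, e5.2, if_pos hacc, mul_zero, if_pos (by omega)]
      exact ⟨hS4, by ring, by ring⟩
    · rw [hv]
      intro hacc
      rw [he, if_neg hacc, symUpdate_self hT.symm] at hS4
      rw [a5]
      refine ⟨hS4, ?_⟩
      rw [e5.1, e5.2, if_neg hacc, mul_one]
      by_cases hc : σ.reg 22 + 1 < p.r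
      · left; rw [if_pos hc]; omega
      · right; rw [if_neg hc]; omega

end

/-! ## The main loop -/

/-- The instance for the triple `τ` of blocks has a triangle of negative weight. -/
def HasNeg (p : Params) (W : ℤ → ℤ → WithTop ℤ) (τ : ℤ) : Prop :=
  ∃ x y z : ℤ, (0 ≤ x ∧ x < 3 * p.m) ∧ (0 ≤ y ∧ y < 3 * p.m) ∧ (0 ≤ z ∧ z < 3 * p.m) ∧
    W (vtx p τ x) (vtx p τ y) + W (vtx p τ x) (vtx p τ z) + W (vtx p τ y) (vtx p τ z) < 0

/-- No instance before number `τ` has a triangle of negative weight. -/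
def Clean (p : Params) (W : ℤ → ℤ → WithTop ℤ) (τ : ℤ) : Prop :=
  ∀ τ' : ℤ, 0 ≤ τ' → τ' < τ → ¬ HasNeg p W τ'

theorem HasNeg.mono {p : Params} {W W' : ℤ → ℤ → WithTop ℤ} {τ : ℤ} (h : ∀ x y, W x y ≤ W' x y) :
    HasNeg p W' τ → HasNeg p W τ := by
  rintro ⟨x, y, z, hx, hy, hz, hs⟩
  exact ⟨x, y, z, hx, hy, hz,
    lt_of_le_of_lt (add_le_add (add_le_add (h _ _) (h _ _)) (h _ _)) hs⟩

theorem Clean.mono {p : Params} {W W' : ℤ → ℤ → WithTop ℤ} {τ : ℤ} (h : ∀ x y, W x y ≤ W' x y)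
    (hc : Clean p W τ) : Clean p W' τ :=
  fun τ' h0 h1 h2 => hc τ' h0 h1 (h2.mono h)

theorem le_symUpdate_top (W : ℤ → ℤ → WithTop ℤ) (a b x y : ℤ) :
    W x y ≤ symUpdate W a b ⊤ x y := by
  unfold symUpdate
  split_ifs
  · exact le_top
  · exact le_rfl

/-- Three finite weights force the vertices into three different parts. The first two are not in the
third part, so the last one is. -/
theorem Accept.cross {N H : ℤ} {W : ℤ → ℤ → WithTop ℤ} (hT : Tripartite N H W) {a b c : ℤ}
    (h : Accept N W (a, b, c)) :
    ((1 ≤ a ∧ a ≤ N ∧ N < b ∧ b ≤ 2 * N) ∨ (N < a ∧ a ≤ 2 * N ∧ 1 ≤ b ∧ b ≤ N)) ∧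
      2 * N < c ∧ c ≤ 3 * N := by
  obtain ⟨h1, h2, h3⟩ := h
  obtain ⟨e1, e2, e3, -⟩ := add_lt_zero_iff.1 h1
  have c1 := hT.cross _ _ e1
  have c2 := hT.cross _ _ e2
  have c3 := hT.cross _ _ e3
  simp only at h2 h3 c1 c2 c3
  unfold Cross at c1 c2 c3
  omega

/-- A triangle has exactly one vertex in the third part. Moving it to the end makes the first two
vertices span the edge that is to be deleted, and by symmetry the weight stays the same. -/
theorem accept_reorder {N H : ℤ} {W : ℤ → ℤ → WithTop ℤ} (hT : Tripartite N H W) {a b c : ℤ}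
    (h : W a b + W a c + W b c < 0) : Accept N W (reorder (2 * N) a b c) := by
  obtain ⟨e1, e2, e3, -⟩ := add_lt_zero_iff.1 h
  have c1 := hT.cross _ _ e1
  have c2 := hT.cross _ _ e2
  have c3 := hT.cross _ _ e3
  unfold Cross at c1 c2 c3
  unfold reorder
  split_ifs with h1 h2 h2
  · omega
  · refine ⟨?_, by simp only; omega, by simp only; omega⟩
    simp only
    rw [hT.symm c b, hT.symm c a, hT.symm b a]
    convert h using 1
    abel
  · refine ⟨?_, by simp only; omega, by simp only; omega⟩
    simp only
    rw [hT.symm c b]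
    convert h using 1
    abel
  · exact ⟨h, by simp only; omega, by simp only; omega⟩

open Classical in
/-- The number of entries between the first two parts that are infinite. -/
noncomputable def marked (p : Params) (W : ℤ → ℤ → WithTop ℤ) : ℕ :=
  ((Finset.range (p.m ^ 3) ×ˢ Finset.range (p.m ^ 3)).filter
    fun c => W ((c.1 : ℤ) + 1) ((c.2 : ℤ) + p.N + 1) = ⊤).card

theorem marked_le (p : Params) (W : ℤ → ℤ → WithTop ℤ) : marked p W ≤ p.m ^ 6 := by
  refine (Finset.card_filter_le _ _).trans (le_of_eq ?_)
  rw [Finset.card_product, Finset.card_range]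
  ring

/-- An accepted triangle has a finite edge between the first two parts, which becomes infinite; no
entry ever becomes finite again within a main loop. With `marked_le` this limits the number of
deletions. -/
theorem marked_lt_of_accept {p : Params} {H : ℤ} {W : ℤ → ℤ → WithTop ℤ} (hT : Tripartite p.N H W)
    {a b c : ℤ} (h : Accept p.N W (a, b, c)) : marked p W < marked p (symUpdate W a b ⊤) := by
  classical
  obtain ⟨i, j, hi, hj, hW, hij⟩ : ∃ i j : ℕ, (i : ℤ) < p.N ∧ (j : ℤ) < p.N ∧
      W ((i : ℤ) + 1) ((j : ℤ) + p.N + 1) ≠ ⊤ ∧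
      symUpdate W a b ⊤ ((i : ℤ) + 1) ((j : ℤ) + p.N + 1) = ⊤ := by
    have hne := (add_lt_zero_iff.1 h.1).1
    simp only at hne
    obtain ⟨h1 | h1, -⟩ := h.cross hT
    · refine ⟨(a - 1).toNat, (b - p.N - 1).toNat, by omega, by omega, ?_, ?_⟩
      · rw [Int.toNat_of_nonneg (by omega), Int.toNat_of_nonneg (by omega)]
        convert hne using 2 <;> ring
      · rw [symUpdate, if_pos (by omega)]
    · refine ⟨(b - 1).toNat, (a - p.N - 1).toNat, by omega, by omega, ?_, ?_⟩
      · rw [Int.toNat_of_nonneg (by omega), Int.toNat_of_nonneg (by omega), hT.symm]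
        convert hne using 2 <;> ring
      · rw [symUpdate, if_pos (by omega)]
  have hi' : i < p.m ^ 3 := by rw [Params.N] at hi; exact_mod_cast hi
  have hj' : j < p.m ^ 3 := by rw [Params.N] at hj; exact_mod_cast hj
  refine Finset.card_lt_card (Finset.ssubset_iff_of_subset ?_ |>.2 ⟨(i, j), ?_, ?_⟩)
  · intro e he
    rw [Finset.mem_filter] at he ⊢
    exact ⟨he.1, top_le_iff.1 (he.2.ge.trans (le_symUpdate_top W a b _ _))⟩
  · simp [hi', hj', hij]
  · simp [hW]

/-! ### The potential, the loop invariant, and the instance given to a call -/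

open Classical in
/-- A bound for the probability that the main loop fails, with `k` iterations to go. -/
noncomputable def loss (p : Params) (k : ℕ) (σ : IState) : ℝ :=
  if Clean p (storedMat p.S σ.arr) (σ.reg 21) then
    min 1 (k * (1 / 3) ^ p.r + if HasNeg p (storedMat p.S σ.arr) (σ.reg 21) then
      (1 / 3) ^ (p.r - σ.reg 22).toNat else 0)
  else 1

theorem loss_le_one (p : Params) (k : ℕ) (σ : IState) : loss p k σ ≤ 1 := by
  unfold loss
  split_ifs
  · exact min_le_left _ _
  · exact min_le_left _ _
  · exact le_rfl

/-- The invariant of the main loop, with `k` iterations to go. -/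
structure MainInv (p : Params) (σ₀ : IState) (W₀ : ℤ → ℤ → WithTop ℤ) (k : ℕ) (σ : IState) :
    Prop where
  env : Env p σ
  reg : ∀ r, 2 ≤ r → r < 30 → r ≠ 18 → r ≠ 21 → r ≠ 22 → r ≠ 23 → σ.reg r = σ₀.reg r
  r18 : σ.reg 18 = k
  a4 : σ.arr 4 = σ₀.arr 4
  tab : σ.tab = σ₀.tab
  stores : Stores p.S σ.arr (storedMat p.S σ.arr)
  tri : Tripartite p.N p.top (storedMat p.S σ.arr)
  outer : ∀ x y, 2 * p.N < x ∨ 2 * p.N < y → storedMat p.S σ.arr x y = W₀ x y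
  cell : ∀ i j, 0 ≤ i → i < p.N → 0 ≤ j → j < p.N →
    storedMat p.S σ.arr (i + 1) (j + p.N + 1) = W₀ (i + 1) (j + p.N + 1) ∨
    (storedMat p.S σ.arr (i + 1) (j + p.N + 1) = ⊤ ∧ ∃ l, 0 ≤ l ∧ l < p.N ∧
      W₀ (i + 1) (j + p.N + 1) + W₀ (i + 1) (l + 2 * p.N + 1) +
        W₀ (l + 2 * p.N + 1) (j + p.N + 1) < 0)
  tau_nonneg : 0 ≤ σ.reg 21
  tau_le : σ.reg 21 + k ≤ p.calls
  a_nonneg : 0 ≤ σ.reg 22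
  a_lt : σ.reg 22 < p.r
  progress : (p.calls : ℤ) - k ≤ σ.reg 21 * p.r + σ.reg 22 + p.r * marked p (storedMat p.S σ.arr)

/-- The body of the main loop. -/
def mainBody (B : ℕ) (P : QProgram) : QProgram :=
  .seq (setupProgram B) (.seq (callProgram B P) (code B processCode))

/-- The instance for a triple of blocks. -/
noncomputable def blockMatrix (p : Params) (W : ℤ → ℤ → WithTop ℤ) (τ : ℤ) : WMatrix (3 * p.m) :=
  Matrix.of fun x y => W (vtx p τ (x : ℕ)) (vtx p τ (y : ℕ))

theorem blockMatrix_apply (p : Params) (W : ℤ → ℤ → WithTop ℤ) (τ : ℤ) (x y : Fin (3 * p.m)) :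
    blockMatrix p W τ x y = W (vtx p τ (x : ℕ)) (vtx p τ (y : ℕ)) := rfl

theorem blockMatrix_isGraph {p : Params} {W : ℤ → ℤ → WithTop ℤ} {H : ℤ}
    (hT : Tripartite p.N H W) (τ : ℤ) : (blockMatrix p W τ).IsGraph := by
  refine ⟨Matrix.IsSymm.ext fun i j => hT.symm _ _, fun i => ?_⟩
  by_contra h
  have := hT.cross _ _ h
  unfold Cross at this
  omega

theorem blockMatrix_bounded {p : Params} {W : ℤ → ℤ → WithTop ℤ} (hT : Tripartite p.N p.top W)
    (τ : ℤ) {c : ℕ} (hc : p.top ≤ (3 * p.m) ^ c) : (blockMatrix p W τ).Bounded c :=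
  fun _ _ z hz => (hT.bound _ _ z hz).trans (by push_cast; exact hc)

theorem hasNeg_iff_blockMatrix {p : Params} {W : ℤ → ℤ → WithTop ℤ} {τ : ℤ} :
    HasNeg p W τ ↔ ∃ x y z : Fin (3 * p.m), blockMatrix p W τ x y + blockMatrix p W τ x z +
      blockMatrix p W τ y z < 0 := by
  constructor
  · rintro ⟨x, y, z, ⟨hx, hx'⟩, ⟨hy, hy'⟩, ⟨hz, hz'⟩, hs⟩
    refine ⟨⟨x.toNat, by omega⟩, ⟨y.toNat, by omega⟩, ⟨z.toNat, by omega⟩, ?_⟩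
    simp only [blockMatrix_apply, Int.toNat_of_nonneg hx, Int.toNat_of_nonneg hy,
      Int.toNat_of_nonneg hz]
    exact hs
  · rintro ⟨x, y, z, hs⟩
    exact ⟨(x : ℕ), (y : ℕ), (z : ℕ), by omega, by omega, by omega, hs⟩

/-- A minimum triangle weighs at most as much as the given negative one. The case without triangles,
in which a correct answer says nothing about `u, v, z`, cannot occur. -/
theorem WMatrix.CorrectCall.neg {p : Params} {W : ℤ → ℤ → WithTop ℤ} {τ u v z : ℤ}
    (h : (blockMatrix p W τ).CorrectCall u v z) (hn : HasNeg p W τ) :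
    ((0 ≤ u ∧ u < 3 * p.m) ∧ (0 ≤ v ∧ v < 3 * p.m) ∧ 0 ≤ z ∧ z < 3 * p.m) ∧
    W (vtx p τ u) (vtx p τ v) + W (vtx p τ u) (vtx p τ z) + W (vtx p τ v) (vtx p τ z) < 0 := by
  obtain ⟨i', j', k', hs⟩ := hasNeg_iff_blockMatrix.1 hn
  obtain ⟨f1, f2, f3, -⟩ := add_lt_zero_iff.1 hs
  rcases h with ⟨i, j, k, hm, rfl, rfl, rfl⟩ | h
  · refine ⟨⟨by omega, by omega, by omega⟩, ?_⟩
    have := hm.2 i' j' k' ⟨f1, f3, f2⟩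
    simp only [blockMatrix_apply] at this hs
    refine lt_of_eq_of_lt ?_ (lt_of_le_of_lt this (lt_of_eq_of_lt ?_ hs)) <;> abel
  · exact absurd ⟨i', j', k', f1, f3, f2⟩ h

section

variable {w : ℕ} {X : WordInput w} {B : ℕ} {p : Params} {σ : IState}

theorem Params.Ok.m_lt (ok : p.Ok) : 3 * (p.m : ℤ) < p.L := by
  have := ok.m_le
  have := ok.S_le
  rw [Params.S] at this
  omega

theorem Params.Ok.r_lt (ok : p.Ok) : (p.r : ℤ) < p.L := by
  have h := ok.calls_lt
  have : p.r ≤ p.calls := by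
    rw [Params.calls]
    exact Nat.le_mul_of_pos_left _ (by have := Nat.pos_of_ne_zero (Nat.one_le_iff_ne_zero.1 ok.m_pos); positivity)
  omega

/-- The row offset `vtx * S` and the column offset `vtx` add up to the address of an entry. An index
of at least `3 m` has offset `0`, and thus refers to row or column `0`. -/
theorem storedInput_eq (hL : 2 * p.L = 2 ^ w) (ok : p.Ok) {W : ℤ → ℤ → WithTop ℤ} {H τ : ℤ}
    (hE : Env p σ) (hS : Stores p.S σ.arr W) (hT : Tripartite p.N H W)
    (h2 : ∀ z : ℤ, 0 ≤ z → z < 3 * (p.m : ℤ) → σ.arr 2 z = vtx p τ z * p.S)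
    (h3 : ∀ z : ℤ, 0 ≤ z → z < 3 * (p.m : ℤ) → σ.arr 3 z = vtx p τ z)
    {s : RamState w} (hs : Represents X B σ s) :
    s.storedInput B = (blockMatrix p W τ).toInput w := by
  have hN := ok.N_pos
  have hSL := ok.S_lt
  funext k i j
  have bi : (0 : ℤ) ≤ i.toNat ∧ (i.toNat : ℤ) < 2 ^ w := ⟨by positivity, by exact_mod_cast i.isLt⟩
  have bj : (0 : ℤ) ≤ j.toNat ∧ (j.toNat : ℤ) < 2 ^ w := ⟨by positivity, by exact_mod_cast j.isLt⟩
  set x : ℤ := if (i.toNat : ℤ) < 3 * p.m then vtx p τ i.toNat else 0 with hx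
  set y : ℤ := if (j.toNat : ℤ) < 3 * p.m then vtx p τ j.toNat else 0 with hy
  have ai : σ.arr 2 i.toNat = x * p.S := by
    rw [hx]; split_ifs with hc
    · exact h2 _ bi.1 hc
    · rw [hE.a2 _ (by omega), zero_mul]
  have aj : σ.arr 3 j.toNat = y := by
    rw [hy]; split_ifs with hc
    · exact h3 _ bj.1 hc
    · rw [hE.a3 _ (by omega)]
  have hxS : 0 ≤ x ∧ x < p.S := by
    rw [hx, Params.S]; split_ifs with hc
    · have := ok.vtx_bounds τ bi.1 hc; omega
    · omega
  have hyS : 0 ≤ y ∧ y < p.S := by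
    rw [hy, Params.S]; split_ifs with hc
    · have := ok.vtx_bounds τ bj.1 hc; omega
    · omega
  have hent : (blockMatrix p W τ).entry i j = W x y := by
    -- Vertices are numbered from `1`, so that `0` is isolated and supplies the value `∞` that an
    -- oracle must return outside the matrix.
    have top : ∀ x y, x = 0 ∨ y = 0 → W x y = ⊤ := fun x y h => by
      by_contra hne
      have := hT.cross _ _ hne
      unfold Cross at this
      omega
    unfold WMatrix.entry
    split_ifs with hc
    · rw [hx, hy, if_pos (by omega), if_pos (by omega), blockMatrix_apply]
    · refine (top x y ?_).symm
      by_cases h1 : i.toNat < 3 * p.m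
      · right; rw [hy, if_neg (by omega)]
      · left; rw [hx, if_neg (by omega)]
  have hadr : s.arr (B + 2) i + s.arr (B + 3) j = BitVec.ofInt w (x * p.S + y) := by
    rw [← BitVec.ofInt_toNat i, ← BitVec.ofInt_toNat j, hs.arr 2 _ bi.1 bi.2, hs.arr 3 _ bj.1 bj.2,
      ai, aj, BitVec.ofInt_add]
  have hadr1 := mul_add_lt_mul_self hxS.2 hxS.1 hyS.2
  have hadr0 : 0 ≤ x * p.S + y := by nlinarith
  obtain ⟨f0, f1⟩ := hS x y hxS.1 hxS.2 hyS.1 hyS.2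
  simp only [RamState.storedInput, hadr]
  match k with
  | 0 => rw [if_pos (by omega), hs.arr 0 _ hadr0 (by omega), f0, WMatrix.toInput, hent, finiteWord_eq]
  | 1 => rw [if_pos (by omega), hs.arr 1 _ hadr0 (by omega), f1, WMatrix.toInput, hent, valueWord_eq]
  | k + 2 => rw [if_neg (by omega)]; rfl

end

/-! ### One iteration of the main loop: progress and expected loss -/

section

variable {w : ℕ} {X : WordInput w} {B : ℕ} {p : Params} {σ₀ σ σ₁ σ₂ σ' : IState}
  {W₀ : ℤ → ℤ → WithTop ℤ} {k : ℕ}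

/-- The relation between the states before and after the preparation and the call. -/
structure Called (p : Params) (σ σ₂ : IState) : Prop where
  env : Env p σ₂
  reg : ∀ r, 2 ≤ r → r < 30 → r ≠ 18 → r ≠ 23 → σ₂.reg r = σ.reg r
  r18 : σ₂.reg 18 = σ.reg 18 - 1
  a0 : σ₂.arr 0 = σ.arr 0
  a1 : σ₂.arr 1 = σ.arr 1
  a4 : σ₂.arr 4 = σ.arr 4
  tab : σ₂.tab = σ.tab

theorem SetUp.called (h : SetUp p σ σ₁) (hE : Env p σ) (u₀ v₀ u v z : ℤ) :
    Called p σ (σ₁.afterCall u₀ v₀ u v z) := by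
  have hr : ∀ r, 2 ≤ r → r < 30 → (σ₁.afterCall u₀ v₀ u v z).reg r = σ₁.reg r := by
    intro r h1 h2
    simp only [IState.afterCall, IState.setReg_reg]
    repeat rw [if_neg (by omega)]
  refine ⟨(h.env hE).congr (fun r h1 h2 _ _ => hr r h1 (by omega)) (fun _ _ => rfl) fun _ _ => rfl,
    fun r h1 h2 h3 h4 => (hr r h1 h2).trans (h.reg r (by omega) h3 h4),
    (hr _ (by omega) (by omega)).trans h.r18, ?_, ?_, ?_, h.tab⟩
  · exact h.arr 0 (by omega) (by omega) (by omega)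
  · exact h.arr 1 (by omega) (by omega) (by omega)
  · exact h.arr 4 (by omega) (by omega) (by omega)

theorem MainInv.of_processed (hσ : MainInv p σ₀ W₀ (k + 1) σ) (hC : Called p σ σ₂)
    (hr : ∀ r < 33, r ≠ 21 → r ≠ 22 → σ'.reg r = σ₂.reg r)
    (ha : ∀ a, 2 ≤ a → σ'.arr a = σ₂.arr a) (ht : σ'.tab = σ₂.tab)
    {W' : ℤ → ℤ → WithTop ℤ} (hS : Stores p.S σ'.arr W') (hT : Tripartite p.N p.top W')
    (outer : ∀ x y, 2 * p.N < x ∨ 2 * p.N < y → W' x y = W₀ x y)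
    (cell : ∀ i j, 0 ≤ i → i < p.N → 0 ≤ j → j < p.N →
      W' (i + 1) (j + p.N + 1) = W₀ (i + 1) (j + p.N + 1) ∨
      (W' (i + 1) (j + p.N + 1) = ⊤ ∧ ∃ l, 0 ≤ l ∧ l < p.N ∧
        W₀ (i + 1) (j + p.N + 1) + W₀ (i + 1) (l + 2 * p.N + 1) +
          W₀ (l + 2 * p.N + 1) (j + p.N + 1) < 0))
    (h21 : σ.reg 21 ≤ σ'.reg 21) (h21' : σ'.reg 21 ≤ σ.reg 21 + 1) (h22 : 0 ≤ σ'.reg 22)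
    (h22' : σ'.reg 22 < p.r)
    (hprog : (p.calls : ℤ) - k ≤ σ'.reg 21 * p.r + σ'.reg 22 + p.r * marked p W') :
    MainInv p σ₀ W₀ k σ' ∧ storedMat p.S σ'.arr = W' := by
  have hW : storedMat p.S σ'.arr = W' := hS.mat_eq hT.mem_range
  refine ⟨?_, hW⟩
  have h18 := hσ.r18
  push_cast at h18
  have := hσ.tau_nonneg
  have := hσ.tau_le
  constructor
  case env =>
    exact hC.env.congr (fun r _ h2 _ h4 => hr r (by omega) (by omega) (by omega))
      (fun z _ => by rw [ha 2 le_rfl]) fun z _ => by rw [ha 3 (by omega)]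
  case reg =>
    intro r h1 h2 h3 h4 h5 h6
    rw [hr r (by omega) h4 h5, hC.reg r h1 h2 h3 h6, hσ.reg r h1 h2 h3 h4 h5 h6]
  case r18 => rw [hr 18 (by omega) (by omega) (by omega), hC.r18, h18]; ring
  case a4 => rw [ha 4 (by omega), hC.a4, hσ.a4]
  case tab => rw [ht, hC.tab, hσ.tab]
  case tau_nonneg => omega
  case tau_le => push_cast at this; omega
  case a_nonneg => exact h22
  case a_lt => exact h22'
  all_goals rw [hW]; assumption

/-- This holds for every answer, correct or not. Since accepted triangles have been verified,
deletions are justified on all branches; chance affects only whether a triple is left too early. -/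
theorem MainInv.processed (hσ : MainInv p σ₀ W₀ (k + 1) σ) (hC : Called p σ σ₂)
    (hP : Processed p (storedMat p.S σ.arr) σ₂ σ') :
    MainInv p σ₀ W₀ k σ' ∧
    ((Accept p.N (storedMat p.S σ.arr) (found p σ₂) ∧ σ'.reg 21 = σ.reg 21 ∧ σ'.reg 22 = 0 ∧
        ∀ x y, storedMat p.S σ.arr x y ≤ storedMat p.S σ'.arr x y) ∨
      (¬ Accept p.N (storedMat p.S σ.arr) (found p σ₂) ∧
        storedMat p.S σ'.arr = storedMat p.S σ.arr ∧
        ((σ.reg 22 + 1 < p.r ∧ σ'.reg 21 = σ.reg 21 ∧ σ'.reg 22 = σ.reg 22 + 1) ∨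
          (σ.reg 22 + 1 = p.r ∧ σ'.reg 21 = σ.reg 21 + 1 ∧ σ'.reg 22 = 0)))) := by
  obtain ⟨hr, harr, htab, hacc, hrej⟩ := hP
  have e21 : σ₂.reg 21 = σ.reg 21 := hC.reg _ (by omega) (by omega) (by omega) (by omega)
  have e22 : σ₂.reg 22 = σ.reg 22 := hC.reg _ (by omega) (by omega) (by omega) (by omega)
  have hT := hσ.tri
  have hprog := hσ.progress
  have outer := hσ.outer
  have cell := hσ.cell
  have h0 := hσ.a_nonneg
  have hlt := hσ.a_lt
  push_cast at hprog
  rw [e21] at hacc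
  rw [e21, e22] at hrej
  set W := storedMat p.S σ.arr with hW
  by_cases hA : Accept p.N W (found p σ₂)
  · obtain ⟨hS, h21, h22⟩ := hacc hA
    obtain ⟨⟨a, b, c⟩, hv⟩ : ∃ v, found p σ₂ = v := ⟨_, rfl⟩
    rw [hv] at hA hS
    have hm := marked_lt_of_accept hT hA
    obtain ⟨hab, hc1, hc2⟩ := hA.cross hT
    have hsum := hA.1
    simp only at hS hsum
    obtain ⟨hinv, hmat⟩ := hσ.of_processed hC hr harr htab hS
      (hT.update (fun h => absurd rfl h) (fun z hz => absurd hz.symm (WithTop.coe_ne_top)))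
      (fun x y hxy => by rw [symUpdate, if_neg (by omega), outer x y hxy])
      (fun i j hi hiN hj hjN => by
        unfold symUpdate
        split_ifs with hij
        · right
          -- The middle index is read off from the third vertex `c`. Its two edges still have their
          -- original weights, and the deleted edge had its original weight too, being finite until
          -- now.
          refine ⟨rfl, c - 2 * p.N - 1, by omega, by omega, ?_⟩
          rw [show c - 2 * p.N - 1 + 2 * p.N + 1 = c by ring, ← outer _ _ (Or.inr hc1),
            ← outer _ _ (Or.inl hc1)]
          obtain ⟨f1, f2, f3, -⟩ := add_lt_zero_iff.1 hsum
          rcases hij with ⟨e1, e2⟩ | ⟨e1, e2⟩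
          · rcases cell i j hi hiN hj hjN with hc | ⟨hc, -⟩
            · rw [← hc, e1, e2, hT.symm c b]; exact hsum
            · rw [e1, e2] at hc; exact absurd hc f1
          · rcases cell i j hi hiN hj hjN with hc | ⟨hc, -⟩
            · rw [← hc, e1, e2, hT.symm c a, hT.symm b a]
              convert hsum using 1
              abel
            · rw [e1, e2, hT.symm] at hc; exact absurd hc f1
        · exact cell i j hi hiN hj hjN)
      h21.ge (by omega) h22.ge (by omega)
      (by
        -- The attempt counter falls from at most `r - 1` to `0`, while `marked` grows by at least
        -- one and is weighted by `r`: the measure of progress increases by at least `1`.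
        rw [h21, h22]
        have : (marked p W : ℤ) + 1 ≤ marked p (symUpdate W a b ⊤) := by exact_mod_cast hm
        have hr0 : (0 : ℤ) ≤ p.r := by positivity
        have := mul_le_mul_of_nonneg_left this hr0
        linarith)
    refine ⟨hinv, Or.inl ⟨hv ▸ hA, h21, h22, fun x y => ?_⟩⟩
    rw [hmat]
    exact le_symUpdate_top W a b x y
  · obtain ⟨hS, h⟩ := hrej hA
    obtain ⟨hinv, hmat⟩ := hσ.of_processed hC hr harr htab hS hT outer cell
      (by omega) (by omega) (by omega) (by omega)
      (by
        rcases h with ⟨g1, g2, g3⟩ | ⟨g1, g2, g3⟩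
        · rw [g2, g3]; linarith
        · rw [g2, g3]; linarith)
    exact ⟨hinv, Or.inr ⟨hA, hmat, h⟩⟩

open Classical in
/-- The bound for the failure probability after an iteration in which no negative triangle was
found. -/
noncomputable def lossReject (p : Params) (k : ℕ) (σ : IState) : ℝ :=
  if Clean p (storedMat p.S σ.arr) (σ.reg 21) then
    if HasNeg p (storedMat p.S σ.arr) (σ.reg 21) then
      min 1 (k * (1 / 3) ^ p.r + (1 / 3) ^ (p.r - σ.reg 22 - 1).toNat)
    else min 1 ((k + 1) * (1 / 3) ^ p.r)
  else 1

open Classical in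
/-- The bound for the failure probability after an iteration in which a negative triangle was
found. -/
noncomputable def lossAccept (p : Params) (k : ℕ) (σ : IState) : ℝ :=
  if Clean p (storedMat p.S σ.arr) (σ.reg 21) then min 1 ((k + 1) * (1 / 3) ^ p.r) else 1

theorem one_third_pow_le {a b : ℕ} (h : a ≤ b) : (1 / 3 : ℝ) ^ b ≤ (1 / 3) ^ a :=
  pow_le_pow_of_le_one (by norm_num) (by norm_num) h

theorem lossAccept_le_lossReject (h0 : 0 ≤ σ.reg 22) :
    lossAccept p k σ ≤ lossReject p k σ := by
  unfold lossAccept lossReject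
  split_ifs
  · refine min_le_min_left _ ?_
    have := one_third_pow_le (show (p.r - σ.reg 22 - 1).toNat ≤ p.r by omega)
    linarith
  · exact le_rfl
  · exact le_rfl

/-- If the current triple still has a negative triangle, a failed attempt raises its term from
`(1/3) ^ (r - a)` to three times as much, where `a` counts the attempts; it happens with probability
at most `1/3`, so the mean does not grow. A success restarts the triple with a new term `(1/3) ^ r`,
paid for by the decrease of `k`. -/
theorem lossAccept_add_le (h1 : σ.reg 22 < p.r) :
    lossAccept p k σ + (lossReject p k σ - lossAccept p k σ) / 3 ≤ loss p (k + 1) σ := by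
  have hρ : (0 : ℝ) ≤ (1 / 3) ^ p.r := by positivity
  unfold lossAccept lossReject loss
  push_cast
  split_ifs
  · refine le_min ?_ ?_
    · have h2 := min_le_left (1 : ℝ) ((k + 1) * (1 / 3) ^ p.r)
      have h3 := min_le_left (1 : ℝ) (k * (1 / 3) ^ p.r + (1 / 3) ^ (p.r - σ.reg 22 - 1).toNat)
      linarith
    · have h2 := min_le_right (1 : ℝ) ((k + 1) * (1 / 3) ^ p.r)
      have h3 := min_le_right (1 : ℝ) (k * (1 / 3) ^ p.r + (1 / 3) ^ (p.r - σ.reg 22 - 1).toNat)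
      have h4 : (1 / 3 : ℝ) ^ (p.r - σ.reg 22).toNat =
          (1 / 3) ^ (p.r - σ.reg 22 - 1).toNat * (1 / 3) := by
        rw [← pow_succ]; congr 1; omega
      rw [h4]
      linarith
  · simp
  · norm_num

/-- After acceptance the deletion keeps the earlier triples clean and the attempt counter is `0`.
After a rejection the matrix is unchanged, and either an attempt is used up or the next triple
begins. -/
theorem MainInv.loss_le (hσ : MainInv p σ₀ W₀ (k + 1) σ) (hC : Called p σ σ₂)
    (hP : Processed p (storedMat p.S σ.arr) σ₂ σ') :
    (Accept p.N (storedMat p.S σ.arr) (found p σ₂) ∧ loss p k σ' ≤ lossAccept p k σ) ∨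
    (¬ Accept p.N (storedMat p.S σ.arr) (found p σ₂) ∧ loss p k σ' ≤ lossReject p k σ) := by
  classical
  have hρ : (0 : ℝ) ≤ (1 / 3) ^ p.r := by positivity
  have h0 := hσ.a_nonneg
  obtain ⟨-, ⟨hA, h21, h22, hle⟩ | ⟨hA, hmat, h⟩⟩ := hσ.processed hC hP
  · refine Or.inl ⟨hA, ?_⟩
    unfold lossAccept
    split_ifs with hc
    · rw [loss, h21, if_pos (hc.mono hle), h22]
      refine min_le_min_left _ ?_
      have : (if HasNeg p (storedMat p.S σ'.arr) (σ.reg 21) then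
          (1 / 3 : ℝ) ^ ((p.r : ℤ) - 0).toNat else 0) ≤ (1 / 3) ^ p.r := by
        split_ifs
        · simp
        · exact hρ
      linarith
    · exact loss_le_one _ _ _
  · refine Or.inr ⟨hA, ?_⟩
    unfold lossReject
    split_ifs with hc hn
    · rcases h with ⟨g1, g2, g3⟩ | ⟨g1, g2, g3⟩
      · rw [loss, hmat, g2, if_pos hc, if_pos hn, g3, sub_sub]
      -- The last attempt has failed although a negative triangle is present. The loop has gone
      -- wrong for good, and the bound already equals `1` because the exponent is `0`.
      · refine (loss_le_one _ _ _).trans (le_min le_rfl ?_)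
        rw [show (p.r - σ.reg 22 - 1).toNat = 0 by omega, pow_zero]
        have : (0 : ℝ) ≤ k * (1 / 3) ^ p.r := by positivity
        linarith
    · rcases h with ⟨g1, g2, g3⟩ | ⟨g1, g2, g3⟩
      · rw [loss, hmat, g2, if_pos hc, if_neg hn]
        refine min_le_min_left _ ?_
        linarith
      · rw [loss, hmat, g2, g3, if_pos]
        · refine min_le_min_left _ ?_
          have : (if HasNeg p (storedMat p.S σ.arr) (σ.reg 21 + 1) then
              (1 / 3 : ℝ) ^ ((p.r : ℤ) - 0).toNat else 0) ≤ (1 / 3) ^ p.r := by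
            split_ifs
            · simp
            · exact hρ
          linarith
        -- The triple that is left has no negative triangle, so the clean range extends by one.
        · intro τ' h1 h2
          rcases lt_or_eq_of_le (show τ' ≤ σ.reg 21 by omega) with h3 | h3
          · exact hc τ' h1 h3
          · exact h3 ▸ hn
    · exact loss_le_one _ _ _

/-- `tri_call` is applied to the function that equals `lossAccept` or `lossReject` according to
whether the answer will pass verification. If a negative triangle exists, a correct answer passes;
otherwise both values coincide and correctness is irrelevant. -/
theorem tri_mainBody (hw : 1 ≤ w) (hL : 2 * p.L = 2 ^ w) (ok : p.Ok) {P : QProgram} {c TP : ℕ}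
    (hB : 1 ≤ B) (hPB : P.bound ≤ B)
    (hP : ∀ A : (minTriangle c).Inst (3 * p.m), ∃ t ≤ TP,
      P.HaltsWithin (3 * p.m) ((minTriangle c).input w A) t ∧
      2 / 3 ≤ P.successProb (3 * p.m) ((minTriangle c).input w A) t ((minTriangle c).correct A))
    (htop : p.top ≤ (3 * p.m) ^ c) (hσ : MainInv p σ₀ W₀ (k + 1) σ) :
    Tri X B (mainBody B P) (75 * p.m + 13 * TP + 5 * B + 150) σ (loss p (k + 1) σ)
      (MainInv p σ₀ W₀ k) (loss p k) := by
  classical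
  have hE := hσ.env
  have hT := hσ.tri
  have hm := ok.m_lt
  have hcl := ok.calls_lt
  have hN := ok.N_pos
  set W := storedMat p.S σ.arr with hW
  set τ := σ.reg 21 with hτ
  set A : (minTriangle c).Inst (3 * p.m) :=
    ⟨blockMatrix p W τ, blockMatrix_isGraph hT τ, blockMatrix_bounded hT τ htop⟩ with hA
  refine Tri.mono (Tri.seq (T' := 13 * TP + 5 * B + 123) (Q' := MainInv p σ₀ W₀ k) (f' := loss p k)
    (f := fun _ => loss p (k + 1) σ) ((det_setup hw hL ok hE hσ.tau_nonneg
    (by have := hσ.tau_le; omega)).tri fun _ _ => le_rfl) fun σ₁ h₁ => ?_)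
    (by omega) le_rfl (fun _ h => h) fun _ _ => le_rfl
  have hE₁ := h₁.env hE
  have hS₁ : Stores p.S σ₁.arr W := hσ.stores.congr (h₁.arr 0 (by omega) (by omega) (by omega))
    (h₁.arr 1 (by omega) (by omega) (by omega))
  refine (Tri.seq (T' := 110) (Q' := MainInv p σ₀ W₀ k) (f' := loss p k)
    (f := fun σ₂ => if Accept p.N W (found p σ₂) then lossAccept p k σ else lossReject p k σ)
    (tri_call (x := lossReject p k σ) (y := lossAccept p k σ) hw hB hPB (n := 3 * p.m)
      (by have : ((3 * p.m : ℕ) : ℤ) < 2 ^ w := by push_cast; omega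
          exact_mod_cast this) (hP A)
      (by rw [hE₁.r7]; push_cast; ring) hE₁.r8 hE₁.r9 hE₁.r10
      (fun s hs => storedInput_eq hL ok hE₁ hS₁ hT h₁.a2 h₁.a3 hs)
      (lossAccept_le_lossReject hσ.a_nonneg) ?_ ?_) ?_).mono (by omega)
      (lossAccept_add_le hσ.a_lt) (fun _ h => h) fun _ _ => le_rfl
  · intro u₀ v₀ u v z _ _ _ _ _ _
    split_ifs
    · exact lossAccept_le_lossReject hσ.a_nonneg
    · exact le_rfl
  · intro u₀ v₀ u v z _ _ _ _ _ _ hc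
    by_cases hn : HasNeg p W τ
    · obtain ⟨⟨hu, hv, hz⟩, hs⟩ := WMatrix.CorrectCall.neg hc hn
      rw [if_pos]
      have : found p (σ₁.afterCall u₀ v₀ u v z) =
          reorder (2 * p.N) (vtx p τ u) (vtx p τ v) (vtx p τ z) := by
        rw [hτ, ← h₁.a3 u hu.1 hu.2, ← h₁.a3 v hv.1 hv.2, ← h₁.a3 z hz.1 hz.2]
        rfl
      rw [this]
      exact accept_reorder hT hs
    · have : lossReject p k σ = lossAccept p k σ := by
        unfold lossReject lossAccept
        rw [← hW, ← hτ, if_neg hn]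
      rw [this, ite_self]
  · rintro σ₂ ⟨u₀, v₀, u, v, z, hu, hv, hz, rfl⟩
    have hC := h₁.called hE u₀ v₀ u v z
    have hE₂ := hC.env
    have e22 : (σ₁.afterCall u₀ v₀ u v z).reg 22 = σ.reg 22 :=
      hC.reg _ (by omega) (by omega) (by omega) (by omega)
    refine (det_process hw hL ok hE₂ (hσ.stores.congr hC.a0 hC.a1) hT (fun z' hz' => ?_) hu hv hz
      (by rw [e22]; exact hσ.a_nonneg) (by rw [e22]; exact hσ.a_lt) ok.r_lt).tri
      (fun σ' hσ' => ?_) |>.mono le_rfl le_rfl (fun σ' hσ' => (hσ.processed hC hσ').1)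
      fun _ _ => le_rfl
    -- An answer outside the instance is translated by the zero tail of the table to the isolated
    -- vertex `0`.
    · change 0 ≤ σ₁.arr 3 z' ∧ σ₁.arr 3 z' ≤ 3 * p.N
      by_cases h3 : z' < 3 * p.m
      · rw [h₁.a3 z' hz' h3]
        have := ok.vtx_bounds (σ.reg 21) hz' h3
        omega
      · rw [hE₁.a3 z' (by omega)]; omega
    · rcases hσ.loss_le hC hσ' with ⟨h1, h2⟩ | ⟨h1, h2⟩
      · rw [if_pos h1]; exact h2
      · rw [if_neg h1]; exact h2

end

/-! ### The whole main loop: every pair in a negative triangle is found -/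

section

variable {w : ℕ} {X : WordInput w} {B : ℕ} {p : Params} {σ σ' : IState}
  {W : ℤ → ℤ → WithTop ℤ}

theorem Params.Ok.NN_eq : p.N * p.N = p.t * (p.t * p.t) := by
  simp only [Params.N, Params.t]; ring

/-- If `a, b, c` are the blocks of `i, j, l`, the triple is the number with digits `a, b, c` in base
`t = m ^ 2`. The vertices are the residues modulo `m`, shifted by `0`, `m` and `2 m` according to
the part. -/
theorem Params.Ok.exists_block (ok : p.Ok) {i j l : ℤ} (hi : 0 ≤ i) (hiN : i < p.N) (hj : 0 ≤ j)
    (hjN : j < p.N) (hl : 0 ≤ l) (hlN : l < p.N) :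
    ∃ τ x y z : ℤ, (0 ≤ τ ∧ τ < p.N * p.N) ∧ (0 ≤ x ∧ x < 3 * p.m) ∧ (0 ≤ y ∧ y < 3 * p.m) ∧
      (0 ≤ z ∧ z < 3 * p.m) ∧ vtx p τ x = i + 1 ∧ vtx p τ y = j + p.N + 1 ∧
      vtx p τ z = l + 2 * p.N + 1 := by
  have hm : (1 : ℤ) ≤ p.m := by exact_mod_cast ok.m_pos
  have ht := ok.t_pos
  have key : ∀ i, 0 ≤ i → i < p.N → (0 ≤ i / p.m ∧ i / p.m < p.t) ∧ (0 ≤ i % p.m ∧ i % p.m < p.m) ∧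
      i / p.m * p.m + i % p.m = i := fun i h0 h1 =>
    ⟨⟨Int.ediv_nonneg h0 (by omega), Int.ediv_lt_of_lt_mul (by omega) (Params.Ok.N_eq ▸ h1)⟩,
      ⟨Int.emod_nonneg _ (by omega), Int.emod_lt_of_pos _ (by omega)⟩, Int.ediv_mul_add_emod _ _⟩
  obtain ⟨⟨i1, i2⟩, ⟨i3, i4⟩, i5⟩ := key i hi hiN
  obtain ⟨⟨j1, j2⟩, ⟨j3, j4⟩, j5⟩ := key j hj hjN
  obtain ⟨⟨l1, l2⟩, ⟨l3, l4⟩, l5⟩ := key l hl hlN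
  set t := p.t
  generalize i / (p.m : ℤ) = a at *
  generalize j / (p.m : ℤ) = b at *
  generalize l / (p.m : ℤ) = c at *
  have hbc : 0 ≤ b + t * c ∧ b + t * c < t * t := by constructor <;> nlinarith
  have q1 : (a + t * (b + t * c)) % t = a := by
    rw [Int.add_mul_emod_self_left, Int.emod_eq_of_lt i1 i2]
  have q2 : (a + t * (b + t * c)) / t = b + t * c := by
    rw [Int.add_mul_ediv_left _ _ (by omega), Int.ediv_eq_zero_of_lt i1 i2, zero_add]
  have q3 : (b + t * c) % t = b := by
    rw [Int.add_mul_emod_self_left, Int.emod_eq_of_lt j1 j2]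
  have q4 : (b + t * c) / t = c := by
    rw [Int.add_mul_ediv_left _ _ (by omega), Int.ediv_eq_zero_of_lt j1 j2, zero_add]
  have q5 : c % t = c := Int.emod_eq_of_lt l1 l2
  have e1 : ∀ z : ℤ, 0 ≤ z → z < p.m → z / p.m = 0 ∧ z % p.m = z := fun z h0 h1 =>
    ⟨Int.ediv_eq_zero_of_lt h0 h1, Int.emod_eq_of_lt h0 h1⟩
  have e2 : ∀ z d : ℤ, 0 ≤ z → z < p.m → (z + p.m * d) / p.m = d ∧ (z + p.m * d) % p.m = z :=
    fun z d h0 h1 => ⟨by rw [Int.add_mul_ediv_left _ _ (by omega), (e1 z h0 h1).1, zero_add],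
      by rw [Int.add_mul_emod_self_left, (e1 z h0 h1).2]⟩
  refine ⟨a + t * (b + t * c), i % p.m, j % p.m + p.m * 1, l % p.m + p.m * 2, ?_, by omega,
    by omega, by omega, ?_, ?_, ?_⟩
  · rw [Params.Ok.NN_eq]
    constructor
    · nlinarith
    · change _ < t * (t * t)
      nlinarith
  · rw [vtx, (e1 _ i3 i4).1, (e1 _ i3 i4).2, blk, if_pos rfl, q1]
    omega
  · rw [vtx, (e2 _ 1 j3 j4).1, (e2 _ 1 j3 j4).2, blk, if_neg one_ne_zero, if_pos rfl, q2, q3]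
    omega
  · rw [vtx, (e2 _ 2 l3 l4).1, (e2 _ 2 l3 l4).2, blk, if_neg two_ne_zero, if_neg (by norm_num), q2,
      q4, q5]
    omega

/-- Repeat the body of the main loop. -/
def mainLoop (B : ℕ) (P : QProgram) : QProgram :=
  .seq (code B [.const 21 0, .const 22 0, .const 18 0, .op .add 18 18 15])
    (.loop (B + 18) (mainBody B P))

/-- The pairs of the first two parts that are in a triangle of negative weight have been deleted. -/
def Detected (p : Params) (W W' : ℤ → ℤ → WithTop ℤ) : Prop :=
  ∀ i j, 0 ≤ i → i < p.N → 0 ≤ j → j < p.N → (W' (i + 1) (j + p.N + 1) = ⊤ ↔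
    ∃ l, 0 ≤ l ∧ l < p.N ∧ W (i + 1) (j + p.N + 1) + W (i + 1) (l + 2 * p.N + 1) +
      W (l + 2 * p.N + 1) (j + p.N + 1) < 0)

/-- Deletions are always justified by the invariant. Conversely, the iterations suffice to pass all
`N ^ 2` triples, and if these are clean then no surviving pair lies in a negative triangle.
Finiteness at the start makes deleted pairs recognisable. -/
theorem MainInv.detected (ok : p.Ok) (h : MainInv p σ W 0 σ')
    (hfin : ∀ i j, 0 ≤ i → i < p.N → 0 ≤ j → j < p.N → W (i + 1) (j + p.N + 1) ≠ ⊤)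
    (hc : Clean p (storedMat p.S σ'.arr) (σ'.reg 21)) :
    Detected p W (storedMat p.S σ'.arr) := by
  have hN := ok.N_pos
  -- With no iterations left, the progress inequality reads `2 * N ^ 2 * r ≤ τ * r + a + r *
  -- marked`. Since `marked ≤ N ^ 2` and `a < r`, this forces `τ * r > (N ^ 2 - 1) * r`.
  have hτ : p.N * p.N ≤ σ'.reg 21 := by
    have h1 := h.progress
    have h2 : (marked p (storedMat p.S σ'.arr) : ℤ) ≤ p.N * p.N := by
      rw [← Params.cast_m6]; exact_mod_cast marked_le p _
    have h3 := h.a_lt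
    have h4 : (p.calls : ℤ) = 2 * (p.N * p.N) * p.r := by
      rw [← Params.cast_m6, Params.calls]; push_cast; ring
    rw [h4] at h1
    have hr : (1 : ℤ) ≤ p.r := by exact_mod_cast ok.r_pos
    have h5 := mul_le_mul_of_nonneg_left h2 (show (0 : ℤ) ≤ p.r by omega)
    by_contra hlt
    have h6 : (σ'.reg 21 + 1) * p.r ≤ p.N * p.N * p.r :=
      mul_le_mul_of_nonneg_right (by omega) (by omega)
    push_cast at h1
    nlinarith
  intro i j hi hiN hj hjN
  constructor
  · intro htop
    rcases h.cell i j hi hiN hj hjN with h1 | ⟨-, h1⟩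
    · exact absurd (h1.symm.trans htop) (hfin i j hi hiN hj hjN)
    · exact h1
  · rintro ⟨l, hl, hlN, hs⟩
    rcases h.cell i j hi hiN hj hjN with h1 | ⟨h1, -⟩
    · exfalso
      obtain ⟨τ, x, y, z, hτ', hx, hy, hz, ex, ey, ez⟩ := ok.exists_block hi hiN hj hjN hl hlN
      refine hc τ hτ'.1 (by omega) ⟨x, y, z, hx, hy, hz, ?_⟩
      rw [ex, ey, ez, h1, h.outer _ _ (Or.inr (by omega)), h.outer _ _ (Or.inr (by omega))]
      refine lt_of_eq_of_lt ?_ hs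
      congr 1
      rw [← h.outer (j + p.N + 1) _ (Or.inr (by omega)), ← h.outer _ (j + p.N + 1) (Or.inl (by omega)),
        h.tri.symm]
    · exact h1

-- The main loop fails with probability at most its initial potential: one term `(1/3) ^ r` for each
-- iteration, and one for the first triple. At the end the potential is at least `1` whenever the
-- range that was passed is not clean.
open Classical in
theorem tri_mainLoop (hw : 1 ≤ w) (hL : 2 * p.L = 2 ^ w) (ok : p.Ok) {P : QProgram} {c TP : ℕ}
    (hB : 1 ≤ B) (hPB : P.bound ≤ B)
    (hP : ∀ A : (minTriangle c).Inst (3 * p.m), ∃ t ≤ TP,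
      P.HaltsWithin (3 * p.m) ((minTriangle c).input w A) t ∧
      2 / 3 ≤ P.successProb (3 * p.m) ((minTriangle c).input w A) t ((minTriangle c).correct A))
    (htop : p.top ≤ (3 * p.m) ^ c) (hE : Env p σ) (hS : Stores p.S σ.arr W)
    (hT : Tripartite p.N p.top W)
    (hfin : ∀ i j, 0 ≤ i → i < p.N → 0 ≤ j → j < p.N → W (i + 1) (j + p.N + 1) ≠ ⊤) :
    Tri X B (mainLoop B P) (p.calls * (75 * p.m + 13 * TP + 5 * B + 151) + 10) σ
      ((p.calls + 1) * (1 / 3) ^ p.r) (MainInv p σ W 0)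
      fun σ' => if Detected p W (storedMat p.S σ'.arr) then 0 else 1 := by
  have hρ : (0 : ℝ) ≤ (1 / 3) ^ p.r := by positivity
  have hcl := ok.calls_lt
  refine (Tri.seq (T' := p.calls * (75 * p.m + 13 * TP + 5 * B + 151) + 1) (f' := loss p 0)
    (f := loss p p.calls) ((det_code hw hL (by simp)
      (by simp [SafeAll, IntInstr.Safe, IntOp.Safe])).tri (b := (p.calls + 1) * (1 / 3) ^ p.r) ?_)
    fun σ₁ h₁ => Tri.loop (MainInv p σ W) (loss p) (fun _ _ h => h.r18) ?_
      (fun k _ σ' hσ' => tri_mainBody hw hL ok hB hPB hP htop hσ') ?_).mono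
      (by simp; omega) le_rfl (fun _ h => h) ?_
  · rintro _ rfl
    unfold loss
    split_ifs with h1 h2
    · refine (min_le_right _ _).trans ?_
      simp [execAll, IntInstr.exec, IState.setReg_reg]
      linarith
    · refine (min_le_right _ _).trans ?_
      linarith
    -- At `τ = 0` no triples have been passed, so the state is vacuously clean.
    · refine absurd (fun τ' h0 h1' => ?_) h1
      simp [execAll, IntInstr.exec, IState.setReg_reg] at h1'
      omega
  · have : (p.calls : ℤ) < 2 ^ w := by omega
    exact_mod_cast this
  · subst h₁
    set σ₁ := execAll [.const 21 0, .const 22 0, .const 18 0, .op .add 18 18 15] σ with hσ₁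
    have hr : ∀ r, r ≠ 18 → r ≠ 21 → r ≠ 22 → σ₁.reg r = σ.reg r := fun r _ _ _ =>
      reg_execAll_of_notMem (by simp [IntInstr.dest]; omega) _
    have e21 : σ₁.reg 21 = 0 := by simp [hσ₁, execAll, IntInstr.exec, IState.setReg_reg]
    have e22 : σ₁.reg 22 = 0 := by simp [hσ₁, execAll, IntInstr.exec, IState.setReg_reg]
    have hW : storedMat p.S σ₁.arr = W := hS.mat_eq hT.mem_range
    have hrp := ok.r_pos
    constructor
    case env =>
      exact hE.congr (fun r _ _ _ _ => hr r (by omega) (by omega) (by omega))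
        (fun _ _ => rfl) fun _ _ => rfl
    case reg => exact fun r _ _ h3 h4 h5 _ => hr r h3 h4 h5
    case r18 => simp [hσ₁, execAll, IntInstr.exec, IState.setReg_reg, IntOp.eval, hE.r15]
    case a4 => rfl
    case tab => rfl
    case tau_nonneg => omega
    case tau_le => omega
    case a_nonneg => omega
    case a_lt => omega
    all_goals rw [hW]
    case stores => exact hS
    case tri => exact hT
    case outer => exact fun _ _ _ => rfl
    case cell => exact fun _ _ _ _ _ _ => Or.inl rfl
    case progress =>
      rw [e21, e22]
      have : (0 : ℤ) ≤ p.r * marked p W := by positivity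
      linarith
  · intro σ' hσ'
    by_cases h1 : Clean p (storedMat p.S σ'.arr) (σ'.reg 21)
    · rw [if_pos (hσ'.detected ok hfin h1), loss, if_pos h1]
      refine le_min zero_le_one ?_
      have : (0 : ℝ) ≤ (1 / 3) ^ (p.r - σ'.reg 22).toNat := by positivity
      split_ifs <;> simp
    · rw [loss, if_neg h1]
      split_ifs <;> simp

end

/-! ## Binary search for the entries of a distance product -/

/-- One round of the binary search. -/
def roundBody (B : ℕ) (P : QProgram) : QProgram :=
  .seq (.seq (code B [.op .sub 19 19 8]) (sweep B thresholdBody))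
    (.seq (mainLoop B P) (.seq (sweep B raiseBody) (code B [.op .div 12 12 9])))

/-- The binary search. -/
def rounds (B : ℕ) (P : QProgram) : QProgram :=
  .seq (code B [.const 12 0, .op .add 12 12 13, .const 19 0, .op .add 19 19 25])
    (.loop (B + 19) (roundBody B P))

/-- The invariant of the binary search with `k` rounds to go. -/
structure RoundInv (p : Params) (σ₀ : IState) (W₀ : ℤ → ℤ → WithTop ℤ) (k : ℕ) (σ : IState) :
    Prop where
  env : Env p σ
  reg : ∀ r, 2 ≤ r → r < 30 → r ≠ 12 → r ≠ 17 → r ≠ 18 → r ≠ 19 → (r < 21 ∨ 23 < r) →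
    σ.reg r = σ₀.reg r
  r19 : σ.reg 19 = k
  r12 : σ.reg 12 = 2 ^ k / 2
  tab : σ.tab = σ₀.tab
  stores : Stores p.S σ.arr (storedMat p.S σ.arr)
  tri : Tripartite p.N p.top (storedMat p.S σ.arr)
  outer : ∀ x y, 2 * p.N < x ∨ 2 * p.N < y → storedMat p.S σ.arr x y = W₀ x y
  lower : ∀ i j, 0 ≤ i → i < p.N → 0 ≤ j → j < p.N → -p.top ≤ σ.arr 4 (i * p.N + j)
  upper : ∀ i j, 0 ≤ i → i < p.N → 0 ≤ j → j < p.N → σ.arr 4 (i * p.N + j) ≤ p.top - 2 ^ k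

/-- The numbers `e i j` are determined by thresholds for the paths from the first to the second
part via the third part. -/
def IsThreshold (p : Params) (W : ℤ → ℤ → WithTop ℤ) (e : ℤ → ℤ → ℤ) : Prop :=
  ∀ i j, 0 ≤ i → i < p.N → 0 ≤ j → j < p.N → ∀ θ, -p.top ≤ θ → θ ≤ p.top - 1 →
    (e i j < θ ↔ ∃ l, 0 ≤ l ∧ l < p.N ∧
      W (i + 1) (l + 2 * p.N + 1) + W (l + 2 * p.N + 1) (j + p.N + 1) < θ)

/-- The intervals of length `2 ^ k` that start at the lower bounds contain the numbers `e i j`. -/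
def Within (p : Params) (W₀ : ℤ → ℤ → WithTop ℤ) (e : ℤ → ℤ → ℤ) (k : ℕ) (σ : IState) : Prop :=
  IsThreshold p W₀ e ∧ ∀ i j, 0 ≤ i → i < p.N → 0 ≤ j → j < p.N →
    σ.arr 4 (i * p.N + j) ≤ e i j ∧ e i j < σ.arr 4 (i * p.N + j) + 2 ^ k

/-- A bound for the time of a round. -/
def roundTime (p : Params) (B TP : ℕ) : ℕ :=
  p.m ^ 6 * 80 + p.calls * (75 * p.m + 13 * TP + 5 * B + 151) + 40

/-- A bound for the failure probability of the main loop. -/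
noncomputable def mainError (p : Params) : ℝ := (p.calls + 1) * (1 / 3) ^ p.r

/-- The bridge between negative triangles and the tests of the binary search. -/
theorem neg_add_lt_zero_iff (θ : ℤ) (a b : WithTop ℤ) :
    ((-θ : ℤ) : WithTop ℤ) + a + b < 0 ↔ a + b < θ := by
  cases a with
  | top => simp
  | coe a =>
    cases b with
    | top => simp
    | coe b => norm_cast; omega

section

variable {w : ℕ} {X : WordInput w} {B : ℕ} {p : Params} {σ₀ σ σ₁ σ₂ σ₃ σ' : IState}
  {W₀ W₁ : ℤ → ℤ → WithTop ℤ} {e : ℤ → ℤ → ℤ} {k : ℕ}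

theorem Params.top_eq : p.top = 2 ^ p.q := rfl

/-- The relation between the states before and after the thresholds are put into the matrix. -/
structure Thresholds (p : Params) (σ σ₁ : IState) (W₁ : ℤ → ℤ → WithTop ℤ) : Prop where
  reg : ∀ r < 30, r ≠ 17 → r ≠ 19 → σ₁.reg r = σ.reg r
  r19 : σ₁.reg 19 = σ.reg 19 - 1
  a2 : σ₁.arr 2 = σ.arr 2
  a3 : σ₁.arr 3 = σ.arr 3
  a4 : σ₁.arr 4 = σ.arr 4
  tab : σ₁.tab = σ.tab
  stores : Stores p.S σ₁.arr W₁
  tri : Tripartite p.N p.top W₁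
  outer : ∀ x y, 2 * p.N < x ∨ 2 * p.N < y → W₁ x y = storedMat p.S σ.arr x y
  cell : ∀ i j, 0 ≤ i → i < p.N → 0 ≤ j → j < p.N →
    W₁ (i + 1) (j + p.N + 1) = ((-(σ.arr 4 (i * p.N + j) + σ.reg 12) : ℤ) : WithTop ℤ)

theorem two_pow_succ_ediv (k : ℕ) : (2 : ℤ) ^ (k + 1) / 2 = 2 ^ k := by
  rw [pow_succ]; exact Int.mul_ediv_cancel _ two_ne_zero

theorem RoundInv.step_eq (h : RoundInv p σ₀ W₀ (k + 1) σ) : σ.reg 12 = 2 ^ k := by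
  rw [h.r12, two_pow_succ_ediv]

theorem det_thresholds (hw : 1 ≤ w) (hL : 2 * p.L = 2 ^ w) (ok : p.Ok)
    (h : RoundInv p σ₀ W₀ (k + 1) σ) :
    Det X B (.seq (code B [.op .sub 19 19 8]) (sweep B thresholdBody)) (p.m ^ 6 * 45 + 9) σ
      fun σ₁ => ∃ W₁, Thresholds p σ σ₁ W₁ := by
  have hr : ∀ r, r ≠ 19 → (execAll [.op .sub 19 19 8] σ).reg r = σ.reg r := fun r _ =>
    reg_execAll_of_notMem (by simp [IntInstr.dest]; omega) _
  refine ((det_code hw hL (l := [.op .sub 19 19 8]) (by simp)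
    (by simp [SafeAll, IntInstr.Safe, IntOp.Safe])).seq
    (T' := p.m ^ 6 * 45 + 6) (Q' := fun σ₁ => ∃ W₁, Thresholds p σ σ₁ W₁) ?_).mono
    (by simp; omega) fun _ h => h
  rintro _ rfl
  have hE : Env p (execAll [.op .sub 19 19 8] σ) :=
    h.env.congr (fun r _ _ _ _ => hr r (by omega)) (fun _ _ => rfl) fun _ _ => rfl
  refine (det_threshold hw hL ok hE (W := storedMat p.S σ.arr) h.stores h.tri
    fun i j hi hiN hj hjN => ?_).mono le_rfl ?_
  · rw [hr 12 (by omega), h.step_eq]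
    change |σ.arr 4 (i * p.N + j) + 2 ^ k| ≤ p.top
    have h1 := h.lower i j hi hiN hj hjN
    have h2 := h.upper i j hi hiN hj hjN
    have h3 : (1 : ℤ) ≤ 2 ^ k := one_le_pow₀ (by norm_num)
    rw [pow_succ] at h2
    rw [abs_le]
    constructor <;> linarith
  · rintro σ₁ ⟨hF, h4, W₁, hS, hT, ho, hc⟩
    refine ⟨W₁, fun r h1 h2 h3 => (hF.reg r (by omega) h2).trans (hr r h3), ?_, hF.a2, hF.a3, h4,
      hF.tab, hS, hT, ho, fun i j hi hiN hj hjN => ?_⟩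
    · rw [hF.reg 19 (by omega) (by omega)]
      simp [execAll, IntInstr.exec, IState.setReg_reg, IntOp.eval, h.env.r8]
    · rw [hc i j hi hiN hj hjN, hr 12 (by omega)]
      rfl

/-- The relation between the states before and after the lower bounds are raised. -/
structure Raised (p : Params) (σ₂ σ₃ : IState) : Prop where
  reg : ∀ r < 30, r ≠ 17 → r ≠ 12 → σ₃.reg r = σ₂.reg r
  r12 : σ₃.reg 12 = σ₂.reg 12 / 2
  a2 : σ₃.arr 2 = σ₂.arr 2
  a3 : σ₃.arr 3 = σ₂.arr 3
  tab : σ₃.tab = σ₂.tab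
  stores : Stores p.S σ₃.arr (storedMat p.S σ₂.arr)
  a4 : ∀ i j, 0 ≤ i → i < p.N → 0 ≤ j → j < p.N → σ₃.arr 4 (i * p.N + j) =
    σ₂.arr 4 (i * p.N + j) + finFlag (storedMat p.S σ₂.arr (i + 1) (j + p.N + 1)) * σ₂.reg 12

theorem det_raised (hw : 1 ≤ w) (hL : 2 * p.L = 2 ^ w) (ok : p.Ok) (hE : Env p σ₂)
    (hS : Stores p.S σ₂.arr (storedMat p.S σ₂.arr)) (h12 : 0 ≤ σ₂.reg 12)
    (h12' : σ₂.reg 12 ≤ p.top) :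
    Det X B (.seq (sweep B raiseBody) (code B [.op .div 12 12 9])) (p.m ^ 6 * 35 + 9) σ₂
      (Raised p σ₂) := by
  have htop := ok.top_lt
  have htop1 := Params.Ok.top_pos (p := p)
  refine ((det_raise hw hL ok hE hS).seq (T' := 2) (Q' := Raised p σ₂) ?_).mono
    (by omega) fun _ h => h
  rintro σ' ⟨hF, hS', h4⟩
  have h12e : σ'.reg 12 = σ₂.reg 12 := hF.reg _ (by omega) (by omega)
  have h9 : σ'.reg 9 = 2 := (hF.reg _ (by omega) (by omega)).trans hE.r9
  refine (det_code hw hL (by simp) ?_).mono (by simp) ?_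
  · simp only [SafeAll, IntInstr.Safe, IntOp.Safe, h12e, h9, and_true]
    omega
  · rintro _ rfl
    refine ⟨fun r h1 h2 h3 => ?_, ?_, hF.a2, hF.a3, hF.tab, hS', h4⟩
    · rw [reg_execAll_of_notMem (by simp [IntInstr.dest]; omega), hF.reg r (by omega) h2]
    · simp [execAll, IntInstr.exec, IState.setReg_reg, IntOp.eval, h12e, h9]

/-- The structural invariant survives whatever the main loop has found. Only the statement that the
halved intervals still contain the wanted numbers relies on `Detected`. -/
theorem RoundInv.next (h : RoundInv p σ₀ W₀ (k + 1) σ) (h₁ : Thresholds p σ σ₁ W₁)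
    (h₂ : MainInv p σ₁ W₁ 0 σ₂) (h₃ : Raised p σ₂ σ₃) :
    RoundInv p σ₀ W₀ k σ₃ ∧
      (Detected p W₁ (storedMat p.S σ₂.arr) → Within p W₀ e (k + 1) σ → Within p W₀ e k σ₃) := by
  have hW : storedMat p.S σ₃.arr = storedMat p.S σ₂.arr := h₃.stores.mat_eq h₂.tri.mem_range
  have e12 : σ₂.reg 12 = 2 ^ k := by
    rw [h₂.reg 12 (by omega) (by omega) (by omega) (by omega) (by omega) (by omega),
      h₁.reg 12 (by omega) (by omega) (by omega), h.step_eq]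
  have e4 : ∀ i j, 0 ≤ i → i < p.N → 0 ≤ j → j < p.N → σ₃.arr 4 (i * p.N + j) =
      σ.arr 4 (i * p.N + j) + finFlag (storedMat p.S σ₂.arr (i + 1) (j + p.N + 1)) * 2 ^ k :=
    fun i j hi hiN hj hjN => by rw [h₃.a4 i j hi hiN hj hjN, e12, h₂.a4, h₁.a4]
  have hk : (1 : ℤ) ≤ 2 ^ k := one_le_pow₀ (by norm_num)
  have h19 := h.r19
  push_cast at h19
  refine ⟨?_, fun hD hI => ⟨hI.1, fun i j hi hiN hj hjN => ?_⟩⟩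
  · constructor
    case env =>
      exact h₂.env.congr (fun r h1 h2 h3 h4 => h₃.reg r (by omega) (by omega) h3)
        (fun _ _ => by rw [h₃.a2]) fun _ _ => by rw [h₃.a3]
    case reg =>
      intro r h1 h2 h3 h4 h5 h6 h7
      rw [h₃.reg r h2 h4 h3, h₂.reg r h1 h2 h5 (by omega) (by omega) (by omega), h₁.reg r h2 h4 h6,
        h.reg r h1 h2 h3 h4 h5 h6 h7]
    case r19 =>
      rw [h₃.reg 19 (by omega) (by omega) (by omega), h₂.reg 19 (by omega) (by omega) (by omega)
        (by omega) (by omega) (by omega), h₁.r19, h19]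
      ring
    case r12 => rw [h₃.r12, e12]
    case tab => rw [h₃.tab, h₂.tab, h₁.tab, h.tab]
    case lower =>
      intro i j hi hiN hj hjN
      rw [e4 i j hi hiN hj hjN]
      have := h.lower i j hi hiN hj hjN
      rcases finFlag_eq (storedMat p.S σ₂.arr (i + 1) (j + p.N + 1)) with ⟨h1, -⟩ | ⟨h1, -⟩ <;>
        rw [h1] <;> linarith
    case upper =>
      intro i j hi hiN hj hjN
      rw [e4 i j hi hiN hj hjN]
      have := h.upper i j hi hiN hj hjN
      rw [pow_succ] at this
      rcases finFlag_eq (storedMat p.S σ₂.arr (i + 1) (j + p.N + 1)) with ⟨h1, -⟩ | ⟨h1, -⟩ <;>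
        rw [h1] <;> linarith
    all_goals rw [hW]
    case stores => exact h₃.stores
    case tri => exact h₂.tri
    case outer => exact fun x y hxy => by rw [h₂.outer x y hxy, h₁.outer x y hxy, h.outer x y hxy]
  · obtain ⟨hI1, hI2⟩ := hI.2 i j hi hiN hj hjN
    have hlo := h.lower i j hi hiN hj hjN
    have hup := h.upper i j hi hiN hj hjN
    rw [pow_succ] at hI2 hup
    rw [e4 i j hi hiN hj hjN]
    -- The midpoint is an admissible threshold: the interval of length `2 ^ (k + 1)` ends at `top`
    -- or below, so its midpoint is at most `top - 2 ^ k ≤ top - 1`.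
    have hθ := hI.1 i j hi hiN hj hjN (σ.arr 4 (i * p.N + j) + 2 ^ k) (by linarith) (by linarith)
    have hd := hD i j hi hiN hj hjN
    simp only [h₁.cell i j hi hiN hj hjN, h.step_eq, neg_add_lt_zero_iff] at hd
    have hcongr : (∃ l, 0 ≤ l ∧ l < p.N ∧ W₁ (i + 1) (l + 2 * p.N + 1) +
        W₁ (l + 2 * p.N + 1) (j + p.N + 1) < ((σ.arr 4 (i * p.N + j) + 2 ^ k : ℤ) : WithTop ℤ)) ↔
        ∃ l, 0 ≤ l ∧ l < p.N ∧ W₀ (i + 1) (l + 2 * p.N + 1) +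
        W₀ (l + 2 * p.N + 1) (j + p.N + 1) < ((σ.arr 4 (i * p.N + j) + 2 ^ k : ℤ) : WithTop ℤ) := by
      refine exists_congr fun l => and_congr_right fun hl => and_congr_right fun _ => ?_
      rw [h₁.outer _ _ (Or.inr (by omega)), h₁.outer _ _ (Or.inl (by omega)),
        h.outer _ _ (Or.inr (by omega)), h.outer _ _ (Or.inl (by omega))]
    rw [hcongr, ← hθ] at hd
    rcases finFlag_eq (storedMat p.S σ₂.arr (i + 1) (j + p.N + 1)) with ⟨h1, h2⟩ | ⟨h1, h2⟩
    · have := hd.1 h2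
      rw [h1]
      constructor <;> linarith
    · have := not_lt.1 (mt hd.2 h2)
      rw [h1]
      constructor <;> linarith

-- The failure probabilities of the rounds add up: if the intervals are right before a round, they
-- are wrong afterwards only if its main loop has failed. If they are wrong before, the bound is at
-- least `1` already.
open Classical in
theorem tri_roundBody (hw : 1 ≤ w) (hL : 2 * p.L = 2 ^ w) (ok : p.Ok) {P : QProgram} {c TP : ℕ}
    (hB : 1 ≤ B) (hPB : P.bound ≤ B)
    (hP : ∀ A : (minTriangle c).Inst (3 * p.m), ∃ t ≤ TP,
      P.HaltsWithin (3 * p.m) ((minTriangle c).input w A) t ∧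
      2 / 3 ≤ P.successProb (3 * p.m) ((minTriangle c).input w A) t ((minTriangle c).correct A))
    (htop : p.top ≤ (3 * p.m) ^ c) (h : RoundInv p σ₀ W₀ (k + 1) σ) :
    Tri X B (roundBody B P) (roundTime p B TP) σ
      ((if Within p W₀ e (k + 1) σ then 0 else 1) + (k + 1 : ℕ) * mainError p)
      (RoundInv p σ₀ W₀ k) (fun σ' => (if Within p W₀ e k σ' then 0 else 1) + k * mainError p) := by
  set b : ℝ := (if Within p W₀ e (k + 1) σ then 0 else 1) + k * mainError p with hb
  refine (Tri.seq (T' := p.calls * (75 * p.m + 13 * TP + 5 * B + 151) + p.m ^ 6 * 35 + 20)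
    (Q' := RoundInv p σ₀ W₀ k)
    (f' := fun σ' => (if Within p W₀ e k σ' then 0 else 1) + k * mainError p)
    (f := fun _ => mainError p + b) ((det_thresholds hw hL ok h).tri fun _ _ => le_rfl)
    ?_).mono (by rw [roundTime]; omega) (by rw [hb]; push_cast; linarith) (fun _ h => h)
    fun _ _ => le_rfl
  rintro σ₁ ⟨W₁, h₁⟩
  have hE₁ : Env p σ₁ := h.env.congr (fun r _ _ _ _ => h₁.reg r (by omega) (by omega) (by omega))
    (fun _ _ => by rw [h₁.a2]) fun _ _ => by rw [h₁.a3]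
  refine (Tri.seq (T' := p.m ^ 6 * 35 + 9) (Q' := RoundInv p σ₀ W₀ k)
    (f' := fun σ' => (if Within p W₀ e k σ' then 0 else 1) + k * mainError p)
    ((tri_mainLoop hw hL ok hB hPB hP htop hE₁ h₁.stores h₁.tri fun i j hi hiN hj hjN => by
      rw [h₁.cell i j hi hiN hj hjN]; exact WithTop.coe_ne_top).add_const hw b) fun σ₂ h₂ => ?_).mono
    (by omega) le_rfl (fun _ h => h) fun _ _ => le_rfl
  have e12 : σ₂.reg 12 = 2 ^ k := by
    rw [h₂.reg 12 (by omega) (by omega) (by omega) (by omega) (by omega) (by omega),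
      h₁.reg 12 (by omega) (by omega) (by omega), h.step_eq]
  have hk : (1 : ℤ) ≤ 2 ^ k := one_le_pow₀ (by norm_num)
  have hN := ok.N_pos
  have hlo := h.lower 0 0 le_rfl (by omega) le_rfl (by omega)
  have hup := h.upper 0 0 le_rfl (by omega) le_rfl (by omega)
  rw [pow_succ] at hup
  refine ((det_raised hw hL ok h₂.env h₂.stores (by omega) (by rw [e12]; linarith)).tri
    fun σ₃ h₃ => ?_).mono le_rfl le_rfl (fun σ₃ h₃ => (h.next (e := e) h₁ h₂ h₃).1) fun _ _ => le_rfl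
  have := (h.next (e := e) h₁ h₂ h₃).2
  rw [hb]
  split_ifs <;> first | linarith | tauto

open Classical in
theorem tri_rounds (hw : 1 ≤ w) (hL : 2 * p.L = 2 ^ w) (ok : p.Ok) {P : QProgram} {c TP : ℕ}
    (hB : 1 ≤ B) (hPB : P.bound ≤ B)
    (hP : ∀ A : (minTriangle c).Inst (3 * p.m), ∃ t ≤ TP,
      P.HaltsWithin (3 * p.m) ((minTriangle c).input w A) t ∧
      2 / 3 ≤ P.successProb (3 * p.m) ((minTriangle c).input w A) t ((minTriangle c).correct A))
    (htop : p.top ≤ (3 * p.m) ^ c) (hE : Env p σ) (hS : Stores p.S σ.arr W₀)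
    (hT : Tripartite p.N p.top W₀)
    (h4 : ∀ i j, 0 ≤ i → i < p.N → 0 ≤ j → j < p.N → σ.arr 4 (i * p.N + j) = -p.top)
    (he : ∀ i j, 0 ≤ i → i < p.N → 0 ≤ j → j < p.N → -p.top ≤ e i j ∧ e i j < p.top) :
    Tri X B (rounds B P) ((p.q + 1) * (roundTime p B TP + 1) + 10) σ
      ((if IsThreshold p W₀ e then 0 else 1) + (p.q + 1 : ℕ) * mainError p)
      (RoundInv p σ W₀ 0) (fun σ' => if Within p W₀ e 0 σ' then 0 else 1) := by
  refine (Tri.seq (T' := (p.q + 1) * (roundTime p B TP + 1) + 1)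
    (Q' := RoundInv p σ W₀ 0)
    (f' := fun σ' => (if Within p W₀ e 0 σ' then 0 else 1) + (0 : ℕ) * mainError p)
    (f := fun σ' => (if Within p W₀ e (p.q + 1) σ' then 0 else 1) + (p.q + 1 : ℕ) * mainError p)
    ((det_code hw hL (by simp) (by simp [SafeAll, IntInstr.Safe, IntOp.Safe])).tri
      (b := (if IsThreshold p W₀ e then 0 else 1) + (p.q + 1 : ℕ) * mainError p) ?_)
    fun σ₁ h₁ => Tri.loop (RoundInv p σ W₀)
      (fun k σ' => (if Within p W₀ e k σ' then 0 else 1) + k * mainError p) (fun _ _ h => h.r19) ?_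
      (fun k _ σ' hσ' => tri_roundBody hw hL ok hB hPB hP htop hσ') ?_).mono
      (by simp; omega) le_rfl (fun _ h => h) ?_
  · rintro _ rfl
    have : IsThreshold p W₀ e → Within p W₀ e (p.q + 1)
        (execAll [.const 12 0, .op .add 12 12 13, .const 19 0, .op .add 19 19 25] σ) := by
      refine fun h => ⟨h, fun i j hi hiN hj hjN => ?_⟩
      -- The search starts with the interval from `-top` to `top`, which has length `2 * 2 ^ q`;
      -- therefore `q + 1` rounds are needed.
      change σ.arr 4 (i * p.N + j) ≤ e i j ∧ e i j < σ.arr 4 (i * p.N + j) + 2 ^ (p.q + 1)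
      rw [h4 i j hi hiN hj hjN, pow_succ, ← Params.top_eq]
      have := he i j hi hiN hj hjN
      omega
    split_ifs <;> first | linarith | tauto
  · have := ok.q_lt
    have : ((p.q + 1 : ℕ) : ℤ) < 2 ^ w := by push_cast; omega
    exact_mod_cast this
  · subst h₁
    set σ₁ := execAll [.const 12 0, .op .add 12 12 13, .const 19 0, .op .add 19 19 25] σ with hσ₁
    have hr : ∀ r, r ≠ 12 → r ≠ 19 → σ₁.reg r = σ.reg r := fun r _ _ =>
      reg_execAll_of_notMem (by simp [IntInstr.dest]; omega) _
    have hW : storedMat p.S σ₁.arr = W₀ := hS.mat_eq hT.mem_range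
    constructor
    case env =>
      exact hE.congr (fun r _ _ _ _ => hr r (by omega) (by omega)) (fun _ _ => rfl) fun _ _ => rfl
    case reg => exact fun r _ _ h1 _ _ h2 _ => hr r h1 h2
    case r19 => simp [hσ₁, execAll, IntInstr.exec, IState.setReg_reg, IntOp.eval, hE.r25]
    case r12 =>
      rw [two_pow_succ_ediv, ← Params.top_eq]
      simp [hσ₁, execAll, IntInstr.exec, IState.setReg_reg, IntOp.eval, hE.r13]
    case tab => rfl
    case lower => exact fun i j hi hiN hj hjN => (h4 i j hi hiN hj hjN).ge
    case upper =>
      intro i j hi hiN hj hjN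
      change σ.arr 4 (i * p.N + j) ≤ _
      rw [h4 i j hi hiN hj hjN, pow_succ, ← Params.top_eq]
      linarith
    all_goals rw [hW]
    case stores => exact hS
    case tri => exact hT
    case outer => exact fun _ _ _ => rfl
  · intro σ' _
    simp

/-! ## Repeated distance products -/

/-- Compute the flags and values of the entries of a product from the lower bounds. -/
def capPre : List IntInstr :=
  [.load 39 4 17, .op .sub 40 13 8, .op .lt 41 39 40, .op .mul 42 41 39, .op .lt 45 39 40,
    .op .mul 46 45 39]

/-- Replace both factors by their product. -/
def squareBody (B : ℕ) (P : QProgram) : QProgram :=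
  .seq (.seq (code B [.op .sub 20 20 8]) (rounds B P)) (sweep B (fillBody capPre))

/-- The matrix that is given by the lower bounds. -/
noncomputable def capMat (p : Params) (lo : ℤ → ℤ) (i j : ℤ) : WithTop ℤ :=
  if (0 ≤ i ∧ i < p.N) ∧ (0 ≤ j ∧ j < p.N) ∧ lo (i * p.N + j) < p.top - 1 then
    (lo (i * p.N + j) : WithTop ℤ) else ⊤

/-- The matrix `C` is the distance product of `U` and `V`, with entries of moderate size. -/
structure IsProduct (p : Params) (U V C : ℤ → ℤ → WithTop ℤ) : Prop where
  lt_iff : ∀ i j, 0 ≤ i → i < p.N → 0 ≤ j → j < p.N → ∀ θ : ℤ,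
    C i j < θ ↔ ∃ l, 0 ≤ l ∧ l < p.N ∧ U i l + V l j < θ
  bound : ∀ i j, 0 ≤ i → i < p.N → 0 ≤ j → j < p.N → ∀ z : ℤ, C i j = z → |z| < p.top - 1

/-- The invariant of the loop that computes products, with `k` products to go. -/
structure SquareInv (p : Params) (σ₀ : IState) (k : ℕ) (σ : IState) : Prop where
  env : Env p σ
  reg : ∀ r, 2 ≤ r → r < 30 → r ≠ 12 → (r < 17 ∨ 23 < r) → σ.reg r = σ₀.reg r
  r20 : σ.reg 20 = k
  tab : σ.tab = σ₀.tab
  stores : Stores p.S σ.arr (storedMat p.S σ.arr)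
  tri : Tripartite p.N p.top (storedMat p.S σ.arr)
  a4 : ∀ i j, 0 ≤ i → i < p.N → 0 ≤ j → j < p.N → σ.arr 4 (i * p.N + j) = -p.top

/-- The matrices `U` and `V` are stored between the third part and the other parts. -/
def Holds (p : Params) (U V : ℤ → ℤ → WithTop ℤ) (σ : IState) : Prop :=
  ∀ i j, 0 ≤ i → i < p.N → 0 ≤ j → j < p.N →
    storedMat p.S σ.arr (i + 1) (j + 2 * p.N + 1) = U i j ∧
    storedMat p.S σ.arr (i + 2 * p.N + 1) (j + p.N + 1) = V i j

/-- A bound for the time of one distance product. -/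
def squareTime (p : Params) (B TP : ℕ) : ℕ :=
  (p.q + 1) * (roundTime p B TP + 1) + p.m ^ 6 * 71 + 30

theorem computes_cap (ok : p.Ok) (h : RoundInv p σ₀ W₀ 0 σ) :
    Computes p σ capPre (capMat p (σ.arr 4)) (capMat p (σ.arr 4)) := by
  intro i j hi hiN hj hjN σ' hF hC h4
  have hE := hF.env h.env
  have hlo := h.lower i j hi hiN hj hjN
  have hup := h.upper i j hi hiN hj hjN
  have htop := ok.top_lt
  have htop1 := Params.Ok.top_pos (p := p)
  have hNN := mul_add_lt_mul_self hiN hi hjN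
  have hNN' := ok.NN_le
  have hiN' : 0 ≤ i * p.N := by nlinarith
  have e39 : σ'.arr 4 (σ'.reg 17) = σ.arr 4 (i * p.N + j) := by rw [hC.r17, h4]
  have hcap : capMat p (σ.arr 4) i j = if σ.arr 4 (i * p.N + j) < p.top - 1 then
      (σ.arr 4 (i * p.N + j) : WithTop ℤ) else ⊤ := by
    rw [capMat]
    exact if_congr (by simp [hi, hiN, hj, hjN]) rfl rfl
  refine ⟨?_, fun r hr => reg_execAll_of_notMem (by simp [capPre, IntInstr.dest]; omega) _, rfl, rfl,
    ?_, ?_, ?_, ?_⟩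
  · simp only [capPre, SafeAll, IntInstr.Safe, IntOp.Safe, IntInstr.exec, IState.setReg_reg,
      IntOp.eval, hE.r13, hE.r8, hC.r17, h4, Nat.reduceEqDiff, if_true,
      if_false, true_and, and_true]
    omega
  all_goals
    simp only [capPre, execAll, IntInstr.exec, IState.setReg_reg, IntOp.eval, hE.r13, hE.r8, e39,
      Nat.reduceEqDiff, if_true, if_false, hcap]
    split_ifs <;> simp

/-- Infinite entries are encoded by `top - 1`, the largest admissible threshold: no test with `θ ≤
top - 1` succeeds for them, so the search ends there. -/
theorem isThreshold_of_isProduct {U V C : ℤ → ℤ → WithTop ℤ} (hC : IsProduct p U V C)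
    (hH : Holds p U V σ) : IsThreshold p (storedMat p.S σ.arr)
      fun i j => if C i j = ⊤ then p.top - 1 else finValue (C i j) := by
  intro i j hi hiN hj hjN θ _ hθ
  have h1 : (∃ l, 0 ≤ l ∧ l < p.N ∧ storedMat p.S σ.arr (i + 1) (l + 2 * p.N + 1) +
      storedMat p.S σ.arr (l + 2 * p.N + 1) (j + p.N + 1) < θ) ↔
      ∃ l, 0 ≤ l ∧ l < p.N ∧ U i l + V l j < θ :=
    exists_congr fun l => and_congr_right fun hl => and_congr_right fun hlN => by
      rw [(hH i l hi hiN hl hlN).1, (hH l j hl hlN hj hjN).2]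
  rw [h1, ← hC.lt_iff i j hi hiN hj hjN θ]
  simp only
  cases C i j with
  | top =>
    simp only [if_true, not_top_lt, iff_false]
    omega
  | coe z => simp

/-- Intervals of length `1` pin down the entries. Finite ones are less than `top - 1` by the bound
in `IsProduct`, so they cannot be confused with the code for `∞`. -/
theorem capMat_eq {U V C : ℤ → ℤ → WithTop ℤ} (hC : IsProduct p U V C)
    (hW : Within p W₀ (fun i j => if C i j = ⊤ then p.top - 1 else finValue (C i j)) 0 σ)
    {i j : ℤ} (hi : 0 ≤ i) (hiN : i < p.N) (hj : 0 ≤ j) (hjN : j < p.N) :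
    capMat p (σ.arr 4) i j = C i j := by
  have h1 := hW.2 i j hi hiN hj hjN
  have h2 := hC.bound i j hi hiN hj hjN
  have hcap : capMat p (σ.arr 4) i j = if σ.arr 4 (i * p.N + j) < p.top - 1 then
      (σ.arr 4 (i * p.N + j) : WithTop ℤ) else ⊤ := by
    rw [capMat]
    exact if_congr (by simp [hi, hiN, hj, hjN]) rfl rfl
  rw [hcap]
  simp only [pow_zero] at h1
  cases h3 : C i j with
  | top =>
    rw [if_pos h3] at h1
    rw [if_neg (by omega)]
  | coe z =>
    rw [if_neg (by rw [h3]; exact WithTop.coe_ne_top), h3, finValue_coe] at h1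
    have h4 := (abs_lt.1 (h2 z h3)).2
    rw [if_pos (by omega), show σ.arr 4 (i * p.N + j) = z by omega]

-- The event that the stored factors are wrong is part of the failure estimate, so an error in an
-- earlier product is simply carried along at cost `1`. Each product adds `q + 1` main loops.
open Classical in
theorem tri_squareBody (hw : 1 ≤ w) (hL : 2 * p.L = 2 ^ w) (ok : p.Ok) {P : QProgram} {c TP : ℕ}
    (hB : 1 ≤ B) (hPB : P.bound ≤ B)
    (hP : ∀ A : (minTriangle c).Inst (3 * p.m), ∃ t ≤ TP,
      P.HaltsWithin (3 * p.m) ((minTriangle c).input w A) t ∧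
      2 / 3 ≤ P.successProb (3 * p.m) ((minTriangle c).input w A) t ((minTriangle c).correct A))
    (htop : p.top ≤ (3 * p.m) ^ c) (h : SquareInv p σ₀ (k + 1) σ) {U V C : ℤ → ℤ → WithTop ℤ}
    (hC : IsProduct p U V C) :
    Tri X B (squareBody B P) (squareTime p B TP) σ
      ((if Holds p U V σ then 0 else 1) + (p.q + 1 : ℕ) * mainError p)
      (SquareInv p σ₀ k) (fun σ' => if Holds p C C σ' then 0 else 1) := by
  have hN := ok.N_pos
  have htop1 := Params.Ok.top_pos (p := p)
  set e : ℤ → ℤ → ℤ := fun i j => if C i j = ⊤ then p.top - 1 else finValue (C i j) with he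
  set W₀ := storedMat p.S σ.arr with hW₀
  have hr : ∀ r, r ≠ 20 → (execAll [.op .sub 20 20 8] σ).reg r = σ.reg r := fun r _ =>
    reg_execAll_of_notMem (by simp [IntInstr.dest]; omega) _
  have hE : Env p (execAll [.op .sub 20 20 8] σ) :=
    h.env.congr (fun r _ _ _ _ => hr r (by omega)) (fun _ _ => rfl) fun _ _ => rfl
  have h20 : (execAll [.op .sub 20 20 8] σ).reg 20 = k := by
    have := h.r20
    push_cast at this
    simp [execAll, IntInstr.exec, IState.setReg_reg, IntOp.eval, h.env.r8, this]
  refine (Tri.seq (T' := p.m ^ 6 * 71 + 6) (Q' := SquareInv p σ₀ k)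
    (f' := fun σ' => if Holds p C C σ' then 0 else 1)
    (f := fun σ' => if Within p W₀ e 0 σ' then 0 else 1)
    (Tri.seq (T' := (p.q + 1) * (roundTime p B TP + 1) + 10)
      (Q' := RoundInv p (execAll [.op .sub 20 20 8] σ) W₀ 0)
      (f' := fun σ' => if Within p W₀ e 0 σ' then 0 else 1)
      (f := fun _ => (if Holds p U V σ then 0 else 1) + (p.q + 1 : ℕ) * mainError p)
      ((det_code hw hL (l := [.op .sub 20 20 8]) (by simp)
        (by simp [SafeAll, IntInstr.Safe, IntOp.Safe])).tri fun _ _ => le_rfl) ?_) ?_).mono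
      (by simp [squareTime]; omega) le_rfl (fun _ h => h) fun _ _ => le_rfl
  · rintro _ rfl
    refine (tri_rounds (e := e) hw hL ok hB hPB hP htop hE h.stores h.tri h.a4
      fun i j hi hiN hj hjN => ?_).mono le_rfl ?_ (fun _ h => h) fun _ _ => le_rfl
    · have := hC.bound i j hi hiN hj hjN
      rw [he]
      simp only
      cases h3 : C i j with
      | top => simp; omega
      | coe z =>
        have := abs_lt.1 (this z h3)
        simp
        omega
    · have := isThreshold_of_isProduct (σ := σ) hC
      have h0 : (0 : ℝ) ≤ (p.q + 1 : ℕ) * mainError p := by unfold mainError; positivity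
      split_ifs <;> first | linarith | tauto
  · intro σ₁ h₁
    have hb : ∀ i j (z : ℤ), capMat p (σ₁.arr 4) i j = z → |z| ≤ p.top := by
      intro i j z hz
      rw [capMat] at hz
      split_ifs at hz with hc
      · rw [← WithTop.coe_injective hz]
        have := h₁.lower i j hc.1.1 hc.1.2 hc.2.1.1 hc.2.1.2
        rw [abs_le]
        omega
      · exact absurd hz.symm WithTop.coe_ne_top
    refine ((det_fill hw hL ok h₁.env h₁.stores h₁.tri (computes_cap ok h₁) hb hb).tri ?_).mono
      (by simp [capPre]) le_rfl ?_ fun _ _ => le_rfl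
    · rintro σ' ⟨hF, W', hS, hT, h'⟩
      have : Within p W₀ e 0 σ₁ → Holds p C C σ' := by
        intro hwi i j hi hiN hj hjN
        obtain ⟨g1, g2, -⟩ := h' i j hi hiN hj hjN
        rw [hS.mat_eq hT.mem_range, g1, g2, capMat_eq hC hwi hi hiN hj hjN]
        exact ⟨rfl, rfl⟩
      split_ifs <;> first | (norm_num; done) | tauto
    · rintro σ' ⟨hF, W', hS, hT, h'⟩
      have hW : storedMat p.S σ'.arr = W' := hS.mat_eq hT.mem_range
      constructor
      case env => exact hF.env h₁.env
      case reg =>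
        intro r h1 h2 h3 h4
        rw [hF.reg r (by omega) (by omega), h₁.reg r h1 h2 h3 (by omega) (by omega) (by omega)
          (by omega), hr r (by omega), h.reg r h1 h2 h3 h4]
      case r20 =>
        rw [hF.reg 20 (by omega) (by omega), h₁.reg 20 (by omega) (by omega) (by omega) (by omega)
          (by omega) (by omega) (by omega), h20]
      case tab => rw [hF.tab, h₁.tab, ← h.tab]; rfl
      case a4 => exact fun i j hi hiN hj hjN => (h' i j hi hiN hj hjN).2.2
      all_goals rw [hW]; assumption

/-- Repeated distance products; the number of repetitions is in register `20`. -/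
def squares (B : ℕ) (P : QProgram) : QProgram := .loop (B + 20) (squareBody B P)

-- Since the loop counts down, the state with `k` products to go is compared with the term of index
-- `n - k` of the ideal sequence `Z`.
open Classical in
theorem tri_squares (hw : 1 ≤ w) (hL : 2 * p.L = 2 ^ w) (ok : p.Ok) {P : QProgram} {c TP : ℕ}
    (hB : 1 ≤ B) (hPB : P.bound ≤ B)
    (hP : ∀ A : (minTriangle c).Inst (3 * p.m), ∃ t ≤ TP,
      P.HaltsWithin (3 * p.m) ((minTriangle c).input w A) t ∧
      2 / 3 ≤ P.successProb (3 * p.m) ((minTriangle c).input w A) t ((minTriangle c).correct A))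
    (htop : p.top ≤ (3 * p.m) ^ c) {n : ℕ} (hn : n < 2 ^ w) (h : SquareInv p σ₀ n σ)
    {Z : ℕ → (ℤ → ℤ → WithTop ℤ) × (ℤ → ℤ → WithTop ℤ)} (hH : Holds p (Z 0).1 (Z 0).2 σ)
    (hZ : ∀ s < n, (Z (s + 1)).2 = (Z (s + 1)).1 ∧
      IsProduct p (Z s).1 (Z s).2 (Z (s + 1)).1) :
    Tri X B (squares B P) (n * (squareTime p B TP + 1) + 1) σ
      (n * ((p.q + 1 : ℕ) * mainError p)) (SquareInv p σ₀ 0)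
      (fun σ' => if Holds p (Z n).1 (Z n).2 σ' then 0 else 1) := by
  have key := Tri.loop (X := X) (B := B) (p := squareBody B P) (T := squareTime p B TP) (x := 20)
    (SquareInv p σ₀) (fun k σ' => (if Holds p (Z (n - k)).1 (Z (n - k)).2 σ' then 0 else 1) +
      k * ((p.q + 1 : ℕ) * mainError p)) (fun _ _ h => h.r20) hn (fun k hk σ' hσ' => ?_) h
  · refine key.mono le_rfl ?_ (fun _ h => h) fun σ' _ => ?_
    · rw [Nat.sub_self, if_pos hH, zero_add]
    · simp
  · obtain ⟨h1, h2⟩ := hZ (n - (k + 1)) (by omega)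
    rw [show n - (k + 1) + 1 = n - k by omega] at h1 h2
    have := (tri_squareBody (X := X) hw hL ok hB hPB hP htop hσ' h2).add_const hw
      (k * ((p.q + 1 : ℕ) * mainError p))
    refine this.mono le_rfl ?_ (fun _ h => h) fun σ'' _ => ?_
    · push_cast; linarith
    · rw [h1]

end

/-! ## Distance products and shortest paths -/

namespace WMatrix

variable {n : ℕ}

/-- Extend a matrix by `∞`. -/
def pad (A : WMatrix n) (i j : ℤ) : WithTop ℤ :=
  if h : (0 ≤ i ∧ i < n) ∧ 0 ≤ j ∧ j < n then A ⟨i.toNat, by omega⟩ ⟨j.toNat, by omega⟩ else ⊤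

theorem pad_natCast (A : WMatrix n) (i j : Fin n) : A.pad (i : ℕ) (j : ℕ) = A i j := by
  rw [pad, dif_pos (by omega)]
  rfl

theorem pad_of_not (A : WMatrix n) {i j : ℤ} (h : ¬((0 ≤ i ∧ i < n) ∧ 0 ≤ j ∧ j < n)) :
    A.pad i j = ⊤ := dif_neg h

theorem distProd_lt_iff (A B : WMatrix n) (i j : Fin n) (θ : ℤ) :
    A.distProd B i j < θ ↔ ∃ k, A i k + B k j < θ := by
  simp [distProd, Finset.inf_lt_iff]

theorem exists_distProd_eq (A B : WMatrix n) (i j : Fin n) :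
    ∃ k, A.distProd B i j = A i k + B k j := by
  obtain ⟨k, -, hk⟩ := Finset.exists_mem_eq_inf Finset.univ ⟨i, Finset.mem_univ i⟩
    fun k => A i k + B k j
  exact ⟨k, hk⟩

theorem distProd_le (A B : WMatrix n) (i j k : Fin n) : A.distProd B i j ≤ A i k + B k j :=
  Finset.inf_le (f := fun k => A i k + B k j) (Finset.mem_univ k)

theorem abs_le_of_distProd_eq {A B : WMatrix n} {h : ℤ}
    (hA : ∀ (i j : Fin n) (z : ℤ), A i j = (z : WithTop ℤ) → |z| ≤ h)
    (hB : ∀ (i j : Fin n) (z : ℤ), B i j = (z : WithTop ℤ) → |z| ≤ h) (i j : Fin n) (z : ℤ)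
    (hz : A.distProd B i j = (z : WithTop ℤ)) : |z| ≤ 2 * h := by
  obtain ⟨k, hk⟩ := exists_distProd_eq A B i j
  rw [hz] at hk
  cases h1 : A i k with
  | top => simp [h1] at hk
  | coe a =>
    cases h2 : B k j with
    | top => simp [h2] at hk
    | coe b =>
      rw [h1, h2] at hk
      have hk' : z = a + b := by exact_mod_cast hk
      have := abs_le.1 (hA i k a h1)
      have := abs_le.1 (hB k j b h2)
      rw [abs_le]
      omega

/-- Middle indices in the padding contribute only `∞`, so the padded factors have the padded
product. -/
theorem isProduct_pad {p : Params} {A B : WMatrix n} (hn : (n : ℤ) ≤ p.N)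
    (hb : ∀ (i j : Fin n) (z : ℤ), A.distProd B i j = (z : WithTop ℤ) → |z| < p.top - 1) :
    IsProduct p A.pad B.pad (A.distProd B).pad where
  lt_iff i j hi _ hj _ θ := by
    by_cases hij : i < n ∧ j < n
    · lift i to ℕ using hi
      lift j to ℕ using hj
      have e1 := pad_natCast (A.distProd B) ⟨i, by omega⟩ ⟨j, by omega⟩
      simp only at e1
      rw [e1, distProd_lt_iff]
      constructor
      · rintro ⟨k, hk⟩
        refine ⟨(k : ℕ), by omega, by omega, ?_⟩
        rw [← pad_natCast A, ← pad_natCast B] at hk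
        exact hk
      · rintro ⟨l, hl, -, h⟩
        by_cases hln : l < n
        · lift l to ℕ using hl
          refine ⟨⟨l, by omega⟩, ?_⟩
          rw [← pad_natCast A, ← pad_natCast B]
          exact h
        · rw [pad_of_not A (by omega)] at h
          simp at h
    · rw [pad_of_not _ (by omega)]
      refine iff_of_false not_top_lt ?_
      rintro ⟨l, -, -, h⟩
      by_cases hin : i < n
      · rw [pad_of_not B (by omega)] at h
        simp at h
      · rw [pad_of_not A (by omega)] at h
        simp at h
  bound i j hi _ hj _ z hz := by
    by_cases hij : i < n ∧ j < n
    · rw [pad, dif_pos (by omega)] at hz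
      exact hb _ _ _ hz
    · rw [pad_of_not _ (by omega)] at hz
      exact absurd hz.symm WithTop.coe_ne_top

/-- The pairs of factors in a repeated distance product. -/
def factors (A B : WMatrix n) : ℕ → WMatrix n × WMatrix n
  | 0 => (A, B)
  | s + 1 => ((factors A B s).1.distProd (factors A B s).2, (factors A B s).1.distProd (factors A B s).2)

theorem abs_le_of_factors_eq {A B : WMatrix n} {h : ℤ}
    (hA : ∀ (i j : Fin n) (z : ℤ), A i j = (z : WithTop ℤ) → |z| ≤ h)
    (hB : ∀ (i j : Fin n) (z : ℤ), B i j = (z : WithTop ℤ) → |z| ≤ h) (s : ℕ) :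
    (∀ (i j : Fin n) (z : ℤ), (factors A B s).1 i j = (z : WithTop ℤ) → |z| ≤ 2 ^ s * h) ∧
    ∀ (i j : Fin n) (z : ℤ), (factors A B s).2 i j = (z : WithTop ℤ) → |z| ≤ 2 ^ s * h := by
  induction s with
  | zero => simpa [factors] using ⟨hA, hB⟩
  | succ s ih =>
    have := abs_le_of_distProd_eq ih.1 ih.2
    rw [show (2 : ℤ) ^ (s + 1) * h = 2 * (2 ^ s * h) by ring]
    exact ⟨this, this⟩

/-! ### Walks, and shortest paths by repeated squaring -/

/-- Replace the diagonal by `0`. -/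
def zeroDiag (A : WMatrix n) : WMatrix n := Matrix.of fun i j => if i = j then 0 else A i j

theorem walkWeight_append (A : WMatrix n) (i : Fin n) (l l' : List (Fin n)) :
    A.walkWeight i (l ++ l') =
      A.walkWeight i l + A.walkWeight ((i :: l).getLast (List.cons_ne_nil i l)) l' := by
  induction l generalizing i with
  | nil => simp [walkWeight]
  | cons j l ih => simp [walkWeight, ih, add_assoc]

theorem getLast_cons_append (i : Fin n) (l l' : List (Fin n)) :
    (i :: (l ++ l')).getLast (List.cons_ne_nil _ _) =
      ((i :: l).getLast (List.cons_ne_nil i l) :: l').getLast (List.cons_ne_nil _ _) := by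
  induction l generalizing i with
  | nil => simp
  | cons j l ih => simpa using ih j

theorem add_mem_walkWeights {A : WMatrix n} {i j k : Fin n} {x y : WithTop ℤ}
    (hx : x ∈ A.walkWeights i k) (hy : y ∈ A.walkWeights k j) : x + y ∈ A.walkWeights i j := by
  obtain ⟨l, h1, rfl⟩ := hx
  obtain ⟨l', h2, rfl⟩ := hy
  refine ⟨l ++ l', ?_, ?_⟩
  · simp only [getLast_cons_append, h1, h2]
  · rw [walkWeight_append, h1]

/-- Concatenation of walks. The alternative `⊤` only serves the induction, where an infinite summand
need not come from a walk; `isDistanceMatrix_factors` disposes of it. -/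
theorem factors_zeroDiag_mem (A : WMatrix n) (s : ℕ) (i j : Fin n) :
    ((factors A.zeroDiag A.zeroDiag s).1 i j = ⊤ ∨
      (factors A.zeroDiag A.zeroDiag s).1 i j ∈ A.walkWeights i j) ∧
    (factors A.zeroDiag A.zeroDiag s).2 = (factors A.zeroDiag A.zeroDiag s).1 := by
  induction s generalizing i j with
  | zero =>
    refine ⟨Or.inr ?_, rfl⟩
    by_cases hij : i = j
    · subst hij
      exact ⟨[], rfl, by simp [factors, zeroDiag, walkWeight]⟩
    · exact ⟨[j], rfl, by simp [factors, zeroDiag, walkWeight, hij]⟩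
  | succ s ih =>
    refine ⟨?_, rfl⟩
    obtain ⟨k, hk⟩ := exists_distProd_eq (factors A.zeroDiag A.zeroDiag s).1
      (factors A.zeroDiag A.zeroDiag s).2 i j
    change (distProd _ _ i j = ⊤ ∨ distProd _ _ i j ∈ _)
    rw [hk, (ih i j).2]
    rcases (ih i k).1 with h1 | h1
    · left; rw [h1, top_add]
    · rcases (ih k j).1 with h2 | h2
      · left; rw [h2, add_top]
      · exact Or.inr (add_mem_walkWeights h1 h2)

/-- A walk with at most `2 ^ (s + 1)` edges is split after its first `2 ^ s` edges; the zero
diagonal covers shorter walks. In the base case a loop is replaced by the empty walk, which is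
allowed since loops have nonnegative weight. -/
theorem factors_zeroDiag_le {A : WMatrix n} (hA : A.NoNegCycle) (s : ℕ) (i : Fin n)
    (l : List (Fin n)) (hl : l.length ≤ 2 ^ s) :
    (factors A.zeroDiag A.zeroDiag s).1 i ((i :: l).getLast (List.cons_ne_nil i l)) ≤
      A.walkWeight i l := by
  induction s generalizing i l with
  | zero =>
    match l, hl with
    | [], _ => simp [factors, zeroDiag, walkWeight]
    | [j], _ =>
      by_cases hij : i = j
      · subst hij
        simpa [factors, zeroDiag, walkWeight] using hA i (A i i) ⟨[i], rfl, by simp [walkWeight]⟩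
      · simp [factors, zeroDiag, walkWeight, hij]
  | succ s ih =>
    rw [factors, (factors_zeroDiag_mem A s i i).2]
    have h1 := ih i (l.take (2 ^ s)) (List.length_take_le _ _)
    have h2 := ih ((i :: l.take (2 ^ s)).getLast (List.cons_ne_nil _ _)) (l.drop (2 ^ s))
      (by rw [List.length_drop, pow_succ] at *; omega)
    have h3 := add_le_add h1 h2
    rw [← walkWeight_append, List.take_append_drop] at h3
    have h4 := getLast_cons_append i (l.take (2 ^ s)) (l.drop (2 ^ s))
    simp only [List.take_append_drop] at h4
    rw [← h4] at h3
    exact (distProd_le _ _ _ _ _).trans h3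

/-- Loop erasure from the end: the rest of the walk is made simple first, and if the new first
vertex occurs in it, the closed walk up to that occurrence is cut off. -/
theorem exists_nodup_walk {A : WMatrix n} (hA : A.NoNegCycle) (i : Fin n) (l : List (Fin n)) :
    ∃ l' : List (Fin n), (i :: l').getLast (List.cons_ne_nil _ _) =
      (i :: l).getLast (List.cons_ne_nil _ _) ∧ A.walkWeight i l' ≤ A.walkWeight i l ∧
      (i :: l').Nodup := by
  induction l generalizing i with
  | nil => exact ⟨[], rfl, le_rfl, List.nodup_singleton i⟩
  | cons j l ih =>
    obtain ⟨t, h1, h2, h3⟩ := ih j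
    have h4 : A.walkWeight i (j :: t) ≤ A.walkWeight i (j :: l) := by
      simp only [walkWeight]
      exact add_le_add le_rfl h2
    by_cases hi : i ∈ j :: t
    · obtain ⟨a, b, hab⟩ := List.append_of_mem hi
      rw [hab] at h3 h4
      rw [show a ++ i :: b = (a ++ [i]) ++ b by simp, walkWeight_append] at h4
      have h5 : (i :: (a ++ [i])).getLast (List.cons_ne_nil _ _) = i := by
        rw [getLast_cons_append]; simp
      have h6 : 0 ≤ A.walkWeight i (a ++ [i]) := hA i _ ⟨_, h5, rfl⟩
      rw [h5] at h4
      refine ⟨b, ?_, (le_add_of_nonneg_left h6).trans h4,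
        h3.sublist (List.sublist_append_right a (i :: b))⟩
      rw [List.getLast_cons_cons, ← h1]
      simp only [hab]
      rw [List.getLast_append_of_ne_nil _ (List.cons_ne_nil _ _)]
    · exact ⟨j :: t, by simpa using h1, h4, List.nodup_cons.2 ⟨hi, h3⟩⟩

theorem isDistanceMatrix_factors {A : WMatrix n} (hA : A.NoNegCycle) {s : ℕ} (hs : n ≤ 2 ^ s) :
    A.IsDistanceMatrix (factors A.zeroDiag A.zeroDiag s).1 := by
  intro i j
  have hle : ∀ x ∈ A.walkWeights i j, (factors A.zeroDiag A.zeroDiag s).1 i j ≤ x := by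
    rintro x ⟨l, h1, rfl⟩
    obtain ⟨l', h2, h3, h4⟩ := exists_nodup_walk hA i l
    have h5 := h4.length_le_card
    rw [Fintype.card_fin, List.length_cons] at h5
    have h6 := factors_zeroDiag_le hA s i l' (by omega)
    rw [h2, h1] at h6
    exact h6.trans h3
  refine ⟨?_, hle⟩
  rcases (factors_zeroDiag_mem A s i j).1 with h | h
  · have h1 : A i j ∈ A.walkWeights i j := ⟨[j], rfl, by simp [walkWeight]⟩
    have h2 := hle _ h1
    rw [h, top_le_iff] at h2
    rw [h, ← h2]
    exact h1
  · exact h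

end WMatrix

/-! ## Computation of the parameters -/

/-- One step towards the least `m ≥ 1` with `n ≤ m ^ 3`. -/
def cubeStep (n m : ℕ) : ℕ := if m ^ 3 < n then m + 1 else m

/-- One step towards the number of binary digits of `n`. -/
def bitStep (n l : ℕ) : ℕ := if n < 2 ^ l then l else l + 1

/-- The least `m ≥ 1` with `n ≤ m ^ 3`. -/
def cubeRoot (n : ℕ) : ℕ := (cubeStep n)^[n] 1

/-- The number of binary digits of `n`. -/
def bits (n : ℕ) : ℕ := (bitStep n)^[n] 0

/-- The first half shows that `n` steps reach the goal. The second half says that no intermediate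
value overshoots, which bounds the result and excludes overflow during the computation. -/
theorem cubeStep_iterate (n i : ℕ) : (n ≤ ((cubeStep n)^[i] 1) ^ 3 ∨ (cubeStep n)^[i] 1 = i + 1) ∧
    ((cubeStep n)^[i] 1 = 1 ∨ 2 ≤ (cubeStep n)^[i] 1 ∧ ((cubeStep n)^[i] 1 - 1) ^ 3 < n) := by
  induction i with
  | zero => simp
  | succ i ih =>
    rw [Function.iterate_succ_apply']
    set m := (cubeStep n)^[i] 1
    rw [cubeStep]
    split_ifs with h
    · refine ⟨Or.inr ?_, Or.inr ⟨by omega, by simpa using h⟩⟩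
      omega
    · exact ⟨Or.inl (not_lt.1 h), ih.2⟩

theorem bitStep_iterate (n i : ℕ) : (n < 2 ^ ((bitStep n)^[i] 0) ∨ (bitStep n)^[i] 0 = i) ∧
    ((bitStep n)^[i] 0 = 0 ∨ 2 ^ ((bitStep n)^[i] 0) ≤ 2 * n) := by
  induction i with
  | zero => simp
  | succ i ih =>
    rw [Function.iterate_succ_apply']
    set m := (bitStep n)^[i] 0
    rw [bitStep]
    split_ifs with h
    · exact ⟨Or.inl h, ih.2⟩
    · refine ⟨Or.inr ?_, Or.inr ?_⟩
      · omega
      · rw [pow_succ]; omega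

theorem cubeStep_iterate_pow_le {n : ℕ} (hn : 1 ≤ n) (i : ℕ) :
    ((cubeStep n)^[i] 1) ^ 3 ≤ 8 * n := by
  rcases (cubeStep_iterate n i).2 with h | ⟨h1, h2⟩
  · rw [h]; omega
  · obtain ⟨k, hk⟩ := Nat.exists_eq_add_of_le' (show 1 ≤ (cubeStep n)^[i] 1 by omega)
    rw [hk, Nat.add_sub_cancel] at h2
    rw [hk] at h1 ⊢
    calc (k + 1) ^ 3 ≤ (2 * k) ^ 3 := Nat.pow_le_pow_left (by omega) 3
      _ = 8 * k ^ 3 := by ring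
      _ ≤ 8 * n := by omega

theorem le_cubeRoot_pow (n : ℕ) : n ≤ cubeRoot n ^ 3 := by
  rcases (cubeStep_iterate n n).1 with h | h
  · exact h
  · rw [cubeRoot, h]
    calc n ≤ n + 1 := by omega
      _ ≤ (n + 1) ^ 3 := Nat.le_self_pow (by norm_num) _

theorem cubeRoot_pow_le {n : ℕ} (hn : 1 ≤ n) : cubeRoot n ^ 3 ≤ 8 * n :=
  cubeStep_iterate_pow_le hn n

theorem lt_two_pow_bits (n : ℕ) : n < 2 ^ bits n := by
  rcases (bitStep_iterate n n).1 with h | h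
  · exact h
  · rw [bits, h]; exact Nat.lt_two_pow_self

theorem two_pow_bitStep_le {n : ℕ} (hn : 1 ≤ n) (i : ℕ) : 2 ^ ((bitStep n)^[i] 0) ≤ 2 * n := by
  rcases (bitStep_iterate n i).2 with h | h
  · rw [h]; omega
  · exact h

theorem two_pow_bits_le {n : ℕ} (hn : 1 ≤ n) : 2 ^ bits n ≤ 2 * n := two_pow_bitStep_le hn n

theorem bits_pos {n : ℕ} (hn : 1 ≤ n) : 1 ≤ bits n := by
  by_contra h
  have := lt_two_pow_bits n
  rw [show bits n = 0 by omega] at this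
  omega

/-- The parameters for matrices with `n` rows, exponent `c` and word length `w`. -/
def params (c K n w : ℕ) : Params :=
  ⟨n, cubeRoot n, K * bits n, (c + 1) * bits n + 2, 2 ^ (w - 1)⟩

/-- Initialise the registers. -/
def initCode : List IntInstr :=
  [.const 8 1, .const 9 2, .const 10 3, .const 3 1, .const 26 1, .const 27 0, .const 23 0,
    .op .add 23 23 2]

/-- One step of the computation of the cube root and of the number of digits. -/
def sizeBody : List IntInstr :=
  [.op .sub 23 23 8, .op .mul 33 3 3, .op .mul 33 33 3, .op .lt 33 33 2, .op .add 3 3 33,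
    .op .lt 34 2 26, .op .sub 34 8 34, .op .add 27 27 34, .op .mul 34 34 26, .op .add 26 26 34]

/-- Compute the parameters. -/
def paramCode (c K : ℕ) : List IntInstr :=
  [.op .mul 4 3 3, .op .mul 4 4 3, .op .mul 5 4 10, .op .add 5 5 8, .op .mul 6 3 3,
    .op .mul 7 3 10, .op .mul 11 4 9, .op .mul 16 4 4, .const 28 K, .op .mul 14 28 27,
    .op .mul 15 16 9, .op .mul 15 15 14, .const 28 (c + 1), .op .mul 25 28 27,
    .const 28 3, .op .add 25 25 28, .const 13 4] ++ List.replicate (c + 1) (.op .mul 13 13 26)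

/-- Compute all parameters. -/
def prelude (B c K : ℕ) : QProgram :=
  .seq (code B initCode) (.seq (.loop (B + 23) (code B sizeBody)) (code B (paramCode c K)))

section

variable {w : ℕ} {X : WordInput w} {B c K n : ℕ} {σ : IState}

theorem execAll_replicate_mul {L : ℤ} (x y j : ℕ) (hxy : y ≠ x) (σ : IState) :
    SafeAll L (List.replicate j (.op .mul x x y)) σ ∧
    (execAll (List.replicate j (.op .mul x x y)) σ).reg x = σ.reg x * σ.reg y ^ j ∧
    (∀ r ≠ x, (execAll (List.replicate j (.op .mul x x y)) σ).reg r = σ.reg r) ∧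
    (execAll (List.replicate j (.op .mul x x y)) σ).arr = σ.arr ∧
    (execAll (List.replicate j (.op .mul x x y)) σ).tab = σ.tab := by
  induction j generalizing σ with
  | zero => simp [SafeAll, execAll]
  | succ j ih =>
    obtain ⟨h1, h2, h3, h4, h5⟩ := ih (σ.setReg x (σ.reg x * σ.reg y))
    rw [List.replicate_succ]
    refine ⟨⟨trivial, h1⟩, ?_, fun r hr => ?_, h4, h5⟩
    · refine h2.trans ?_
      rw [IState.setReg_reg, IState.setReg_reg, if_pos rfl, if_neg hxy, pow_succ]
      ring
    · refine (h3 r hr).trans ?_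
      rw [IState.setReg_reg, if_neg hr]

/-- The cube root and the number of digits are found by naive counting in `n` steps, which is
negligible here. Register `26` holds `2 ^ bits n` up to the end of the counting, so `top` is
obtained as `4 * (2 ^ bits n) ^ (c + 1)`. -/
theorem det_prelude (hw : 1 ≤ w) (hn : 1 ≤ n) (hnw : 8 * (n : ℤ) < 2 ^ (w - 1)) (h2 : σ.reg 2 = n)
    (ha : ∀ z, σ.arr 2 z = 0 ∧ σ.arr 3 z = 0) :
    Det X B (prelude B c K) (n * 21 + 2 * c + 60) σ fun σ' => Env (params c K n w) σ' ∧
      σ'.reg 27 = bits n ∧ σ'.arr = σ.arr ∧ σ'.tab = σ.tab := by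
  have hL : 2 * (2 : ℤ) ^ (w - 1) = 2 ^ w := by
    rw [mul_comm, ← pow_succ]; congr 1; omega
  set L : ℤ := 2 ^ (w - 1) with hLdef
  set inv : ℕ → IState → Prop := fun k σ' => (σ'.reg 23 = k ∧ k ≤ n) ∧ σ'.reg 2 = n ∧
    σ'.reg 8 = 1 ∧ σ'.reg 9 = 2 ∧ σ'.reg 10 = 3 ∧ σ'.reg 3 = ((cubeStep n)^[n - k] 1 : ℕ) ∧
    σ'.reg 27 = ((bitStep n)^[n - k] 0 : ℕ) ∧ σ'.reg 26 = 2 ^ ((bitStep n)^[n - k] 0) ∧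
    σ'.arr = σ.arr ∧ σ'.tab = σ.tab with hinv
  have hbody : ∀ k < n, ∀ σ', inv (k + 1) σ' → Det X B (code B sizeBody) 20 σ' (inv k) := by
    rintro k hk σ' ⟨⟨g23, -⟩, g2, g8, g9, g10, g3, g27, g26, ga, gt⟩
    have b1 := cubeStep_iterate_pow_le hn (n - (k + 1))
    have b2 := two_pow_bitStep_le hn (n - (k + 1))
    have i1 : (cubeStep n)^[n - k] 1 = cubeStep n ((cubeStep n)^[n - (k + 1)] 1) := by
      rw [← Function.iterate_succ_apply' (cubeStep n)]; congr 1; omega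
    have i2 : (bitStep n)^[n - k] 0 = bitStep n ((bitStep n)^[n - (k + 1)] 0) := by
      rw [← Function.iterate_succ_apply' (bitStep n)]; congr 1; omega
    set μ := (cubeStep n)^[n - (k + 1)] 1 with hμ
    set ν := (bitStep n)^[n - (k + 1)] 0 with hν
    have b1' : (μ : ℤ) * μ * μ ≤ 8 * n := by
      have : ((μ ^ 3 : ℕ) : ℤ) ≤ ((8 * n : ℕ) : ℤ) := by exact_mod_cast b1
      push_cast at this
      rw [show (μ : ℤ) * μ * μ = μ ^ 3 by ring]
      exact this
    have b2' : (2 : ℤ) ^ ν ≤ 2 * n := by exact_mod_cast b2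
    have b1'' : (0 : ℤ) ≤ (μ : ℤ) * μ * μ := by positivity
    have b2'' : (0 : ℤ) ≤ 2 ^ ν := by positivity
    refine (det_code hw hL (by simp [sizeBody]) ?_).mono (by simp [sizeBody]) ?_
    · simp only [sizeBody, SafeAll, IntInstr.Safe, IntOp.Safe, IntOp.eval, IntInstr.exec,
        IState.setReg_reg, g2, g3, g26, Nat.reduceEqDiff, if_true, if_false, true_and, and_true]
      omega
    · rintro _ rfl
      push_cast at g23
      refine ⟨⟨?_, by omega⟩, ?_, ?_, ?_, ?_, ?_, ?_, ?_, ga, gt⟩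
      all_goals simp only [sizeBody, execAll, IntInstr.exec, IState.setReg_reg, IntOp.eval, g23, g2,
        g8, g9, g10, g3, g27, g26, Nat.reduceEqDiff, if_true, if_false, add_sub_cancel_right]
      · have : (μ : ℤ) * μ * μ < n ↔ μ ^ 3 < n := by
          rw [show (μ : ℤ) * μ * μ = ((μ ^ 3 : ℕ) : ℤ) by push_cast; ring]
          exact Nat.cast_lt
        rw [i1, cubeStep]
        split_ifs <;> first | rfl | tauto
      · have : (n : ℤ) < 2 ^ ν ↔ n < 2 ^ ν := by exact_mod_cast Iff.rfl
        rw [i2, bitStep, if_congr this rfl rfl]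
        split_ifs <;> simp
      · have : (n : ℤ) < 2 ^ ν ↔ n < 2 ^ ν := by exact_mod_cast Iff.rfl
        rw [i2, bitStep, if_congr this rfl rfl]
        split_ifs
        · simp
        · rw [pow_succ]; ring
  have hr : ∀ σ', SafeAll L (paramCode c K) σ' := fun σ' => by
    rw [paramCode, safeAll_append]
    exact ⟨by simp [SafeAll, IntInstr.Safe, IntOp.Safe],
      (execAll_replicate_mul 13 26 (c + 1) (by omega) _).1⟩
  refine ((det_code hw hL (l := initCode) (by simp [initCode])
    (by simp [initCode, SafeAll, IntInstr.Safe, IntOp.Safe])).seq (T' := n * 21 + 2 * c + 40)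
    (Q' := fun σ' => Env (params c K n w) σ' ∧ σ'.reg 27 = bits n ∧ σ'.arr = σ.arr ∧
      σ'.tab = σ.tab) ?_).mono (by simp [initCode]; omega) fun _ h => h
  rintro _ rfl
  have hn2 : n < 2 ^ w := by
    have : (n : ℤ) < 2 ^ w := by omega
    exact_mod_cast this
  refine ((Det.loop inv (fun _ _ h => h.1.1) hn2 hbody ?_).seq (T' := 2 * (paramCode c K).length)
    (fun σ' h => (det_code hw hL (by simp [paramCode]) (hr σ')).mono le_rfl ?_)).mono
      (by simp [paramCode]; omega) fun _ h => h
  · refine ⟨⟨?_, le_rfl⟩, ?_, ?_, ?_, ?_, ?_, ?_, ?_, rfl, rfl⟩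
    all_goals simp [initCode, execAll, IntInstr.exec, IState.setReg_reg, IntOp.eval, h2]
  · obtain ⟨-, g2, g8, g9, g10, g3, g27, g26, ga, gt⟩ := h
    rintro _ rfl
    rw [Nat.sub_zero] at g3 g27 g26
    change σ'.reg 3 = (cubeRoot n : ℕ) at g3
    change σ'.reg 27 = (bits n : ℕ) at g27
    change σ'.reg 26 = 2 ^ bits n at g26
    rw [paramCode, execAll_append]
    obtain ⟨-, q2, q3, q4, q5⟩ := execAll_replicate_mul (L := L) 13 26 (c + 1) (by omega)
      (execAll [.op .mul 4 3 3, .op .mul 4 4 3, .op .mul 5 4 10, .op .add 5 5 8, .op .mul 6 3 3,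
    .op .mul 7 3 10, .op .mul 11 4 9, .op .mul 16 4 4, .const 28 K, .op .mul 14 28 27,
    .op .mul 15 16 9, .op .mul 15 15 14, .const 28 (c + 1), .op .mul 25 28 27,
    .const 28 3, .op .add 25 25 28, .const 13 4] σ')
    refine ⟨?_, ?_, q4.trans ga, q5.trans gt⟩
    · constructor
      case r13 =>
        rw [q2]
        simp only [execAll, IntInstr.exec, IState.setReg_reg, IntOp.eval, g26, Nat.reduceEqDiff,
          if_true, if_false]
        simp only [params, Params.top]
        rw [← pow_mul, pow_add, mul_comm (bits n)]
        push_cast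
        ring
      case a2 => intro z _; rw [q4]; exact (congrFun (congrFun ga 2) z).trans (ha z).1
      case a3 => intro z _; rw [q4]; exact (congrFun (congrFun ga 3) z).trans (ha z).2
      all_goals
        rw [q3 _ (by omega)]
        simp only [execAll, IntInstr.exec, IState.setReg_reg, IntOp.eval, g2, g3, g8, g9, g10, g27,
          Nat.reduceEqDiff, if_true, if_false, params, Params.N, Params.S, Params.t, Params.calls]
        try push_cast
        try ring
    · rw [q3 _ (by omega)]
      simp only [execAll, IntInstr.exec, IState.setReg_reg, IntOp.eval, g27, Nat.reduceEqDiff,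
        if_true, if_false]

end

/-! ## Input and output -/

/-- Read the entries of two matrices. -/
def productPre : List IntInstr :=
  [.query 0 41 33 34, .query 1 42 33 34, .query 2 45 33 34, .query 3 46 33 34]

/-- Read the entries of a matrix, whose diagonal is replaced by `0`, twice. -/
def pathsPre : List IntInstr :=
  [.op .eq 39 33 34, .op .lt 40 33 2, .op .mul 39 39 40, .query 0 41 33 34, .query 1 42 33 34,
    .op .sub 40 8 39, .op .mul 41 41 40, .op .add 41 41 39, .op .mul 42 42 40, .const 45 0,
    .op .add 45 45 41, .const 46 0, .op .add 46 46 42]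

/-- Compute the parameters, store the input, and put the number of products into register `20`. -/
def startProgram (B c K : ℕ) (pre cnt : List IntInstr) : QProgram :=
  .seq (prelude B c K) (.seq (sweep B (fillBody pre)) (code B cnt))

/-- Write one entry of the result to the arrays `0` and `1`. -/
def outputBody (B : ℕ) : List IntInstr :=
  [.op .sub (B + 17) (B + 17) (B + 8), .op .div (B + 33) (B + 17) (B + 2),
    .op .mod (B + 34) (B + 17) (B + 2), .op .add (B + 35) (B + 33) (B + 8),
    .op .mul (B + 36) (B + 35) (B + 5), .op .add (B + 36) (B + 36) (B + 34),
    .op .add (B + 36) (B + 36) (B + 11), .op .add (B + 36) (B + 36) (B + 8),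
    .load (B + 37) B (B + 36), .load (B + 38) (B + 1) (B + 36),
    .store 0 (B + 17) (B + 37), .store 1 (B + 17) (B + 38)]

/-- Write the result to the arrays `0` and `1`. -/
def outputProgram (B : ℕ) : QProgram :=
  .seq (code 0 [.op .mul (B + 17) (B + 2) (B + 2)]) (.loop (B + 17) (code 0 (outputBody B)))

section

variable {w : ℕ} {X : WordInput w} {B c K n : ℕ} {p : Params} {σ : IState}

theorem Params.Ok.N_lt (ok : p.Ok) : p.N < p.L := by
  have := ok.S_le
  have := ok.N_pos
  rw [Params.S] at *
  omega

theorem computes_productPre (ok : p.Ok) {U V : ℤ → ℤ → WithTop ℤ}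
    (h0 : ∀ i j, σ.tab 0 i j = finFlag (U i j)) (h1 : ∀ i j, σ.tab 1 i j = finValue (U i j))
    (h2 : ∀ i j, σ.tab 2 i j = finFlag (V i j)) (h3 : ∀ i j, σ.tab 3 i j = finValue (V i j)) :
    Computes p σ productPre U V := by
  intro i j hi hiN hj hjN σ' hF hC _
  have := ok.N_lt
  refine ⟨?_, fun r hr => reg_execAll_of_notMem (by simp [productPre, IntInstr.dest]; omega) _, rfl,
    rfl, ?_, ?_, ?_, ?_⟩
  · simp only [productPre, SafeAll, IntInstr.Safe, IntInstr.exec, IState.setReg_reg, hC.r33, hC.r34,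
      Nat.reduceEqDiff, if_false, and_true]
    omega
  all_goals simp only [productPre, execAll, IntInstr.exec, IState.setReg_reg, IState.setReg_tab,
    hC.r33, hC.r34, hF.tab, h0, h1, h2, h3, Nat.reduceEqDiff, if_true, if_false]

/-- The diagonal is set to `0` only at indices below `n`, as the padding must stay infinite. This is
done with the indicator `d` of the diagonal: the flag `f` becomes `f * (1 - d) + d`, and the value
is multiplied by `1 - d`. -/
theorem computes_pathsPre (ok : p.Ok) (hE : Env p σ) {A : WMatrix p.n}
    (h0 : ∀ i j, σ.tab 0 i j = finFlag (A.pad i j))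
    (h1 : ∀ i j, σ.tab 1 i j = finValue (A.pad i j)) :
    Computes p σ pathsPre A.zeroDiag.pad A.zeroDiag.pad := by
  intro i j hi hiN hj hjN σ' hF hC _
  have hNL := ok.N_lt
  have hn : (p.n : ℤ) ≤ p.N := by have := ok.n_le; rw [Params.N]; exact_mod_cast this
  have hE' := hF.env hE
  have hd : A.zeroDiag.pad i j = if i = j ∧ i < p.n then 0 else A.pad i j := by
    by_cases hij : i < p.n ∧ j < p.n
    · rw [WMatrix.pad, dif_pos (by omega), WMatrix.pad, dif_pos (by omega), WMatrix.zeroDiag,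
        Matrix.of_apply]
      exact if_congr (by rw [Fin.mk.injEq]; omega) rfl rfl
    · rw [WMatrix.pad_of_not _ (by omega), if_neg (by omega), WMatrix.pad_of_not _ (by omega)]
  have he : ((if i = j then 1 else 0 : ℤ) * if i < p.n then 1 else 0) =
      if i = j ∧ i < p.n then 1 else 0 := by
    rw [ite_and]
    split_ifs <;> simp
  have f0 : finFlag 0 = 1 := rfl
  have v0 : finValue 0 = 0 := rfl
  refine ⟨?_, fun r hr => reg_execAll_of_notMem (by simp [pathsPre, IntInstr.dest]; omega) _, rfl,
    rfl, ?_, ?_, ?_, ?_⟩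
  · simp only [pathsPre, SafeAll, IntInstr.Safe, IntOp.Safe, IntInstr.exec, IState.setReg_reg,
      hC.r33, hC.r34, hE'.r2, Nat.reduceEqDiff, if_false, and_true, true_and]
    omega
  all_goals
    simp only [pathsPre, execAll, IntInstr.exec, IState.setReg_reg, IState.setReg_tab, IntOp.eval,
      hC.r33, hC.r34, hE'.r2, hE'.r8, hF.tab, h0, h1, Nat.reduceEqDiff, if_true, if_false, hd, he]
    split_ifs <;> simp [f0, v0]

/-- Memory full of zeros already represents the matrix whose entries are all `∞`, so `det_fill`
applies without further initialisation. -/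
theorem det_start (hw : 1 ≤ w) (hn : 1 ≤ n) (hnw : 8 * (n : ℤ) < 2 ^ (w - 1))
    (ok : (params c K n w).Ok) (h2 : σ.reg 2 = n) (ha : ∀ a z, σ.arr a z = 0)
    {pre cnt : List IntInstr} {R : ℕ} {U V : ℤ → ℤ → WithTop ℤ}
    (hpre : ∀ σ', Env (params c K n w) σ' → σ'.tab = σ.tab → Computes (params c K n w) σ' pre U V)
    (hU : ∀ i j (z : ℤ), U i j = z → |z| ≤ (params c K n w).top)
    (hV : ∀ i j (z : ℤ), V i j = z → |z| ≤ (params c K n w).top)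
    (hcnt : ∀ σ' : IState, σ'.reg 27 = bits n → cnt ≠ [] ∧ SafeAll (params c K n w).L cnt σ' ∧
      execAll cnt σ' = σ'.setReg 20 R) :
    Det X B (startProgram B c K pre cnt)
      (n * 21 + 2 * c + 70 + cubeRoot n ^ 6 * (2 * pre.length + 59) + 2 * cnt.length) σ
      fun σ' => SquareInv (params c K n w) σ' R σ' ∧ Holds (params c K n w) U V σ' := by
  have hL : 2 * (params c K n w).L = 2 ^ w := by
    change 2 * (2 : ℤ) ^ (w - 1) = 2 ^ w
    rw [mul_comm, ← pow_succ]; congr 1; omega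
  have htop := Params.Ok.top_pos (p := params c K n w)
  refine ((det_prelude hw hn hnw h2 fun z => ⟨ha 2 z, ha 3 z⟩).seq
    (T' := cubeRoot n ^ 6 * (2 * pre.length + 59) + 6 + 2 * cnt.length + 1)
    (Q' := fun σ' => SquareInv (params c K n w) σ' R σ' ∧ Holds (params c K n w) U V σ')
    ?_).mono (by omega) fun _ h => h
  rintro σ₁ ⟨hE₁, h27, harr, htab⟩
  have hS₁ : Stores (params c K n w).S σ₁.arr fun _ _ => ⊤ := fun x y _ _ _ _ => by
    rw [harr]; exact ⟨ha _ _, ha _ _⟩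
  have hT₁ : Tripartite (params c K n w).N (params c K n w).top fun _ _ => ⊤ :=
    ⟨fun _ _ => rfl, fun _ _ h => absurd rfl h, fun _ _ z hz => absurd hz.symm WithTop.coe_ne_top⟩
  refine ((det_fill hw hL ok hE₁ hS₁ hT₁ (hpre σ₁ hE₁ htab) hU hV).seq
    (T' := 2 * cnt.length)
    (Q' := fun σ' => SquareInv (params c K n w) σ' R σ' ∧ Holds (params c K n w) U V σ')
    ?_).mono le_rfl fun _ h => h
  rintro σ₂ ⟨hF, W', hS, hT, hW⟩
  obtain ⟨g1, g2, g3⟩ := hcnt σ₂ ((hF.reg _ (by omega) (by omega)).trans h27)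
  refine (det_code hw hL g1 g2).mono le_rfl ?_
  rintro _ rfl
  rw [g3]
  have hmat : storedMat (params c K n w).S (σ₂.setReg 20 R).arr = W' := hS.mat_eq hT.mem_range
  refine ⟨?_, fun i j hi hiN hj hjN => ?_⟩
  · constructor
    case env =>
      refine (hF.env hE₁).congr (fun r _ _ _ h => ?_) (fun _ _ => rfl) fun _ _ => rfl
      rw [IState.setReg_reg, if_neg (by omega)]
    case reg => exact fun _ _ _ _ _ => rfl
    case r20 => rw [IState.setReg_reg, if_pos rfl]
    case tab => rfl
    case a4 => exact fun i j hi hiN hj hjN => (hW i j hi hiN hj hjN).2.2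
    all_goals rw [hmat]
    case stores => exact hS
    case tri => exact hT
  · rw [hmat]
    exact ⟨(hW i j hi hiN hj hjN).1, (hW i j hi hiN hj hjN).2.1⟩

/-- Include the registers and arrays with names below `B`. -/
def IState.unshift {w : ℕ} (σ : IState) (B : ℕ) (s : RamState w) : IState where
  reg x := if x < B then (s.reg x).toNat else σ.reg (x - B)
  arr a z := if a < B then (s.arr a (BitVec.ofInt w z)).toNat else σ.arr (a - B) z
  tab := σ.tab

theorem Represents.unshift {s : RamState w} (h : Represents X B σ s) :
    Represents X 0 (σ.unshift B s) s where
  reg x := by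
    rw [zero_add]
    simp only [IState.unshift]
    split_ifs with hx
    · exact (BitVec.ofInt_toNat _).symm
    · rw [← h.reg, Nat.add_sub_cancel' (by omega)]
  arr a z h0 h1 := by
    rw [zero_add]
    simp only [IState.unshift]
    split_ifs with ha
    · exact (BitVec.ofInt_toNat _).symm
    · rw [← h.arr _ z h0 h1, Nat.add_sub_cancel' (by omega)]
  tab := h.tab

/-- The output belongs in the machine arrays `0` and `1`, below the shift `B`. Hence the whole
memory is described with shift `0`, and the outer names appear as `B + x`. The result is read
between the first and the third part, where the left factor is stored. -/
theorem det_output (hw : 1 ≤ w) (hL : 2 * p.L = 2 ^ w) (ok : p.Ok) (hB : 2 ≤ B)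
    {D : ℤ → ℤ → WithTop ℤ} (h2 : σ.reg (B + 2) = p.n) (h5 : σ.reg (B + 5) = p.S)
    (h8 : σ.reg (B + 8) = 1) (h11 : σ.reg (B + 11) = 2 * p.N)
    (hD : ∀ i j : ℤ, 0 ≤ i → i < p.n → 0 ≤ j → j < p.n →
      σ.arr B ((i + 1) * p.S + (j + 2 * p.N + 1)) = finFlag (D i j) ∧
      σ.arr (B + 1) ((i + 1) * p.S + (j + 2 * p.N + 1)) = finValue (D i j)) :
    Det X 0 (outputProgram B) (p.n * p.n * 25 + 4) σ fun σ' =>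
      ∀ i j : ℤ, 0 ≤ i → i < p.n → 0 ≤ j → j < p.n →
        σ'.arr 0 (i * p.n + j) = finFlag (D i j) ∧ σ'.arr 1 (i * p.n + j) = finValue (D i j) := by
  have hN := ok.N_pos
  have hNL := ok.N_lt
  have hSL := ok.S_lt
  have hn : (p.n : ℤ) ≤ p.N := by have := ok.n_le; rw [Params.N]; exact_mod_cast this
  have hn1 : (1 : ℤ) ≤ p.n := by exact_mod_cast ok.n_pos
  have hnn : (p.n : ℤ) * p.n < p.L := lt_of_le_of_lt (by nlinarith) ok.NN_le
  set inv : ℕ → IState → Prop := fun k σ' => (σ'.reg (B + 17) = k ∧ (k : ℤ) ≤ p.n * p.n) ∧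
    σ'.reg (B + 2) = p.n ∧ σ'.reg (B + 5) = p.S ∧ σ'.reg (B + 8) = 1 ∧
    σ'.reg (B + 11) = 2 * p.N ∧ σ'.arr B = σ.arr B ∧ σ'.arr (B + 1) = σ.arr (B + 1) ∧
    ∀ i j : ℤ, 0 ≤ i → i < p.n → 0 ≤ j → j < p.n → (k : ℤ) ≤ i * p.n + j →
        σ'.arr 0 (i * p.n + j) = finFlag (D i j) ∧ σ'.arr 1 (i * p.n + j) = finValue (D i j)
    with hinv
  have b0 : B ≠ 0 := by omega
  have b1 : B ≠ 1 := by omega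
  have b2 : B + 1 ≠ 0 := by omega
  have b3 : B + 1 ≠ 1 := by omega
  have hbody : ∀ k < p.n * p.n, ∀ σ', inv (k + 1) σ' →
      Det X 0 (code 0 (outputBody B)) 24 σ' (inv k) := by
    rintro k hk σ' ⟨⟨g17, gk⟩, g2, g5, g8, g11, ga, ga', gc⟩
    push_cast at g17 gk gc
    set i : ℤ := k / p.n with hi
    set j : ℤ := k % p.n with hj
    have hij : (k : ℤ) = i * p.n + j := by
      rw [hi, hj, mul_comm]; exact (Int.mul_ediv_add_emod (k : ℤ) p.n).symm
    have hi0 : 0 ≤ i := Int.ediv_nonneg (by positivity) (by omega)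
    have hiN : i < p.n := Int.ediv_lt_of_lt_mul (by omega) (by omega)
    have hj0 : 0 ≤ j := Int.emod_nonneg _ (by omega)
    have hjN : j < p.n := Int.emod_lt_of_pos _ (by omega)
    have hadr := mul_add_lt_mul_self (show i + 1 < p.S by rw [Params.S]; omega) (by omega)
      (show j + 2 * p.N + 1 < p.S by rw [Params.S]; omega)
    have hadr0 : 0 ≤ (i + 1) * p.S := by
      have : 0 ≤ p.S := by rw [Params.S]; omega
      nlinarith
    have hk0 : (0 : ℤ) ≤ k := by positivity
    obtain ⟨d1, d2⟩ := hD i j hi0 hiN hj0 hjN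
    have eadr : (i + 1) * p.S + j + 2 * p.N + 1 = (i + 1) * p.S + (j + 2 * p.N + 1) := by ring
    refine (det_code hw hL (by simp [outputBody]) ?_).mono (by simp [outputBody]) ?_
    · simp only [outputBody, SafeAll, IntInstr.Safe, IntOp.Safe, IntOp.eval, IntInstr.exec,
        IState.setReg_reg, IState.setCell_reg, g17, g2, g8, g5, g11, Nat.add_left_cancel_iff,
        Nat.reduceEqDiff, if_true, if_false, add_sub_cancel_right, true_and, and_true, ← hi, ← hj,
        eadr]
      omega
    · rintro _ rfl
      refine ⟨⟨?_, by omega⟩, ?_, ?_, ?_, ?_, ?_, ?_, fun i' j' hi' hiN' hj' hjN' hk' => ?_⟩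
      iterate 5
        simp only [outputBody, execAll, IntInstr.exec, IState.setReg_reg, IState.setCell_reg,
          IntOp.eval, g17, g2, g5, g8, g11, Nat.add_left_cancel_iff, Nat.reduceEqDiff, if_true,
          if_false, add_sub_cancel_right]
      iterate 2
        funext z
        simp only [outputBody, execAll, IntInstr.exec, IState.setReg_arr, IState.setCell_arr, b0, b1,
          b2, b3, false_and, if_false, ga, ga']
      have hc : i' * p.n + j' = k ↔ i' = i ∧ j' = j := by
        rw [hij]
        exact add_mul_inj hj' hjN' hj0 hjN
      simp only [outputBody, execAll, IntInstr.exec, IState.setReg_arr, IState.setCell_arr,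
        IState.setReg_reg, IState.setCell_reg, IntOp.eval, g17, g2, g5, g8, g11, ga, ga',
        Nat.add_left_cancel_iff, Nat.reduceEqDiff, if_true, if_false, add_sub_cancel_right, true_and,
        false_and, zero_ne_one, one_ne_zero, ← hi, ← hj, eadr, d1, d2, hc]
      by_cases hcc : i' = i ∧ j' = j
      · obtain ⟨rfl, rfl⟩ := hcc
        simp
      · simp only [hcc, if_false]
        refine gc i' j' hi' hiN' hj' hjN' ?_
        have : i' * p.n + j' ≠ k := fun h => hcc (hc.1 h)
        omega
  refine ((det_code hw hL (by simp) (by simp [SafeAll, IntInstr.Safe, IntOp.Safe])).seq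
    (T' := p.n * p.n * 25 + 1) (Q' := inv 0) ?_).mono (by simp; omega) ?_
  · rintro _ rfl
    have hlt : p.n * p.n < 2 ^ w := by
      have : ((p.n * p.n : ℕ) : ℤ) < 2 ^ w := by push_cast; omega
      exact_mod_cast this
    have := Det.loop (X := X) (B := 0) (p := code 0 (outputBody B)) (x := B + 17) inv
      (fun _ _ h => h.1.1) hlt hbody (σ := execAll [.op .mul (B + 17) (B + 2) (B + 2)] σ) ?_
    · rwa [zero_add] at this
    · refine ⟨⟨?_, by push_cast; exact le_rfl⟩, ?_, ?_, ?_, ?_, rfl, rfl,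
        fun i j hi hiN hj hjN h => ?_⟩
      iterate 5
        simp only [execAll, IntInstr.exec, IState.setReg_reg, IntOp.eval, h2, h5, h8, h11,
          Nat.add_left_cancel_iff, Nat.reduceEqDiff, if_true, if_false]
        try push_cast
        try rfl
      push_cast at h
      have := mul_add_lt_mul_self hiN hi hjN
      omega
  · rintro σ' ⟨-, -, -, -, -, -, -, h⟩ i j hi hiN hj hjN
    exact h i j hi hiN hj hjN (by have : 0 ≤ i * p.n := by positivity
                                  push_cast; omega)

end

/-! ## The whole program -/

/-- Compute a sequence of distance products. -/
def fullProgram (B c K : ℕ) (P : QProgram) (pre cnt : List IntInstr) : QProgram :=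
  .seq (.instr (.op .bor (B + 2) 0 0))
    (.seq (.seq (startProgram B c K pre cnt) (squares B P)) (outputProgram B))

/-- A bound for the running time of `fullProgram`. -/
def fullTime (p : Params) (B c TP len len' R : ℕ) : ℕ :=
  p.n * 21 + 2 * c + 70 + p.m ^ 6 * (2 * len + 59) + 2 * len' + (R * (squareTime p B TP + 1) + 1) +
    p.n * p.n * 25 + 8

theorem represents_init {w : ℕ} {X : WordInput w} {B n : ℕ} (hB : 1 ≤ B) {tab : ℕ → ℤ → ℤ → ℤ}
    (hX : ∀ k y z, 0 ≤ y → y < 2 ^ w → 0 ≤ z → z < 2 ^ w →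
      X k (BitVec.ofInt w y) (BitVec.ofInt w z) = BitVec.ofInt w (tab k y z)) :
    Represents X B ⟨fun r => if r = 2 then n else 0, fun _ _ => 0, tab⟩
      ((RamState.init w n).setReg (B + 2) (BitVec.ofNat w n)) where
  reg x := by
    simp only [RamState.setReg, RamState.init, Function.update_apply, Nat.add_left_cancel_iff,
      show B + x ≠ 0 by omega, if_false]
    split_ifs
    · exact (BitVec.ofInt_natCast w n).symm
    · exact (BitVec.ofInt_natCast w 0).symm
  arr _ _ _ _ := (BitVec.ofInt_natCast w 0).symm
  tab := hX

section

variable {w : ℕ} {X : WordInput w} {P : QProgram} {B c K n d TP R : ℕ}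

-- The copy of `n` into outer register `2` comes first, because calls overwrite machine register
-- `0`. The output phase is deterministic and preserves the norm, so the answer is wrong at most
-- with the probability that the last matrix is wrong.
open Classical in
theorem fullProgram_spec (hw : 1 ≤ w) (hn : 1 ≤ n) (hnw : 8 * (n : ℤ) < 2 ^ (w - 1))
    (ok : (params c K n w).Ok) (hB : 2 ≤ B) (hPB : P.bound ≤ B)
    (hP : ∀ A : (minTriangle d).Inst (3 * cubeRoot n), ∃ t ≤ TP,
      P.HaltsWithin (3 * cubeRoot n) ((minTriangle d).input w A) t ∧
      2 / 3 ≤ P.successProb (3 * cubeRoot n) ((minTriangle d).input w A) t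
        ((minTriangle d).correct A))
    (htop : (params c K n w).top ≤ (3 * cubeRoot n) ^ d)
    {tab : ℕ → ℤ → ℤ → ℤ} (hX : ∀ k y z, 0 ≤ y → y < 2 ^ w → 0 ≤ z → z < 2 ^ w →
      X k (BitVec.ofInt w y) (BitVec.ofInt w z) = BitVec.ofInt w (tab k y z))
    {pre cnt : List IntInstr} {Z : ℕ → (ℤ → ℤ → WithTop ℤ) × (ℤ → ℤ → WithTop ℤ)}
    (hpre : ∀ σ', Env (params c K n w) σ' → σ'.tab = tab →
      Computes (params c K n w) σ' pre (Z 0).1 (Z 0).2)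
    (hU : ∀ i j (z : ℤ), (Z 0).1 i j = z → |z| ≤ (params c K n w).top)
    (hV : ∀ i j (z : ℤ), (Z 0).2 i j = z → |z| ≤ (params c K n w).top)
    (hcnt : ∀ σ' : IState, σ'.reg 27 = bits n → cnt ≠ [] ∧ SafeAll (params c K n w).L cnt σ' ∧
      execAll cnt σ' = σ'.setReg 20 R)
    (hR : R < 2 ^ w)
    (hZ : ∀ s < R, (Z (s + 1)).2 = (Z (s + 1)).1 ∧
      IsProduct (params c K n w) (Z s).1 (Z s).2 (Z (s + 1)).1)
    (herr : R * (((params c K n w).q + 1 : ℕ) * mainError (params c K n w)) ≤ 1 / 3)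
    {good : RamState w → Prop} (hgood : ∀ s : RamState w,
      (∀ i j : ℤ, 0 ≤ i → i < n → 0 ≤ j → j < n →
        s.arr 0 (BitVec.ofInt w (i * n + j)) = BitVec.ofInt w (finFlag ((Z R).1 i j)) ∧
        s.arr 1 (BitVec.ofInt w (i * n + j)) = BitVec.ofInt w (finValue ((Z R).1 i j))) →
      good s) :
    (fullProgram B c K P pre cnt).HaltsWithin n X
        (fullTime (params c K n w) B c TP pre.length cnt.length R) ∧
      2 / 3 ≤ (fullProgram B c K P pre cnt).successProb n X
        (fullTime (params c K n w) B c TP pre.length cnt.length R) good := by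
  set p := params c K n w with hp
  have hpn : p.n = n := rfl
  have hL : 2 * p.L = 2 ^ w := by
    change 2 * (2 : ℤ) ^ (w - 1) = 2 ^ w
    rw [mul_comm, ← pow_succ]; congr 1; omega
  have hnN : (p.n : ℤ) ≤ p.N := by have := ok.n_le; rw [Params.N]; exact_mod_cast this
  set s₀ := (RamState.init w n).setReg (B + 2) (BitVec.ofNat w n) with hs₀
  have hr₀ : Represents X B _ s₀ := represents_init (n := n) (by omega) hX
  have first : Runs X [.instr (.op .bor (B + 2) 0 0)] (RamState.init w n) 1 {s₀} := by
    have := Runs.instr (X := X) (.op .bor (B + 2) 0 0) (RamState.init w n)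
    simpa [Instr.exec, WordOp.eval, RamState.init, hs₀] using this
  have start := det_start (X := X) (B := B) (σ := ⟨fun r => if r = 2 then n else 0, fun _ _ => 0, tab⟩)
    hw hn hnw ok rfl (fun _ _ => rfl) (fun σ' h h' => hpre σ' h h') hU hV hcnt
  have main := (start.tri (b := R * ((p.q + 1 : ℕ) * mainError p))
    (f := fun _ => R * ((p.q + 1 : ℕ) * mainError p)) fun _ _ => le_rfl).seq
    (Q' := fun σ => ∃ σ₀, SquareInv p σ₀ 0 σ)
    fun σ' h => (tri_squares hw hL ok (by omega) hPB hP htop hR h.1 h.2 hZ).mono le_rfl le_rfl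
      (fun _ h => ⟨_, h⟩) fun _ _ => le_rfl
  obtain ⟨M, m1, m2, m3⟩ := main s₀ hr₀
  have out : ∀ e ∈ M, ∃ s', Runs X [outputProgram B] e.2 (p.n * p.n * 25 + 4) {s'} ∧
      s'.vec = e.2.vec ∧ (Holds p (Z R).1 (Z R).2 e.1 → good s') := by
    intro e he
    obtain ⟨hrep, σ₀, hI⟩ := m2 e he
    have ub : ∀ a z, (e.1.unshift B e.2).arr (B + a) z = e.1.arr a z := fun a z => by
      simp [IState.unshift]
    have ur : ∀ r, (e.1.unshift B e.2).reg (B + r) = e.1.reg r := fun r => by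
      simp [IState.unshift]
    obtain ⟨σ', s', q1, q2, q3, q4⟩ := det_output (X := X) (σ := e.1.unshift B e.2)
      (D := fun i j => storedMat p.S e.1.arr (i + 1) (j + 2 * p.N + 1)) hw hL ok hB
      ((ur 2).trans hI.env.r2) ((ur 5).trans hI.env.r5) ((ur 8).trans hI.env.r8)
      ((ur 11).trans hI.env.r11) (fun i j hi hin hj hjn => by
        rw [ub 1, show (e.1.unshift B e.2).arr B = e.1.arr 0 from funext (ub 0)]
        exact hI.stores _ _ (by omega) (by rw [Params.S]; omega) (by omega)
          (by rw [Params.S]; omega)) e.2 hrep.unshift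
    refine ⟨s', q1, q3, fun hH => hgood s' fun i j hi hin hj hjn => ?_⟩
    have hlt : i * n + j < 2 ^ w := by
      have h1 := mul_add_lt_mul_self hin hi hjn
      have h2 := ok.NN_le
      have h3 : (n : ℤ) * n ≤ p.N * p.N := by nlinarith
      linarith
    have h0 : 0 ≤ i * n + j := by positivity
    obtain ⟨e1, e2⟩ := q4 i j hi hin hj hjn
    rw [(hH i j hi (by omega) hj (by omega)).1] at e1 e2
    have r0 := q2.arr 0 (i * n + j) h0 hlt
    have r1 := q2.arr 1 (i * n + j) h0 hlt
    rw [zero_add] at r0 r1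
    exact ⟨r0.trans (congrArg _ e1), r1.trans (congrArg _ e2)⟩
  -- Needed by `choose!`, which extends the final state to labels outside `M`.
  have : Nonempty (RamState w) := ⟨s₀⟩
  choose! G g1 g2 g3 using out
  have full : Runs X [fullProgram B c K P pre cnt] (RamState.init w n)
      (fullTime p B c TP pre.length cnt.length R) (M.map G) := by
    have h1 := m1.cons_map g1
    rw [Multiset.bind_singleton] at h1
    replace h1 := Runs.of_step_singleton (k := [.seq (.seq (startProgram B c K pre cnt)
      (squares B P)) (outputProgram B)]) (s := s₀) rfl h1
    refine (first.seq_singleton h1).mono ?_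
    rw [fullTime]
    change _ ≤ p.n * 21 + 2 * c + 70 + cubeRoot n ^ 6 * (2 * pre.length + 59) + 2 * cnt.length + _ + _ + _
    omega
  refine ⟨full.halted, ?_⟩
  rw [successProb_eq full, Multiset.map_map]
  have hsum := full.sum_normSq hw
  rw [normSq_init, Multiset.map_map] at hsum
  have h1 : s₀.vec.normSq = 1 := normSq_init w n
  rw [h1, mul_one] at m3
  calc (2 / 3 : ℝ) ≤ 1 - R * ((p.q + 1 : ℕ) * mainError p) := by linarith
    _ ≤ 1 - (M.map fun e => (if Holds p (Z R).1 (Z R).2 e.1 then 0 else 1) * e.2.vec.normSq).sum := by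
        linarith
    _ = (M.map fun e => (G e).vec.normSq -
          (if Holds p (Z R).1 (Z R).2 e.1 then 0 else 1) * e.2.vec.normSq).sum := by
        rw [Multiset.sum_map_sub, ← hsum]; rfl
    _ ≤ _ := Multiset.sum_map_le_sum_map _ _ fun e he => by
        have := e.2.vec.normSq_nonneg
        simp only [Function.comp_apply, g2 e he]
        split_ifs with h h' h'
        · simp
        · exact absurd (g3 e he h) h'
        · simpa using this
        · simp

end

/-! ## Inputs and outputs -/

namespace WMatrix

variable {n w : ℕ}

/-- The tables of the input that presents a matrix, as integers. -/
def table (A : WMatrix n) (k : ℕ) (i j : ℤ) : ℤ :=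
  match k with
  | 0 => finFlag (A.pad i j)
  | 1 => finValue (A.pad i j)
  | _ => 0

/-- The tables of the input that presents two matrices, as integers. -/
def table₂ (A B : WMatrix n) (k : ℕ) : ℤ → ℤ → ℤ :=
  if k < 2 then A.table k else B.table (k - 2)

theorem entry_ofInt (A : WMatrix n) {y z : ℤ} (hy : 0 ≤ y) (hyw : y < 2 ^ w) (hz : 0 ≤ z)
    (hzw : z < 2 ^ w) : A.entry (BitVec.ofInt w y) (BitVec.ofInt w z) = A.pad y z := by
  have h : ∀ x : ℤ, 0 ≤ x → x < 2 ^ w → (BitVec.ofInt w x).toNat = x.toNat := fun x h1 h2 => by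
    rw [BitVec.toNat_ofInt, Int.emod_eq_of_lt h1 (by push_cast; omega)]
  simp only [entry, pad, h y hy hyw, h z hz hzw]
  by_cases hn : y.toNat < n ∧ z.toNat < n
  · rw [dif_pos hn, dif_pos (by omega)]
  · rw [dif_neg hn, dif_neg (by omega)]

theorem toInput_ofInt (A : WMatrix n) (k : ℕ) {y z : ℤ} (hy : 0 ≤ y) (hyw : y < 2 ^ w)
    (hz : 0 ≤ z) (hzw : z < 2 ^ w) :
    A.toInput w k (BitVec.ofInt w y) (BitVec.ofInt w z) = BitVec.ofInt w (A.table k y z) := by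
  match k with
  | 0 => rw [toInput, A.entry_ofInt hy hyw hz hzw, finiteWord_eq]; rfl
  | 1 => rw [toInput, A.entry_ofInt hy hyw hz hzw, valueWord_eq]; rfl
  | k + 2 => exact (BitVec.ofInt_natCast w 0).symm

theorem toInput₂_ofInt (A B : WMatrix n) (k : ℕ) {y z : ℤ} (hy : 0 ≤ y) (hyw : y < 2 ^ w)
    (hz : 0 ≤ z) (hzw : z < 2 ^ w) :
    A.toInput₂ B w k (BitVec.ofInt w y) (BitVec.ofInt w z) = BitVec.ofInt w (A.table₂ B k y z) := by
  rw [toInput₂, table₂]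
  split_ifs
  · exact A.toInput_ofInt k hy hyw hz hzw
  · exact B.toInput_ofInt _ hy hyw hz hzw

theorem isOutput_of_pad {D : WMatrix n} {s : RamState w}
    (h : ∀ i j : ℤ, 0 ≤ i → i < n → 0 ≤ j → j < n →
      s.arr 0 (BitVec.ofInt w (i * n + j)) = BitVec.ofInt w (finFlag (D.pad i j)) ∧
      s.arr 1 (BitVec.ofInt w (i * n + j)) = BitVec.ofInt w (finValue (D.pad i j))) :
    D.IsOutput s := by
  intro i j
  have := h (i : ℕ) (j : ℕ) (by omega) (by omega) (by omega) (by omega)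
  rwa [pad_natCast, ← finiteWord_eq, ← valueWord_eq,
    show ((i : ℕ) : ℤ) * n + (j : ℕ) = ((i * n + j : ℕ) : ℤ) by push_cast; rfl,
    BitVec.ofInt_natCast] at this

theorem abs_le_of_pad_eq {A : WMatrix n} {h : ℤ}
    (hA : ∀ (i j : Fin n) (z : ℤ), A i j = (z : WithTop ℤ) → |z| ≤ h) (i j z : ℤ)
    (hz : A.pad i j = z) : |z| ≤ h := by
  by_cases hij : (0 ≤ i ∧ i < n) ∧ 0 ≤ j ∧ j < n
  · rw [pad, dif_pos hij] at hz
    exact hA _ _ _ hz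
  · rw [pad_of_not _ hij] at hz
    exact absurd hz.symm WithTop.coe_ne_top

end WMatrix

/-! ### Both problems as instances of a sequence of distance products -/

/-- The problem `Q` can be reduced to the computation of a sequence of at most `bits n` distance
products of matrices with entries at most `n ^ c`; the matrices are read from the input by the code
`pre`, and the number of products is computed by the code `cnt`. -/
def ReducesToFactors (Q : RamProblem) (c : ℕ) (pre cnt : List IntInstr) : Prop :=
  ∀ n w : ℕ, ∀ x : Q.Inst n, ∃ (A B : WMatrix n) (R : ℕ) (tab : ℕ → ℤ → ℤ → ℤ),
    A.Bounded c ∧ B.Bounded c ∧ (1 ≤ n → R ≤ bits n) ∧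
    (∀ k y z, 0 ≤ y → y < 2 ^ w → 0 ≤ z → z < 2 ^ w →
      Q.input w x k (BitVec.ofInt w y) (BitVec.ofInt w z) = BitVec.ofInt w (tab k y z)) ∧
    (∀ p : Params, p.Ok → p.n = n → ∀ σ, Env p σ → σ.tab = tab → Computes p σ pre A.pad B.pad) ∧
    (∀ σ : IState, σ.reg 27 = bits n →
      cnt ≠ [] ∧ (∀ L, SafeAll L cnt σ) ∧ execAll cnt σ = σ.setReg 20 R) ∧
    ∀ s : RamState w, (WMatrix.factors A B R).1.IsOutput s → Q.correct x s

theorem reducesToFactors_distanceProduct (c : ℕ) :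
    ReducesToFactors (distanceProduct c) c productPre [.const 20 1] := by
  rintro n w ⟨⟨A, B⟩, hA, hB⟩
  refine ⟨A, B, 1, A.table₂ B, hA, hB, bits_pos, fun k y z h1 h2 h3 h4 =>
    A.toInput₂_ofInt B k h1 h2 h3 h4, fun p ok _ σ _ ht => ?_, fun σ _ => ?_, fun s h => h⟩
  · refine computes_productPre ok ?_ ?_ ?_ ?_ <;> rw [ht] <;> intro i j <;> rfl
  · exact ⟨by simp, fun L => by simp [SafeAll, IntInstr.Safe], rfl⟩

theorem reducesToFactors_allPairsShortestPaths (c : ℕ) :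
    ReducesToFactors (allPairsShortestPaths c) c pathsPre
      [.const 20 0, .op .add 20 20 27] := by
  rintro n w ⟨A, hA, hb⟩
  have hb' : A.zeroDiag.Bounded c := fun i j z hz => by
    rw [WMatrix.zeroDiag, Matrix.of_apply] at hz
    split_ifs at hz
    · rw [← WithTop.coe_zero, WithTop.coe_eq_coe] at hz
      rw [← hz, abs_zero]
      positivity
    · exact hb i j z hz
  refine ⟨A.zeroDiag, A.zeroDiag, bits n, A.table, hb', hb', fun _ => le_rfl,
    fun k y z h1 h2 h3 h4 => A.toInput_ofInt k h1 h2 h3 h4, fun p ok hpn σ hE ht => ?_,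
    fun σ h27 => ⟨by simp, fun L => by simp [SafeAll, IntInstr.Safe, IntOp.Safe], ?_⟩,
    fun s h => ⟨_, WMatrix.isDistanceMatrix_factors hA (lt_two_pow_bits n).le, h⟩⟩
  · subst hpn
    refine computes_pathsPre ok hE ?_ ?_ <;> rw [ht] <;> intro i j <;> rfl
  · simp [execAll, IntInstr.exec, IState.setReg, IntOp.eval, h27]

/-! ## Bounds for the parameters -/

section

variable {c K n w : ℕ}

theorem bits_le_log (hn : 1 ≤ n) : bits n ≤ Nat.log 2 n + 1 := by
  have h1 := two_pow_bits_le hn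
  have h2 : n < 2 ^ (Nat.log 2 n + 1) := Nat.lt_pow_succ_log_self (by norm_num) n
  have h3 : 2 ^ bits n < 2 ^ (Nat.log 2 n + 2) := by
    rw [show Nat.log 2 n + 2 = (Nat.log 2 n + 1) + 1 by ring, pow_succ]
    omega
  have := (Nat.pow_lt_pow_iff_right (by norm_num)).1 h3
  omega

theorem cubeRoot_pos (hn : 1 ≤ n) : 1 ≤ cubeRoot n := by
  by_contra h
  have := le_cubeRoot_pow n
  rw [show cubeRoot n = 0 by omega] at this
  omega

theorem cubeRoot_pow_lt (hn : 1 ≤ n) : cubeRoot n ^ 3 < 2 ^ (bits n + 3) := by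
  have h1 := cubeRoot_pow_le hn
  have h2 := lt_two_pow_bits n
  rw [pow_add]
  omega

theorem cubeRoot_lt (hn : 1 ≤ n) : 3 * cubeRoot n < 2 ^ (bits n + 5) := by
  have h1 := cubeRoot_pow_lt hn
  have h2 : cubeRoot n ≤ cubeRoot n ^ 3 := Nat.le_self_pow (by norm_num) _
  rw [pow_add] at h1 ⊢
  omega

theorem cubeRoot_pow_six_lt (hn : 1 ≤ n) : cubeRoot n ^ 6 < 2 ^ (2 * bits n + 6) := by
  have := Nat.mul_lt_mul'' (cubeRoot_pow_lt hn) (cubeRoot_pow_lt hn)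
  rw [← pow_add, ← pow_add] at this
  convert this using 2
  ring

/-- Each quantity is bounded by a power of two whose exponent is linear in `bits n`; since `1 ≤ bits
n`, additive constants can be absorbed into its multiple. -/
theorem params_ok (hn : 1 ≤ n) (hK : 1 ≤ K) (hw : (K + c + 41) * bits n ≤ w) :
    (params c K n w).Ok := by
  have hl := bits_pos hn
  have h6 := cubeRoot_pow_six_lt hn
  have h3 := cubeRoot_pow_lt hn
  set l := bits n with hl'
  have hwl : K + c + 39 + l ≤ w - 1 ∧ (K + 3) + 3 * l + 20 ≤ w - 1 ∧ (c + 1) * l + 20 ≤ w - 1 := by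
    have e1 : (K + c + 41) * l = K * l + c * l + 41 * l := by ring
    have e2 : (c + 1) * l = c * l + l := by ring
    have e3 : K ≤ K * l := Nat.le_mul_of_pos_right _ hl
    have e4 : c ≤ c * l := Nat.le_mul_of_pos_right _ hl
    omega
  have key : ∀ a b : ℕ, a ≤ 2 ^ b → b < w - 1 → (a : ℤ) < 2 ^ (w - 1) := fun a b h1 h2 => by
    exact_mod_cast h1.trans_lt (Nat.pow_lt_pow_right (by norm_num) h2)
  have hbit : l < 2 ^ l := Nat.lt_two_pow_self
  have hKl : K * l < 2 ^ (K + l) := by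
    rw [pow_add]
    exact Nat.mul_lt_mul'' Nat.lt_two_pow_self hbit
  constructor
  case n_pos => exact hn
  case n_le => exact le_cubeRoot_pow n
  case r_pos => exact Nat.mul_pos hK hl
  case S_lt =>
    have h1 : 3 * cubeRoot n ^ 3 + 1 ≤ 2 ^ (l + 5) := by
      rw [pow_add] at h3 ⊢
      have : 1 ≤ 2 ^ l := Nat.one_le_two_pow
      omega
    have h2 := Nat.mul_le_mul h1 h1
    rw [← pow_add] at h2
    have := key _ _ h2 (by omega)
    push_cast at this
    exact this
  case calls_lt =>
    have h1 : 2 * cubeRoot n ^ 6 * (K * l) + 1 ≤ 2 ^ (2 * l + 6 + (K + l) + 1) := by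
      have := Nat.mul_lt_mul'' h6 hKl
      rw [← pow_add] at this
      rw [pow_succ 2, mul_assoc 2]
      omega
    have := key _ _ h1 (by omega)
    push_cast at this
    simp only [params, Params.calls]
    push_cast
    exact this
  case top_lt =>
    have h1 : 8 * 2 ^ ((c + 1) * l + 2) ≤ 2 ^ ((c + 1) * l + 2 + 3) := by
      rw [pow_add _ _ 3]; omega
    have := key _ _ h1 (by omega)
    push_cast at this
    exact this
  case q_lt =>
    have h1 : (c + 1) * l + 2 + 1 ≤ 2 ^ ((c + 1) * l + 2) :=
      Nat.lt_two_pow_self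
    have := key _ _ h1 (by omega)
    push_cast at this
    simp only [params]
    push_cast
    exact this

/-- This is where the exponent `3 * c + 5` comes from: `2 ^ bits n ≤ 2 * n ≤ (3 * m) ^ 3` is raised
to the power `c + 1`, and the remaining factor `4` is at most `(3 * m) ^ 2`. -/
theorem params_top_le (hn : 1 ≤ n) :
    (params c K n w).top ≤ (3 * (cubeRoot n : ℤ)) ^ (3 * c + 5) := by
  have h1 : 2 ^ bits n ≤ 27 * cubeRoot n ^ 3 := by
    have := two_pow_bits_le hn
    have := le_cubeRoot_pow n
    omega
  have h2 : 2 ^ ((c + 1) * bits n + 2) ≤ (3 * cubeRoot n) ^ (3 * c + 5) := by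
    calc 2 ^ ((c + 1) * bits n + 2) = (2 ^ bits n) ^ (c + 1) * 4 := by
          rw [pow_add, mul_comm (c + 1), pow_mul]; norm_num
      _ ≤ (27 * cubeRoot n ^ 3) ^ (c + 1) * (3 * cubeRoot n) ^ 2 := by
          refine Nat.mul_le_mul (Nat.pow_le_pow_left h1 _) ?_
          have := cubeRoot_pos hn
          nlinarith
      _ = (3 * cubeRoot n) ^ (3 * c + 5) := by
          rw [show 27 * cubeRoot n ^ 3 = (3 * cubeRoot n) ^ 3 by ring, ← pow_mul, ← pow_add]
          congr 1
  simp only [params, Params.top]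
  exact_mod_cast h2

/-- Finite entries after `R` products are at most `2 ^ R * n ^ c`. The factor `4` keeps them
strictly below `top - 1`, the code for `∞`. -/
theorem four_mul_le_params_top {R : ℕ} (hR : R ≤ bits n) :
    4 * (2 ^ R * (n : ℤ) ^ c) ≤ (params c K n w).top := by
  have h1 : 2 ^ R * n ^ c ≤ 2 ^ bits n * (2 ^ bits n) ^ c :=
    Nat.mul_le_mul (Nat.pow_le_pow_right (by norm_num) hR)
      (Nat.pow_le_pow_left (lt_two_pow_bits n).le _)
  have h2 : 4 * (2 ^ R * n ^ c) ≤ 2 ^ ((c + 1) * bits n + 2) := by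
    rw [pow_add, mul_comm (c + 1), pow_mul, pow_succ (2 ^ bits n)]
    linarith
  simp only [params, Params.top]
  exact_mod_cast h2

theorem mul_sq_le_three_pow (c : ℕ) : 576 * (c + 20) ^ 2 ≤ 3 ^ (c + 16) := by
  induction c with
  | zero => norm_num
  | succ c ih =>
    rw [show c + 1 + 16 = (c + 16) + 1 by ring, pow_succ 3]
    have : (c + 1 + 20) ^ 2 ≤ 3 * (c + 20) ^ 2 := by
      rw [show (c + 1 + 20) ^ 2 = c * c + 42 * c + 441 by ring,
        show (c + 20) ^ 2 = c * c + 40 * c + 400 by ring]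
      omega
    linarith

/-- The number of iterations is exponential in `l = bits n` with a fixed base, and `r` is a multiple
of `l`, so `(1/3) ^ r` outweighs it for the multiple `c + 20`. -/
theorem error_le (hn : 1 ≤ n) {R : ℕ} (hR : R ≤ bits n) :
    R * (((params c (c + 20) n w).q + 1 : ℕ) * mainError (params c (c + 20) n w)) ≤ 1 / 3 := by
  have hl := bits_pos hn
  have h3 := cubeRoot_pow_le hn
  have hm := cubeRoot_pos hn
  have h2 := (lt_two_pow_bits n).le
  set l := bits n with hl'
  have h6 : cubeRoot n ^ 6 ≤ 64 * 4 ^ l := by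
    calc cubeRoot n ^ 6 = (cubeRoot n ^ 3) ^ 2 := by ring
      _ ≤ (8 * 2 ^ l) ^ 2 := Nat.pow_le_pow_left (by omega) 2
      _ = 64 * 4 ^ l := by rw [mul_pow, ← pow_mul, mul_comm l, pow_mul]; norm_num
  have hbit : l ≤ 2 ^ l := Nat.lt_two_pow_self.le
  have hm6 : 1 ≤ cubeRoot n ^ 6 * ((c + 20) * l) :=
    Nat.mul_pos (Nat.pow_pos hm) (Nat.mul_pos (by omega) hl)
  have key : 3 * (R * (((c + 1) * l + 2 + 1) * (2 * cubeRoot n ^ 6 * ((c + 20) * l) + 1))) ≤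
      3 ^ ((c + 20) * l) := by
    -- The polynomial `l ^ 3` is absorbed into `8 ^ l`, and `8 * 4 = 32 ≤ 81 = 3 ^ 4`. This uses `4`
    -- of the `c + 20` powers of `3 ^ l`; the other `c + 16` pay for `576 * (c + 20) ^ 2`.
    calc 3 * (R * (((c + 1) * l + 2 + 1) * (2 * cubeRoot n ^ 6 * ((c + 20) * l) + 1)))
        ≤ 3 * (l * (((c + 20) * l) * (3 * (64 * 4 ^ l * ((c + 20) * l))))) := by
          have e1 : (c + 1) * l + 2 + 1 ≤ (c + 20) * l := by nlinarith
          have e2 : 2 * cubeRoot n ^ 6 * ((c + 20) * l) + 1 ≤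
              3 * (64 * 4 ^ l * ((c + 20) * l)) := by
            have := Nat.mul_le_mul_right ((c + 20) * l) h6
            linarith
          gcongr
      _ = 576 * (c + 20) ^ 2 * (l ^ 3 * 4 ^ l) := by ring
      _ ≤ 3 ^ (c + 16) * ((2 ^ l) ^ 3 * 4 ^ l) := by
          gcongr
          exact mul_sq_le_three_pow c
      _ = 3 ^ (c + 16) * 32 ^ l := by
          rw [← pow_mul, mul_comm l 3, pow_mul, ← mul_pow]; norm_num
      _ ≤ 3 ^ ((c + 16) * l) * 81 ^ l := by
          gcongr
          · norm_num
          · exact Nat.le_mul_of_pos_right _ hl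
          · norm_num
      _ = 3 ^ ((c + 20) * l) := by
          rw [show 81 = 3 ^ 4 by norm_num, ← pow_mul, ← pow_add]
          congr 1
          ring
  have key' : (3 : ℝ) * (R * ((((c + 1) * l + 2 + 1 : ℕ) : ℝ) *
      ((2 * cubeRoot n ^ 6 * ((c + 20) * l) : ℕ) + 1))) ≤ 3 ^ ((c + 20) * l) := by
    exact_mod_cast key
  have hpos : (0 : ℝ) < 3 ^ ((c + 20) * l) := by positivity
  change (R : ℝ) * ((((c + 1) * l + 2 + 1 : ℕ) : ℝ) *
    (((2 * cubeRoot n ^ 6 * ((c + 20) * l) : ℕ) + 1) * (1 / 3) ^ ((c + 20) * l))) ≤ 1 / 3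
  rw [one_div, inv_pow, ← mul_assoc, ← mul_assoc, ← div_eq_mul_inv, div_le_iff₀ hpos]
  linarith

/-- The constant factor in the running time. -/
def timeConst (B c K len len' : ℕ) : ℕ :=
  (c + 4) * (121 + 2 * K * (5 * B + 239)) + 2 * c + 2 * len + 2 * len' + 400

/-- The three factors `bits n` come from the number of products, the number of rounds in a binary
search, and the repetitions `r` of the calls. Everything else is dominated by `m ^ 6`. -/
theorem fullTime_le (hn : 1 ≤ n) {R : ℕ} (hR : R ≤ bits n) (B TP len len' : ℕ) :
    fullTime (params c K n w) B c TP len len' R ≤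
      timeConst B c K len len' * (cubeRoot n ^ 6 * bits n ^ 3 * (cubeRoot n + TP)) := by
  have hl := bits_pos hn
  have hm := cubeRoot_pos hn
  have hnm := le_cubeRoot_pow n
  change n * 21 + 2 * c + 70 + cubeRoot n ^ 6 * (2 * len + 59) + 2 * len' +
    (R * (((c + 1) * bits n + 2 + 1) * (cubeRoot n ^ 6 * 80 +
      2 * cubeRoot n ^ 6 * (K * bits n) * (75 * cubeRoot n + 13 * TP + 5 * B + 151) + 40 + 1) +
      cubeRoot n ^ 6 * 71 + 30 + 1) + 1) + n * n * 25 + 8 ≤ _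
  set l := bits n with hl'
  set m := cubeRoot n with hm'
  obtain ⟨Y, hY⟩ : ∃ Y, Y = m + TP := ⟨_, rfl⟩
  obtain ⟨D, hD⟩ : ∃ D, D = m ^ 6 := ⟨_, rfl⟩
  rw [← hY, ← hD]
  have hD1 : 1 ≤ D := hD ▸ Nat.pow_pos hm
  have hY1 : 1 ≤ Y := by omega
  have hnn : n * n ≤ D := by
    rw [hD, show m ^ 6 = m ^ 3 * m ^ 3 by ring]
    exact Nat.mul_le_mul hnm hnm
  have hn' : n ≤ D := le_trans (Nat.le_mul_of_pos_right n hn) hnn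
  have hW : 75 * m + 13 * TP + 5 * B + 151 ≤ (5 * B + 239) * Y := by nlinarith
  have h1 : D * 80 + 2 * D * (K * l) * (75 * m + 13 * TP + 5 * B + 151) + 40 + 1 ≤
      (121 + 2 * K * (5 * B + 239)) * (D * l * Y) := by
    have e1 : D ≤ D * l * Y := by
      rw [mul_assoc]; exact Nat.le_mul_of_pos_right _ (Nat.mul_pos hl hY1)
    have e2 : 2 * D * (K * l) * (75 * m + 13 * TP + 5 * B + 151) ≤
        2 * D * (K * l) * ((5 * B + 239) * Y) := Nat.mul_le_mul_left _ hW
    have e3 : 2 * D * (K * l) * ((5 * B + 239) * Y) = 2 * K * (5 * B + 239) * (D * l * Y) := by ring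
    rw [add_mul 121, ← e3]
    omega
  set C₁ := 121 + 2 * K * (5 * B + 239) with hC₁
  have h2 : ((c + 1) * l + 2 + 1) * (D * 80 +
      2 * D * (K * l) * (75 * m + 13 * TP + 5 * B + 151) + 40 + 1) + D * 71 + 30 + 1 ≤
      ((c + 4) * C₁ + 102) * (D * l ^ 2 * Y) := by
    have e1 : (c + 1) * l + 2 + 1 ≤ (c + 4) * l := by nlinarith
    have e2 := Nat.mul_le_mul e1 h1
    have e3 : D ≤ D * l ^ 2 * Y := by
      rw [mul_assoc]; exact Nat.le_mul_of_pos_right _ (Nat.mul_pos (Nat.pow_pos hl) hY1)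
    have e4 : (c + 4) * l * (C₁ * (D * l * Y)) = (c + 4) * C₁ * (D * l ^ 2 * Y) := by ring
    rw [add_mul _ 102, ← e4]
    omega
  have h3 := Nat.mul_le_mul hR h2
  have e3 : D ≤ D * l ^ 3 * Y := by
    rw [mul_assoc]; exact Nat.le_mul_of_pos_right _ (Nat.mul_pos (Nat.pow_pos hl) hY1)
  have e4 : l * (((c + 4) * C₁ + 102) * (D * l ^ 2 * Y)) =
      ((c + 4) * C₁ + 102) * (D * l ^ 3 * Y) := by ring
  rw [e4] at h3
  have e5 : timeConst B c K len len' = ((c + 4) * C₁ + 102) + (2 * c + 2 * len + 2 * len' + 298) := by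
    rw [timeConst]; ring
  rw [e5, add_mul ((c + 4) * C₁ + 102)]
  have e6 : 2 * c + 2 * len' + 2 * len * D + 298 * D ≤
      (2 * c + 2 * len + 2 * len' + 298) * (D * l ^ 3 * Y) := by
    refine le_trans ?_ (Nat.mul_le_mul_left _ e3)
    nlinarith
  have e7 : D * (2 * len + 59) = 2 * len * D + 59 * D := by ring
  rw [e7]
  omega

end

/-! ## The main theorem -/

theorem RamProblem.HasQuantumAlgorithm.mono {Q : RamProblem} {e e' : ℝ}
    (h : Q.HasQuantumAlgorithm e) (he : e ≤ e') : Q.HasQuantumAlgorithm e' := by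
  obtain ⟨P, κ, C, hκ, h⟩ := h
  refine ⟨P, κ, |C|, hκ, fun n hn w hw x => ?_⟩
  obtain ⟨t, ht, h'⟩ := h n hn w hw x
  refine ⟨t, ht.trans ?_, h'⟩
  have hn' : (1 : ℝ) ≤ n := by exact_mod_cast hn
  calc C * (n : ℝ) ^ e ≤ |C| * (n : ℝ) ^ e := by gcongr; exact le_abs_self C
    _ ≤ |C| * (n : ℝ) ^ e' := by gcongr

theorem bits_pow_le {η : ℝ} (hη : 0 < η) : ∃ C : ℝ, 0 ≤ C ∧ ∀ n : ℕ, 1 ≤ n →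
    (bits n : ℝ) ^ 3 ≤ C * (n : ℝ) ^ η := by
  have hlog : 0 < Real.log 2 := Real.log_pos (by norm_num)
  refine ⟨(2 ^ (η / 3) / (η / 3 * Real.log 2)) ^ 3, by positivity, fun n hn => ?_⟩
  have h1 : (2 : ℝ) ^ bits n ≤ 2 * n := by exact_mod_cast two_pow_bits_le hn
  have h2 : bits n * Real.log 2 ≤ (2 * n : ℝ) ^ (η / 3) / (η / 3) := by
    rw [← Real.log_pow]
    exact (Real.log_le_log (by positivity) h1).trans
      (Real.log_le_rpow_div (by positivity) (by positivity))
  have h3 : (bits n : ℝ) ≤ 2 ^ (η / 3) / (η / 3 * Real.log 2) * (n : ℝ) ^ (η / 3) := by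
    rw [Real.mul_rpow (by norm_num) (by positivity), ← le_div_iff₀ hlog] at h2
    refine h2.trans (le_of_eq ?_)
    field_simp
  calc (bits n : ℝ) ^ 3 ≤ (2 ^ (η / 3) / (η / 3 * Real.log 2) * (n : ℝ) ^ (η / 3)) ^ 3 := by
        gcongr
    _ = _ := by
        rw [mul_pow, ← Real.rpow_natCast ((n : ℝ) ^ (η / 3)), ← Real.rpow_mul (by positivity)]
        congr 2
        push_cast
        ring

/-- `m ^ 6 * m ^ (3/2 - ε)` is the power `5/2 - ε/3` of `m ^ 3 ≤ 8 * n`. Half of the saving `ε/3` is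
spent on the logarithms. The condition `ε ≤ 1/2` gives `3/2 - ε ≥ 1`, so that the preparation time
`m` is covered by the bound for a call. -/
theorem time_le {ε : ℝ} (hε : 0 < ε) (hε' : ε ≤ 1 / 2) (C : ℝ) (hC : 0 ≤ C) :
    ∃ C' : ℝ, ∀ n : ℕ, 1 ≤ n → ∀ T : ℕ, T ≤ C * ((3 * cubeRoot n : ℕ) : ℝ) ^ (3 / 2 - ε) →
      ((cubeRoot n ^ 6 * bits n ^ 3 * (cubeRoot n + T) : ℕ) : ℝ) ≤
        C' * (n : ℝ) ^ (5 / 2 - ε / 6) := by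
  obtain ⟨C₁, hC₁, h₁⟩ := bits_pow_le (η := ε / 6) (by positivity)
  refine ⟨C₁ * (1 + C * 3 ^ (3 / 2 - ε)) * 8 ^ (5 / 2 - ε / 3), fun n hn T hT => ?_⟩
  have hn' : (1 : ℝ) ≤ n := by exact_mod_cast hn
  set m : ℝ := (cubeRoot n : ℝ) with hm
  have hm1 : 1 ≤ m := by rw [hm]; exact_mod_cast cubeRoot_pos hn
  have hm3 : m ^ 3 ≤ 8 * n := by rw [hm]; exact_mod_cast cubeRoot_pow_le hn
  have h2 : m + T ≤ (1 + C * 3 ^ (3 / 2 - ε)) * m ^ (3 / 2 - ε) := by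
    rw [Nat.cast_mul, ← hm, Real.mul_rpow (by positivity) (by positivity)] at hT
    have := Real.self_le_rpow_of_one_le hm1 (show 1 ≤ 3 / 2 - ε by linarith)
    push_cast at hT
    linarith
  have h3 : m ^ 6 * m ^ (3 / 2 - ε) ≤ 8 ^ (5 / 2 - ε / 3) * (n : ℝ) ^ (5 / 2 - ε / 3) := by
    rw [← Real.mul_rpow (by norm_num) (by positivity)]
    calc m ^ 6 * m ^ (3 / 2 - ε) = (m ^ 3) ^ (5 / 2 - ε / 3) := by
          rw [← Real.rpow_natCast, ← Real.rpow_natCast, ← Real.rpow_mul (by positivity),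
            ← Real.rpow_add (by positivity)]
          congr 1
          push_cast
          ring
      _ ≤ (8 * n : ℝ) ^ (5 / 2 - ε / 3) :=
          Real.rpow_le_rpow (by positivity) hm3 (by linarith)
  push_cast
  calc m ^ 6 * (bits n : ℝ) ^ 3 * (m + T)
      ≤ m ^ 6 * (C₁ * (n : ℝ) ^ (ε / 6)) * ((1 + C * 3 ^ (3 / 2 - ε)) * m ^ (3 / 2 - ε)) := by
        gcongr
        exact h₁ n hn
    _ = C₁ * (1 + C * 3 ^ (3 / 2 - ε)) * (n : ℝ) ^ (ε / 6) * (m ^ 6 * m ^ (3 / 2 - ε)) := by ring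
    _ ≤ C₁ * (1 + C * 3 ^ (3 / 2 - ε)) * (n : ℝ) ^ (ε / 6) *
          (8 ^ (5 / 2 - ε / 3) * (n : ℝ) ^ (5 / 2 - ε / 3)) := by gcongr
    _ = C₁ * (1 + C * 3 ^ (3 / 2 - ε)) * 8 ^ (5 / 2 - ε / 3) *
          ((n : ℝ) ^ (ε / 6) * (n : ℝ) ^ (5 / 2 - ε / 3)) := by ring
    _ = _ := by
        rw [← Real.rpow_add (by positivity)]
        congr 2
        ring

theorem ReducesToFactors.hasQuantumAlgorithm {Q : RamProblem} {c : ℕ} {pre cnt : List IntInstr}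
    (hQ : ReducesToFactors Q c pre cnt) {ε : ℝ} (hε : 0 < ε) (hε' : ε ≤ 1 / 2)
    (h : (minTriangle (3 * c + 5)).HasQuantumAlgorithm (3 / 2 - ε)) :
    Q.HasQuantumAlgorithm (5 / 2 - ε / 6) := by
  obtain ⟨P, κ, C, hκ, hP⟩ := h
  obtain ⟨C', hC'⟩ := time_le hε hε' |C| (abs_nonneg C)
  set B := max P.bound 2 with hB
  -- The summand `6 * κ` makes the words long enough for the calls, and `K + c + 41` with `K = c +
  -- 20` is what `params_ok` requires.
  refine ⟨fullProgram B c (c + 20) P pre cnt, 6 * κ + (c + 20 + c + 41),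
    timeConst B c (c + 20) pre.length cnt.length * C', by omega, fun n hn w hw x => ?_⟩
  have hl := bits_pos hn
  have hll := bits_le_log hn
  have hw' : (6 * κ + (c + 20 + c + 41)) * bits n ≤ w := (Nat.mul_le_mul_left _ hll).trans hw
  rw [add_mul] at hw'
  have ok : (params c (c + 20) n w).Ok := params_ok hn (by omega) (by omega)
  obtain ⟨A, A', R, tab, hA, hA', hR, hX, hpre, hcnt, hgood⟩ := hQ n w x
  replace hR := hR hn
  have hw6 : bits n + 5 ≤ w - 1 := by
    have : 41 * bits n ≤ (c + 20 + c + 41) * bits n := Nat.mul_le_mul_right _ (by omega)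
    omega
  have hnw : 8 * n < 2 ^ (w - 1) := by
    have := lt_two_pow_bits n
    calc 8 * n < 2 ^ (bits n + 5) := by rw [pow_add]; omega
      _ ≤ 2 ^ (w - 1) := Nat.pow_le_pow_right (by norm_num) hw6
  have hRw : R < 2 ^ w := (show R < w by omega).trans Nat.lt_two_pow_self
  -- An instance has `3 * m < 2 ^ (bits n + 5)` vertices, and `bits n + 5 ≤ 6 * bits n`.
  have hsub : κ * (Nat.log 2 (3 * cubeRoot n) + 1) ≤ w := by
    have h1 : Nat.log 2 (3 * cubeRoot n) < bits n + 5 :=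
      Nat.log_lt_of_lt_pow (by have := cubeRoot_pos hn; omega) (cubeRoot_lt hn)
    calc κ * (Nat.log 2 (3 * cubeRoot n) + 1) ≤ κ * (6 * bits n) :=
          Nat.mul_le_mul_left _ (by omega)
      _ = 6 * κ * bits n := by ring
      _ ≤ w := by omega
  set TP := ⌊|C| * ((3 * cubeRoot n : ℕ) : ℝ) ^ (3 / 2 - ε)⌋₊ with hTP
  have hcall : ∀ G : (minTriangle (3 * c + 5)).Inst (3 * cubeRoot n), ∃ t ≤ TP,
      P.HaltsWithin (3 * cubeRoot n) ((minTriangle (3 * c + 5)).input w G) t ∧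
      2 / 3 ≤ P.successProb (3 * cubeRoot n) ((minTriangle (3 * c + 5)).input w G) t
        ((minTriangle (3 * c + 5)).correct G) := fun G => by
    obtain ⟨t, ht, h'⟩ := hP (3 * cubeRoot n) (by have := cubeRoot_pos hn; omega) w hsub G
    refine ⟨t, Nat.le_floor (ht.trans ?_), h'⟩
    gcongr
    exact le_abs_self C
  have hb : ∀ s ≤ R, 4 * (2 ^ s * (n : ℤ) ^ c) ≤ (params c (c + 20) n w).top := fun s hs =>
    four_mul_le_params_top (hs.trans hR)
  have hpos : ∀ s, (0 : ℤ) < 2 ^ s * (n : ℤ) ^ c := fun s => by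
    have : (0 : ℤ) < n := by exact_mod_cast hn
    positivity
  have hbound := WMatrix.abs_le_of_factors_eq hA hA'
  have hprod : ∀ s < R, IsProduct (params c (c + 20) n w) (WMatrix.factors A A' s).1.pad
      (WMatrix.factors A A' s).2.pad (WMatrix.factors A A' (s + 1)).1.pad := fun s hs => by
    refine WMatrix.isProduct_pad ?_ fun i j z hz => ?_
    · rw [Params.N]; exact_mod_cast ok.n_le
    · have h1 := (hbound (s + 1)).1 i j z hz
      have h2 := hb (s + 1) hs
      have h3 := hpos (s + 1)
      omega
  have h0 : (n : ℤ) ^ c ≤ (params c (c + 20) n w).top := by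
    have h1 := hb 0 (by omega)
    have h2 := hpos 0
    rw [pow_zero, one_mul] at h1 h2
    omega
  have main := fullProgram_spec (X := Q.input w x) (B := B) (good := Q.correct x)
    (Z := fun s => ((WMatrix.factors A A' s).1.pad, (WMatrix.factors A A' s).2.pad))
    (show 1 ≤ w by omega) hn (by exact_mod_cast hnw) ok (le_max_right _ _) (le_max_left _ _) hcall
    (params_top_le hn) hX (fun σ hE ht => hpre _ ok rfl σ hE ht)
    (fun i j z hz => (WMatrix.abs_le_of_pad_eq hA i j z hz).trans h0)
    (fun i j z hz => (WMatrix.abs_le_of_pad_eq hA' i j z hz).trans h0)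
    (fun σ hσ => ⟨(hcnt σ hσ).1, (hcnt σ hσ).2.1 _, (hcnt σ hσ).2.2⟩) hRw
    (fun s hs => ⟨rfl, hprod s hs⟩) (error_le hn hR)
    (fun s hs => hgood s (WMatrix.isOutput_of_pad hs))
  refine ⟨_, ?_, main⟩
  have htime := fullTime_le (c := c) (K := c + 20) (w := w) hn hR B TP pre.length cnt.length
  calc _ ≤ ((timeConst B c (c + 20) pre.length cnt.length *
          (cubeRoot n ^ 6 * bits n ^ 3 * (cubeRoot n + TP)) : ℕ) : ℝ) := Nat.cast_le.2 htime
    _ ≤ timeConst B c (c + 20) pre.length cnt.length * (C' * (n : ℝ) ^ (5 / 2 - ε / 6)) := by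
        rw [Nat.cast_mul]
        exact mul_le_mul_of_nonneg_left (hC' n hn TP (Nat.floor_le (by positivity)))
          (Nat.cast_nonneg _)
    _ = _ := by ring

theorem mainTheorem7
    (h : ∃ ε : ℝ, 0 < ε ∧ ∀ c : ℕ, (minTriangle c).HasQuantumAlgorithm (3 / 2 - ε)) :
    ∃ δ : ℝ, 0 < δ ∧ ∀ c : ℕ,
      (distanceProduct c).HasQuantumAlgorithm (5 / 2 - δ) ∧
      (allPairsShortestPaths c).HasQuantumAlgorithm (5 / 2 - δ) := by
  obtain ⟨ε, hε, h⟩ := h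
  -- A larger saving may be weakened, as required by `time_le`; the resulting `δ` does not depend on
  -- `c`.
  have h' : ∀ c, (minTriangle c).HasQuantumAlgorithm (3 / 2 - min ε (1 / 2)) := fun c =>
    (h c).mono (by linarith [min_le_left ε (1 / 2)])
  have hε' : 0 < min ε (1 / 2) := lt_min hε (by norm_num)
  exact ⟨min ε (1 / 2) / 6, by positivity, fun c =>
    ⟨(reducesToFactors_distanceProduct c).hasQuantumAlgorithm hε' (min_le_right _ _) (h' _),
      (reducesToFactors_allPairsShortestPaths c).hasQuantumAlgorithm hε' (min_le_right _ _) (h' _)⟩⟩
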